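/- Let $\mathbb H$ be the quaternions, $S^3\subset\mathbb H$ the group of unit quaternions, $S^7\subset\mathbb H^2$ and $S^4\subset\mathbb R\times\mathbb H$ the unit spheres, and $h,\tilde h:S^7\to S^4$ the maps $h(a,b)=(|a|^2-|b|^2,\,2a\bar b)$ and $\tilde h(a,b)=(|a|^2-|b|^2,\,2\bar a b)$. Let $Sp(2)$ be the group of quaternionic unitary $2\times 2$ matrices, and for $m\ge 2$ put $$Sp(2,m)=\{(u_1,\dots,u_m)\in (S^7)^m \mid h(u_1)=-h(u_2),\ \tilde h(u_i)=-h(u_{i+1})\text{ for } 2\le i\le m-1\}.$$ Let $m>2$. Then: 1. $Sp(2,m)$ is a smooth embedded submanifold of $(\mathbb H^2)^m$ of dimension $3m+4$. 2. The map $Sp(2,m)\to Sp(2,m-1)$, $(u_1,\dots,u_m)\mapsto(u_1,\dots,u_{m-1})$, with the $S^3$-action $q\cdot(u_1,\dots,u_m)=(u_1,\dots,u_{m-1},u_m\bar q)$, is a trivial smooth principal $S^3$-bundle: there is an $S^3$-equivariant diffeomorphism $Sp(2,m-1)\times S^3\to Sp(2,m)$ over $Sp(2,m-1)$. 3. $Sp(2,m)$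 is diffeomorphic to $(S^3)^{m-2}\times Sp(2)$. 4. $Sp(2,m)$ admits a Riemannian metric of positive Ricci curvature that is invariant under the action of $S^3\times(S^3)^m$ given by $$(p;q_1,\dots,q_m)\cdot(u_1,\dots,u_m)=(p\,u_1\bar q_1,\ p\,u_2\bar q_2,\ q_2u_3\bar q_3,\ \dots,\ q_{m-1}u_m\bar q_m);$$ in particular it is invariant under the $(S^3)^m$-action obtained by setting $p=1$. -/

import Mathlib

open scoped Quaternion ContDiff

noncomputable section

namespace Wilhelm

/-! ### Embedded submanifolds, diffeomorphisms, Riemannian metrics, Ricci curvature -/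

section Submanifolds

variable {E F : Type*} [NormedAddCommGroup E] [NormedSpace ℝ E]
  [NormedAddCommGroup F] [NormedSpace ℝ F]

/-- `φ : U → S`, with `U` open in `ℝ^d`, is a local parametrization of `S ⊆ E`: a smooth immersion
that is a homeomorphism of `U` onto a relatively open subset of `S`. -/
def IsLocalParam {d : ℕ} (S : Set E) (U : Set (Fin d → ℝ)) (φ : (Fin d → ℝ) → E) : Prop :=
  IsOpen U ∧ ContDiffOn ℝ ∞ φ U ∧ (∀ x ∈ U, Function.Injective (fderiv ℝ φ x)) ∧
    (∃ W : Set E, IsOpen W ∧ φ '' U = S ∩ W) ∧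
    ∃ ψ : E → (Fin d → ℝ), ContinuousOn ψ (φ '' U) ∧ Set.LeftInvOn ψ φ U

/-- `S` is a smooth embedded `d`-dimensional submanifold of `E`. -/
def IsSubmanifold (d : ℕ) (S : Set E) : Prop :=
  ∀ p ∈ S, ∃ (U : Set (Fin d → ℝ)) (φ : (Fin d → ℝ) → E), IsLocalParam S U φ ∧ p ∈ φ '' U

/-- `f` restricts to a diffeomorphism from the submanifold `S` onto the submanifold `T`. The values
of `f` and of its inverse `k` off `S` and `T` are irrelevant. -/
def IsDiffeo (f : E → F) (S : Set E) (T : Set F) : Prop :=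
  ContDiffOn ℝ ∞ f S ∧ Set.MapsTo f S T ∧
    ∃ k : F → E, ContDiffOn ℝ ∞ k T ∧ Set.MapsTo k T S ∧
      Set.LeftInvOn k f S ∧ Set.RightInvOn k f T

/-- The submanifolds `S` and `T` are diffeomorphic. -/
def AreDiffeomorphic (S : Set E) (T : Set F) : Prop := ∃ f : E → F, IsDiffeo f S T

/-- The tangent space of `S` at `p`: the velocities at `p` of smooth curves in `S`. -/
def tangentVectors (S : Set E) (p : E) : Set E :=
  {v | ∃ (ε : ℝ) (c : ℝ → E), 0 < ε ∧ ContDiffOn ℝ ∞ c (Set.Ioo (-ε) ε) ∧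
    (∀ t ∈ Set.Ioo (-ε) ε, c t ∈ S) ∧ c 0 = p ∧ HasDerivAt c v 0}

/-- `g` is a smooth Riemannian metric on the submanifold `S`. Only the restriction of `g p`
to the tangent space at `p ∈ S` carries information. -/
def IsRiemannianMetric (S : Set E) (g : E → E →L[ℝ] E →L[ℝ] ℝ) : Prop :=
  ContDiffOn ℝ ∞ g S ∧ ∀ p ∈ S,
    (∀ v ∈ tangentVectors S p, ∀ w ∈ tangentVectors S p, g p v w = g p w v) ∧
    (∀ v ∈ tangentVectors S p, v ≠ 0 → 0 < g p v v)

/-- The transformation `A` maps `S` into itself and preserves the Riemannian metric `g`. -/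
def PreservesMetric (S : Set E) (g : E → E →L[ℝ] E →L[ℝ] ℝ) (A : E → E) : Prop :=
  Set.MapsTo A S S ∧ ∀ p ∈ S, ∀ v ∈ tangentVectors S p, ∀ w ∈ tangentVectors S p,
    g (A p) (fderiv ℝ A p v) (fderiv ℝ A p w) = g p v w

/-- The partial derivative `∂_i f`. -/
def pderiv {d : ℕ} (i : Fin d) (f : (Fin d → ℝ) → ℝ) (x : Fin d → ℝ) : ℝ :=
  fderiv ℝ f x (Pi.single i 1)

/-- The matrix `g_{ij}` of the metric `g` in the local parametrization `φ`. -/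
def metricCoeff {d : ℕ} (g : E → E →L[ℝ] E →L[ℝ] ℝ) (φ : (Fin d → ℝ) → E) (x : Fin d → ℝ) :
    Matrix (Fin d) (Fin d) ℝ :=
  Matrix.of fun i j => g (φ x) (fderiv ℝ φ x (Pi.single i 1)) (fderiv ℝ φ x (Pi.single j 1))

/-- The Christoffel symbols `Γ^k_{ij}` of a metric `G` on an open subset of `ℝ^d`. -/
def christoffel {d : ℕ} (G : (Fin d → ℝ) → Matrix (Fin d) (Fin d) ℝ) (k i j : Fin d)
    (x : Fin d → ℝ) : ℝ :=
  (1 / 2) * ∑ l, (G x)⁻¹ k l *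
    (pderiv i (fun y => G y j l) x + pderiv j (fun y => G y i l) x - pderiv l (fun y => G y i j) x)

/-- The coefficients `R_{ij}` of the Ricci tensor of a metric `G` on an open subset of `ℝ^d`. -/
def ricci {d : ℕ} (G : (Fin d → ℝ) → Matrix (Fin d) (Fin d) ℝ) (i j : Fin d)
    (x : Fin d → ℝ) : ℝ :=
  ∑ k, (pderiv k (christoffel G k i j) x - pderiv j (christoffel G k i k) x +
    ∑ l, (christoffel G k k l x * christoffel G l i j x -
      christoffel G k j l x * christoffel G l i k x))

/-- The metric `g` on the `d`-dimensional submanifold `S` has positive Ricci curvature: at each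
point, the Ricci tensor is positive definite when computed in a local parametrization around
the point (being a tensor, it is then so in every such parametrization). -/
def HasPosRicci (d : ℕ) (S : Set E) (g : E → E →L[ℝ] E →L[ℝ] ℝ) : Prop :=
  ∀ p ∈ S, ∃ (U : Set (Fin d → ℝ)) (φ : (Fin d → ℝ) → E) (x : Fin d → ℝ),
    IsLocalParam S U φ ∧ x ∈ U ∧ φ x = p ∧
      ∀ v : Fin d → ℝ, v ≠ 0 → 0 < ∑ i, ∑ j, ricci (metricCoeff g φ) i j x * v i * v j

end Submanifolds

/-! ### Spheres, Hopf maps, `Sp(2)` and `Sp(2,m)` -/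

/-- The group of unit quaternions. -/
def S3 : Set ℍ[ℝ] := Metric.sphere 0 1

/-- The unit sphere of `ℍ²`. -/
def S7 : Set (ℍ[ℝ] × ℍ[ℝ]) := {u | ‖u.1‖ ^ 2 + ‖u.2‖ ^ 2 = 1}

/-- `h (a, b) = (|a|² - |b|², 2 a b̄)`. -/
def hopf (u : ℍ[ℝ] × ℍ[ℝ]) : ℝ × ℍ[ℝ] := (‖u.1‖ ^ 2 - ‖u.2‖ ^ 2, 2 * (u.1 * star u.2))

/-- `h̃ (a, b) = (|a|² - |b|², 2 ā b)`. -/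
def hopfTilde (u : ℍ[ℝ] × ℍ[ℝ]) : ℝ × ℍ[ℝ] := (‖u.1‖ ^ 2 - ‖u.2‖ ^ 2, 2 * (star u.1 * u.2))

/-- `Sp(2)`: pairs of columns `((a, b), (c, d))` of quaternionic unitary `2 × 2` matrices. -/
def Sp2 : Set ((ℍ[ℝ] × ℍ[ℝ]) × (ℍ[ℝ] × ℍ[ℝ])) :=
  {Q | !![Q.1.1, Q.2.1; Q.1.2, Q.2.2] ∈ unitary (Matrix (Fin 2) (Fin 2) ℍ[ℝ])}

/-- `Sp(2,m)`: the `(u_1, …, u_m) ∈ (S⁷)^m` with `h(u_1) = -h(u_2)` and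
`h̃(u_i) = -h(u_{i+1})` for `2 ≤ i < m`; here the indices start at `0`. -/
def Sp2m (m : ℕ) : Set (Fin m → ℍ[ℝ] × ℍ[ℝ]) :=
  {u | (∀ i, u i ∈ S7) ∧ ∀ i j : Fin m, (j : ℕ) = (i : ℕ) + 1 →
    (if (i : ℕ) = 0 then hopf (u i) else hopfTilde (u i)) = -hopf (u j)}

/-- The product `(S³)^n`. -/
def S3pow (n : ℕ) : Set (Fin n → ℍ[ℝ]) := {q | ∀ i, q i ∈ S3}

/-- The projection `(u_1, …, u_m) ↦ (u_1, …, u_{m-1})`. -/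
def forgetLast (m : ℕ) (u : Fin m → ℍ[ℝ] × ℍ[ℝ]) : Fin (m - 1) → ℍ[ℝ] × ℍ[ℝ] :=
  fun i => u ⟨i, lt_of_lt_of_le i.isLt (Nat.sub_le m 1)⟩

/-- `a u b̄` for `u ∈ ℍ²`, with quaternions `a`, `b`. -/
def twoSided (a b : ℍ[ℝ]) (u : ℍ[ℝ] × ℍ[ℝ]) : ℍ[ℝ] × ℍ[ℝ] := (a * u.1 * star b, a * u.2 * star b)

/-- The principal action `q · (u_1, …, u_m) = (u_1, …, u_{m-1}, u_m q̄)`. -/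
def lastAction (m : ℕ) (q : ℍ[ℝ]) (u : Fin m → ℍ[ℝ] × ℍ[ℝ]) : Fin m → ℍ[ℝ] × ℍ[ℝ] :=
  fun i => if (i : ℕ) + 1 = m then twoSided 1 q (u i) else u i

/-- The action of `(p; q_1, …, q_m) ∈ S³ × (S³)^m`,
`(u_1, …, u_m) ↦ (p u_1 q̄_1, p u_2 q̄_2, q_2 u_3 q̄_3, …, q_{m-1} u_m q̄_m)`. The case `p = 1` is the
principal `(S³)^m`-action over `S⁴`. -/
def wilhelmAction (m : ℕ) (p : ℍ[ℝ]) (q : Fin m → ℍ[ℝ]) (u : Fin m → ℍ[ℝ] × ℍ[ℝ]) :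
    Fin m → ℍ[ℝ] × ℍ[ℝ] :=
  fun i => twoSided
    (if (i : ℕ) < 2 then p else q ⟨(i : ℕ) - 1, lt_of_le_of_lt (Nat.sub_le _ _) i.isLt⟩) (q i) (u i)

/-- `π : P → B`, with the action `act` of `S³` on `P`, is a trivial smooth principal `S³`-bundle:
there is an equivariant diffeomorphism `B × S³ → P` over `B`, where `S³` acts on `B × S³` by
multiplication on the second factor. -/
def IsTrivialPrincipalS3Bundle {E F : Type*} [NormedAddCommGroup E] [NormedSpace ℝ E]
    [NormedAddCommGroup F] [NormedSpace ℝ F] (P : Set E) (B : Set F) (π : E → F)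
    (act : ℍ[ℝ] → E → E) : Prop :=
  ∃ Ψ : F × ℍ[ℝ] → E, IsDiffeo Ψ (B ×ˢ S3) P ∧
    ∀ b ∈ B, ∀ s ∈ S3, π (Ψ (b, s)) = b ∧ ∀ q ∈ S3, Ψ (b, q * s) = act q (Ψ (b, s))

end Wilhelm

end

/-!
Two unit columns `x`, `y` satisfy `h x = -h y` exactly when they are orthogonal for the Hermitian
product of `ℍ²`, and `h̃ x = h (star x)`. Hence `u_3, u_4, …` each range over the unit columns
orthogonal to the conjugate of the previous one, an `S³`-bundle. It is trivial because the identity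
of `ℍ²` can be joined to the conjugation by orthogonal maps: the column orthogonal to `u_i` that
comes from `u_{i-1}` is transported along the path, by repeated projection, to a column orthogonal
to the conjugate of `u_i`.

For the Ricci curvature, `Sp(2,m)` is a principal `(S³)^m`-bundle over `S⁴`. Use a connection metric
with round fibres of radius `t`. In a local section along which the connection form vanishes
radially to second order, its 2-jet at the centre gives Ricci curvature `12 + O(t²)` on the
horizontal and at least `2 / t²` on the vertical vectors, with mixed terms `O(t)`. The bounds are
uniform because `Sp(2,m)` is compact, so the Ricci curvature is positive for small `t`.
-/

open scoped RightActions Topology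
open MulOpposite (op)

noncomputable section

namespace Wilhelm

instance : StarModule ℝ ℍ[ℝ] := ⟨fun r a => by simp⟩

/-! ### The Hermitian product of `ℍ²` -/

/-- The Hermitian product `x* y` of two columns `x`, `y` of `ℍ²`, conjugate linear in `x` and linear
in `y` for the multiplication of columns by quaternions from the right. -/
def herm (x y : ℍ[ℝ] × ℍ[ℝ]) : ℍ[ℝ] := star x.1 * y.1 + star x.2 * y.2

section Herm

variable (x y z : ℍ[ℝ] × ℍ[ℝ]) (a b : ℍ[ℝ]) (r : ℝ)

lemma star_herm : star (herm x y) = herm y x := by simp [herm]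

lemma herm_op_smul_right : herm x (y <• b) = herm x y * b := by simp [herm, add_mul, mul_assoc]

lemma herm_op_smul_left : herm (x <• b) y = star b * herm x y := by
  simp [herm, mul_add, mul_assoc]

lemma herm_smul_left : herm (a • x) y = herm x (star a • y) := by simp [herm, mul_assoc]

lemma herm_add_right : herm x (y + z) = herm x y + herm x z := by simp [herm, mul_add]; abel

lemma herm_sub_right : herm x (y - z) = herm x y - herm x z := by simp [herm, mul_sub]; abel

lemma herm_add_left : herm (x + y) z = herm x z + herm y z := by simp [herm, add_mul]; abel

lemma herm_sub_left : herm (x - y) z = herm x z - herm y z := by simp [herm, sub_mul]; abel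

lemma herm_real_smul_right : herm x (r • y) = r • herm x y := by simp [herm]

lemma herm_real_smul_left : herm (r • x) y = r • herm x y := by simp [herm]

@[simp] lemma herm_zero_right : herm x 0 = 0 := by simp [herm]

lemma star_smul_column : star (a • x) = star x <• star a := by ext1 <;> simp

lemma star_op_smul_column : star (x <• a) = star a • star x := by ext1 <;> simp

lemma op_real_smul : x <• (r • a) = r • (x <• a) := by simp

lemma twoSided_eq : twoSided a b x = (a • x) <• star b := rfl

lemma star_mul_self_eq_norm_sq : star a * a = ((‖a‖ ^ 2 : ℝ) : ℍ[ℝ]) := by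
  rw [Quaternion.star_mul_self, Quaternion.normSq_eq_norm_mul_self, sq]

lemma mul_star_self_eq_norm_sq : a * star a = ((‖a‖ ^ 2 : ℝ) : ℍ[ℝ]) := by
  rw [Quaternion.self_mul_star, Quaternion.normSq_eq_norm_mul_self, sq]

lemma herm_self : herm x x = ((‖x.1‖ ^ 2 + ‖x.2‖ ^ 2 : ℝ) : ℍ[ℝ]) := by
  rw [herm, star_mul_self_eq_norm_sq, star_mul_self_eq_norm_sq, Quaternion.coe_add]

lemma herm_star_self : herm (star x) (star x) = herm x x := by simp [herm_self]

variable {x y z a b}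

lemma coe_eq_one_iff : (r : ℍ[ℝ]) = 1 ↔ r = 1 := by
  rw [← Quaternion.coe_one, Quaternion.coe_injective.eq_iff]

lemma mem_S7_iff : x ∈ S7 ↔ herm x x = 1 := by
  rw [herm_self, coe_eq_one_iff, S7, Set.mem_ofPred_eq]

lemma mem_S3_iff : a ∈ S3 ↔ ‖a‖ = 1 := mem_sphere_zero_iff_norm

lemma star_mul_self_eq_one_iff : star a * a = 1 ↔ ‖a‖ = 1 := by
  rw [star_mul_self_eq_norm_sq, coe_eq_one_iff,
    pow_eq_one_iff_of_nonneg (norm_nonneg a) two_ne_zero]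

lemma mul_star_self_eq_one_iff : a * star a = 1 ↔ ‖a‖ = 1 := by
  rw [← norm_star a, ← star_mul_self_eq_one_iff, star_star]

lemma star_smul_smul (h : ‖a‖ = 1) : star a • a • x = x := by
  rw [smul_smul, star_mul_self_eq_one_iff.2 h, one_smul]

lemma herm_smul_smul (h : ‖a‖ = 1) : herm (a • x) (a • y) = herm x y := by
  rw [herm_smul_left, star_smul_smul h]

/-! ### Hopf fibres and orthogonality -/

lemma hopfTilde_eq_hopf_star : hopfTilde x = hopf (star x) := by simp [hopfTilde, hopf]

lemma norm_sq_hopf_add : ((hopf x).1 + (hopf y).1) ^ 2 + ‖(hopf x).2 + (hopf y).2‖ ^ 2 =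
    4 * ‖herm x y‖ ^ 2 + (‖x.1‖ ^ 2 + ‖x.2‖ ^ 2 - (‖y.1‖ ^ 2 + ‖y.2‖ ^ 2)) ^ 2 := by
  have norm_two : ‖(2 : ℍ[ℝ])‖ = 2 := (norm_algebraMap' ℍ[ℝ] (2 : ℝ)).trans (by norm_num)
  rw [hopf, hopf, ← mul_add, norm_mul, mul_pow, norm_two]
  simp only [herm, sq ‖_‖, ← Quaternion.normSq_eq_norm_mul_self, Quaternion.normSq_def',
    Quaternion.re_add, Quaternion.imI_add, Quaternion.imJ_add, Quaternion.imK_add,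
    Quaternion.re_mul, Quaternion.imI_mul, Quaternion.imJ_mul, Quaternion.imK_mul,
    Quaternion.re_star, Quaternion.imI_star, Quaternion.imJ_star, Quaternion.imK_star]
  ring

lemma hopf_eq_neg_hopf_iff (hx : herm x x = 1) (hy : herm y y = 1) :
    hopf x = -hopf y ↔ herm x y = 0 := by
  have key := norm_sq_hopf_add (x := x) (y := y)
  rw [show ‖x.1‖ ^ 2 + ‖x.2‖ ^ 2 = 1 from mem_S7_iff.2 hx,
    show ‖y.1‖ ^ 2 + ‖y.2‖ ^ 2 = 1 from mem_S7_iff.2 hy, sub_self] at key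
  rw [eq_neg_iff_add_eq_zero, Prod.ext_iff, Prod.fst_add, Prod.snd_add, Prod.fst_zero,
    Prod.snd_zero]
  refine ⟨fun ⟨h₁, h₂⟩ => ?_, fun h => ?_⟩
  · rw [h₁, h₂] at key
    exact norm_eq_zero.1 (pow_eq_zero_iff two_ne_zero |>.1 (by simp at key ⊢; simpa using key))
  · rw [h, norm_zero] at key
    constructor
    · nlinarith [sq_nonneg ‖(hopf x).2 + (hopf y).2‖]
    · exact norm_eq_zero.1 (by nlinarith [sq_nonneg ((hopf x).1 + (hopf y).1)])

lemma hopfTilde_eq_neg_hopf_iff (hx : herm x x = 1) (hy : herm y y = 1) :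
    hopfTilde x = -hopf y ↔ herm (star x) y = 0 := by
  rw [hopfTilde_eq_hopf_star, hopf_eq_neg_hopf_iff (by rw [herm_star_self, hx]) hy]

end Herm

/-- `x` and `y` are the columns of a quaternionic unitary `2 × 2` matrix. -/
structure OrthonormalPair (x y : ℍ[ℝ] × ℍ[ℝ]) : Prop where
  herm_left : herm x x = 1
  herm_right : herm y y = 1
  herm_eq_zero : herm x y = 0

lemma OrthonormalPair.symm {x y : ℍ[ℝ] × ℍ[ℝ]} (h : OrthonormalPair x y) : OrthonormalPair y x :=
  ⟨h.herm_right, h.herm_left, by rw [← star_herm, h.herm_eq_zero, star_zero]⟩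

lemma mem_Sp2_iff {x y : ℍ[ℝ] × ℍ[ℝ]} : (x, y) ∈ Sp2 ↔ OrthonormalPair x y := by
  rw [Sp2, Set.mem_ofPred_eq, Unitary.mem_iff, and_iff_left_of_imp mul_eq_one_comm.1,
    ← Matrix.ext_iff]
  simp only [Fin.forall_fin_two, Matrix.mul_apply, Fin.sum_univ_two, Matrix.star_apply,
    Matrix.of_apply, Matrix.cons_val', Matrix.cons_val_zero, Matrix.cons_val_one,
    Matrix.cons_val_fin_one, Matrix.one_apply_eq, Matrix.one_apply_ne zero_ne_one,
    Matrix.one_apply_ne one_ne_zero]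
  exact ⟨fun ⟨⟨hx, hxy⟩, _, hy⟩ => ⟨hx, hy, hxy⟩, fun h =>
    ⟨⟨h.herm_left, h.herm_eq_zero⟩, h.symm.herm_eq_zero, h.herm_right⟩⟩

lemma OrthonormalPair.expand {x y : ℍ[ℝ] × ℍ[ℝ]} (h : OrthonormalPair x y) (v : ℍ[ℝ] × ℍ[ℝ]) :
    x <• herm x v + y <• herm y v = v := by
  have hrows := congrArg (Matrix.mulVec · ![v.1, v.2]) (Unitary.mem_iff.1 (mem_Sp2_iff.2 h)).2
  simp only [Matrix.one_mulVec, ← Matrix.mulVec_mulVec] at hrows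
  ext1
  · simpa [Matrix.mulVec, herm, Matrix.vecHead, Matrix.vecTail] using congrFun hrows 0
  · simpa [Matrix.mulVec, herm, Matrix.vecHead, Matrix.vecTail] using congrFun hrows 1

section Smooth

variable {E : Type*} [NormedAddCommGroup E] [NormedSpace ℝ E] {n : WithTop ℕ∞}
  {f g : E → ℍ[ℝ] × ℍ[ℝ]} {a : E → ℍ[ℝ]} {x : E}

@[fun_prop]
lemma contDiffAt_star {F : Type*} [NormedAddCommGroup F] [NormedSpace ℝ F] [StarAddMonoid F]
    [StarModule ℝ F] [ContinuousStar F] {f : E → F} (hf : ContDiffAt ℝ n f x) :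
    ContDiffAt ℝ n (fun x => star (f x)) x :=
  (starL' ℝ : F ≃L[ℝ] F).contDiff.contDiffAt.comp x hf

@[fun_prop]
lemma contDiffAt_re (ha : ContDiffAt ℝ n a x) : ContDiffAt ℝ n (fun x => (a x).re) x := by
  have h : ContDiffAt ℝ n (fun x => inner ℝ (a x) 1) x := ha.inner ℝ contDiffAt_const
  simpa [Quaternion.inner_def] using h

@[fun_prop]
lemma contDiffAt_op_smul (hf : ContDiffAt ℝ n f x) (ha : ContDiffAt ℝ n a x) :
    ContDiffAt ℝ n (fun x => f x <• a x) x :=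
  ContDiffAt.smul ((MulOpposite.opContinuousLinearEquiv ℝ).contDiff.contDiffAt.comp x ha) hf

@[fun_prop]
lemma contDiffAt_herm (hf : ContDiffAt ℝ n f x) (hg : ContDiffAt ℝ n g x) :
    ContDiffAt ℝ n (fun x => herm (f x) (g x)) x := by
  unfold herm; fun_prop

end Smooth

/-- The column to which orthogonality of `u_{i+1}` is required of a point `u` of `Sp(2,m)`:
`u_i` itself for `i = 0`, and its conjugate for `i > 0`. -/
def link (i : ℕ) (x : ℍ[ℝ] × ℍ[ℝ]) : ℍ[ℝ] × ℍ[ℝ] := if i = 0 then x else star x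

lemma mem_Sp2m_iff {m : ℕ} {u : Fin m → ℍ[ℝ] × ℍ[ℝ]} :
    u ∈ Sp2m m ↔ (∀ i, herm (u i) (u i) = 1) ∧
      ∀ i j : Fin m, (j : ℕ) = (i : ℕ) + 1 → herm (link i (u i)) (u j) = 0 := by
  simp only [Sp2m, Set.mem_ofPred_eq, mem_S7_iff, link]
  refine and_congr_right fun h => forall_congr' fun i => forall_congr' fun j =>
    imp_congr_right fun _ => ?_
  split_ifs
  · exact hopf_eq_neg_hopf_iff (h i) (h j)
  · exact hopfTilde_eq_neg_hopf_iff (h i) (h j)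

lemma herm_link_self (i : ℕ) (x : ℍ[ℝ] × ℍ[ℝ]) : herm (link i x) (link i x) = herm x x := by
  unfold link; split_ifs
  · rfl
  · exact herm_star_self x

/-! ### Orthogonal projection of columns -/

/-- The squared length of a column. -/
def normSq (x : ℍ[ℝ] × ℍ[ℝ]) : ℝ := ‖x.1‖ ^ 2 + ‖x.2‖ ^ 2

/-- The component of `y` orthogonal to the unit column `x`. -/
def orthComp (x y : ℍ[ℝ] × ℍ[ℝ]) : ℍ[ℝ] × ℍ[ℝ] := y - x <• herm x y

/-- The normalized component of `y` orthogonal to the unit column `x`; it is `0` if `y` is a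
multiple of `x`. -/
def unitOrthComp (x y : ℍ[ℝ] × ℍ[ℝ]) : ℍ[ℝ] × ℍ[ℝ] := (√(normSq (orthComp x y)))⁻¹ • orthComp x y

section Projection

variable {x x' y : ℍ[ℝ] × ℍ[ℝ]}

lemma herm_self_eq_normSq (x : ℍ[ℝ] × ℍ[ℝ]) : herm x x = (normSq x : ℍ[ℝ]) := herm_self x

lemma normSq_pos_iff : 0 < normSq x ↔ x ≠ 0 := by
  refine ⟨by rintro h rfl; simp [normSq] at h, fun h => ?_⟩
  rcases not_and_or.1 (mt Prod.ext_iff.2 h) with h | h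
  · have := norm_pos_iff.2 h
    unfold normSq; positivity
  · have := norm_pos_iff.2 h
    unfold normSq; positivity

lemma orthComp_eq_self (h : herm x y = 0) : orthComp x y = y := by
  rw [orthComp, h, MulOpposite.op_zero, zero_smul, sub_zero]

lemma herm_orthComp (hx : herm x x = 1) : herm x (orthComp x y) = 0 := by
  rw [orthComp, herm_sub_right, herm_op_smul_right, hx, one_mul, sub_self]

lemma herm_unitOrthComp (hx : herm x x = 1) : herm x (unitOrthComp x y) = 0 := by
  rw [unitOrthComp, herm_real_smul_right, herm_orthComp hx, smul_zero]

lemma herm_unitOrthComp_self (h : orthComp x y ≠ 0) :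
    herm (unitOrthComp x y) (unitOrthComp x y) = 1 := by
  have hpos := normSq_pos_iff.2 h
  rw [unitOrthComp, herm_real_smul_right, herm_real_smul_left, herm_self_eq_normSq, smul_smul,
    ← Quaternion.coe_smul, coe_eq_one_iff, smul_eq_mul, ← mul_inv, Real.mul_self_sqrt hpos.le,
    inv_mul_cancel₀ hpos.ne']

lemma OrthonormalPair.orthComp_ne_zero (h : OrthonormalPair x y) (hx' : herm x x' ≠ 0) :
    orthComp x' y ≠ 0 := by
  intro h₀
  have hy : y = x' <• herm x' y := sub_eq_zero.1 h₀
  have hprod : herm x x' * herm x' y = 0 := by rw [← herm_op_smul_right, ← hy, h.herm_eq_zero]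
  rw [(mul_eq_zero.1 hprod).resolve_left hx', MulOpposite.op_zero, zero_smul] at hy
  simpa [hy] using h.herm_right

lemma OrthonormalPair.unitOrthComp (h : OrthonormalPair x y) (hx' : herm x' x' = 1)
    (hxx' : herm x x' ≠ 0) : OrthonormalPair x' (unitOrthComp x' y) :=
  ⟨hx', herm_unitOrthComp_self (h.orthComp_ne_zero hxx'), herm_unitOrthComp hx'⟩

variable {E : Type*} [NormedAddCommGroup E] [NormedSpace ℝ E] {n : WithTop ℕ∞}
  {f g : E → ℍ[ℝ] × ℍ[ℝ]} {e : E}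

@[fun_prop]
lemma contDiffAt_normSq (hf : ContDiffAt ℝ n f e) : ContDiffAt ℝ n (fun e => normSq (f e)) e :=
  (hf.fst.norm_sq ℝ).add (hf.snd.norm_sq ℝ)

@[fun_prop]
lemma contDiffAt_orthComp (hf : ContDiffAt ℝ n f e) (hg : ContDiffAt ℝ n g e) :
    ContDiffAt ℝ n (fun e => orthComp (f e) (g e)) e := by
  unfold orthComp; fun_prop

lemma contDiffAt_unitOrthComp (hf : ContDiffAt ℝ n f e) (hg : ContDiffAt ℝ n g e)
    (h : orthComp (f e) (g e) ≠ 0) : ContDiffAt ℝ n (fun e => unitOrthComp (f e) (g e)) e := by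
  have hpos := normSq_pos_iff.2 h
  have hsqrt : ContDiffAt ℝ n (fun e => √(normSq (orthComp (f e) (g e)))) e :=
    ContDiffAt.sqrt (by fun_prop) hpos.ne'
  exact (hsqrt.inv (Real.sqrt_pos.2 hpos).ne').smul (contDiffAt_orthComp hf hg)

end Projection

/-! ### A path from the identity to conjugation -/

/-- The rotation of `ℍ²` by the angle `θ` in the three coordinate planes of `Im ℍ ⊕ Im ℍ = ℝ³ ⊗ ℝ²`.
It joins the identity to the conjugation `star`. -/
def imRotation (θ : ℝ) (x : ℍ[ℝ] × ℍ[ℝ]) : ℍ[ℝ] × ℍ[ℝ] :=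
  ((x.1.re : ℍ[ℝ]) + Real.cos θ • x.1.im - Real.sin θ • x.2.im,
    (x.2.re : ℍ[ℝ]) + Real.cos θ • x.2.im + Real.sin θ • x.1.im)

section ImRotation

variable (θ φ : ℝ) (x : ℍ[ℝ] × ℍ[ℝ])

lemma imRotation_zero : imRotation 0 x = x := by simp [imRotation]

lemma imRotation_add : imRotation (θ + φ) x = imRotation θ (imRotation φ x) := by
  ext <;> simp [imRotation, Real.cos_add, Real.sin_add] <;> ring

lemma imRotation_pi : imRotation Real.pi x = star x := by
  ext <;> simp [imRotation]

lemma normSq_imRotation : normSq (imRotation θ x) = normSq x := by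
  simp only [normSq, imRotation, sq ‖_‖, ← Quaternion.normSq_eq_norm_mul_self,
    Quaternion.normSq_def']
  simp
  linear_combination (x.1.imI ^ 2 + x.1.imJ ^ 2 + x.1.imK ^ 2 + x.2.imI ^ 2 + x.2.imJ ^ 2 +
    x.2.imK ^ 2) * Real.sin_sq_add_cos_sq θ

lemma cos_mul_normSq_le_re_herm_imRotation :
    Real.cos θ * normSq x ≤ (herm x (imRotation θ x)).re := by
  have hre : (herm x (imRotation θ x)).re =
      Real.cos θ * normSq x + (1 - Real.cos θ) * (x.1.re ^ 2 + x.2.re ^ 2) := by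
    simp only [normSq, herm, imRotation, sq ‖_‖, ← Quaternion.normSq_eq_norm_mul_self,
      Quaternion.normSq_def']
    simp
    ring
  rw [hre]
  have := mul_nonneg (sub_nonneg.2 (Real.cos_le_one θ))
    (add_nonneg (sq_nonneg x.1.re) (sq_nonneg x.2.re))
  linarith

variable {E : Type*} [NormedAddCommGroup E] [NormedSpace ℝ E] {n : WithTop ℕ∞}
  {f : E → ℍ[ℝ] × ℍ[ℝ]} {e : E}

@[fun_prop]
lemma contDiffAt_imRotation (hf : ContDiffAt ℝ n f e) :
    ContDiffAt ℝ n (fun e => imRotation θ (f e)) e := by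
  have him (a : ℍ[ℝ]) : a.im = a - (a.re : ℍ[ℝ]) := by simp
  have hcoe : ContDiff ℝ n fun r : ℝ => (r : ℍ[ℝ]) :=
    (Algebra.linearMap ℝ ℍ[ℝ]).toContinuousLinearMap.contDiff
  unfold imRotation
  simp only [him]
  fun_prop

end ImRotation

/-- One step in the transport of the second column of an orthonormal pair along the path
`θ ↦ imRotation θ x` of first columns. The angle `π / 3` is acute, so that the columns before and
after the step are not orthogonal, and three steps end at `star x`. -/
def transportStep (z : (ℍ[ℝ] × ℍ[ℝ]) × ℍ[ℝ] × ℍ[ℝ]) : (ℍ[ℝ] × ℍ[ℝ]) × ℍ[ℝ] × ℍ[ℝ] :=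
  (imRotation (Real.pi / 3) z.1, unitOrthComp (imRotation (Real.pi / 3) z.1) z.2)

section Transport

variable {x y : ℍ[ℝ] × ℍ[ℝ]} {z : (ℍ[ℝ] × ℍ[ℝ]) × ℍ[ℝ] × ℍ[ℝ]}

lemma transportStep_iterate_fst (k : ℕ) :
    (transportStep^[k] z).1 = imRotation (k * (Real.pi / 3)) z.1 := by
  induction k with
  | zero => simp [imRotation_zero]
  | succ k ih =>
    rw [Function.iterate_succ_apply']
    change imRotation _ (transportStep^[k] z).1 = _
    rw [ih, ← imRotation_add]
    congr 1
    push_cast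
    ring

lemma OrthonormalPair.herm_imRotation_ne_zero (h : OrthonormalPair x y) :
    herm x (imRotation (Real.pi / 3) x) ≠ 0 := by
  intro h₀
  have hx : normSq x = 1 := mem_S7_iff.2 h.herm_left
  have := cos_mul_normSq_le_re_herm_imRotation (Real.pi / 3) x
  rw [h₀, hx, Real.cos_pi_div_three] at this
  norm_num at this

lemma OrthonormalPair.transportStep (h : OrthonormalPair z.1 z.2) :
    OrthonormalPair (transportStep z).1 (transportStep z).2 := by
  refine h.unitOrthComp ?_ h.herm_imRotation_ne_zero
  change herm (imRotation _ z.1) (imRotation _ z.1) = 1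
  rw [herm_self_eq_normSq, normSq_imRotation, ← herm_self_eq_normSq, h.herm_left]

lemma OrthonormalPair.transportStep_iterate (h : OrthonormalPair z.1 z.2) (k : ℕ) :
    OrthonormalPair (Wilhelm.transportStep^[k] z).1 (Wilhelm.transportStep^[k] z).2 := by
  induction k with
  | zero => exact h
  | succ k ih => rw [Function.iterate_succ_apply']; exact ih.transportStep

lemma contDiffAt_transportStep_iterate {n : WithTop ℕ∞} (h : OrthonormalPair z.1 z.2) (k : ℕ) :
    ContDiffAt ℝ n (transportStep^[k]) z := by
  induction k with
  | zero => exact contDiffAt_id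
  | succ k ih =>
    have hk := h.transportStep_iterate k
    rw [Function.iterate_succ']
    refine ContDiffAt.comp z ?_ ih
    exact ContDiffAt.prodMk (by fun_prop) (contDiffAt_unitOrthComp (by fun_prop) (by fun_prop)
      (hk.orthComp_ne_zero hk.herm_imRotation_ne_zero))

/-- A unit column orthogonal to `star x` that depends smoothly on the orthonormal pair `x`, `y`. -/
def transport (x y : ℍ[ℝ] × ℍ[ℝ]) : ℍ[ℝ] × ℍ[ℝ] := (transportStep^[3] (x, y)).2

lemma OrthonormalPair.transport (h : OrthonormalPair x y) :
    OrthonormalPair (star x) (transport x y) := by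
  have hstar : (Wilhelm.transportStep^[3] (x, y)).1 = star x := by
    rw [transportStep_iterate_fst, ← imRotation_pi]
    congr 1
    push_cast
    ring
  rw [← hstar]
  exact transportStep_iterate (z := (x, y)) h 3

lemma contDiffAt_transport {E : Type*} [NormedAddCommGroup E] [NormedSpace ℝ E] {n : WithTop ℕ∞}
    {f g : E → ℍ[ℝ] × ℍ[ℝ]} {e : E} (hf : ContDiffAt ℝ n f e) (hg : ContDiffAt ℝ n g e)
    (h : OrthonormalPair (f e) (g e)) : ContDiffAt ℝ n (fun e => transport (f e) (g e)) e := by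
  have hiter : ContDiffAt ℝ n (fun e => transportStep^[3] (f e, g e)) e :=
    ContDiffAt.comp (g := transportStep^[3]) e
      (contDiffAt_transportStep_iterate (z := (f e, g e)) h 3) (hf.prodMk hg)
  exact contDiffAt_snd.comp e hiter

end Transport

/-! ### The bundle `Sp(2,m) → Sp(2,m-1)` -/

section Bundle

variable {k : ℕ}

/-- A smooth choice of a last entry `u_{k+3}` for `(u_1, …, u_{k+2}) ∈ Sp(2,k+2)`: `u_{k+1}` is a
column orthogonal to `u_{k+2}`, and it gets transported to one orthogonal to the conjugate. -/
def lastSection (b : Fin (k + 2) → ℍ[ℝ] × ℍ[ℝ]) : ℍ[ℝ] × ℍ[ℝ] :=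
  transport (b (Fin.last (k + 1))) (link k (b (Fin.last k).castSucc))

variable {b : Fin (k + 2) → ℍ[ℝ] × ℍ[ℝ]}

lemma orthonormalPair_last_link (hb : b ∈ Sp2m (k + 2)) :
    OrthonormalPair (b (Fin.last (k + 1))) (link k (b (Fin.last k).castSucc)) := by
  obtain ⟨hunit, horth⟩ := mem_Sp2m_iff.1 hb
  refine OrthonormalPair.symm ⟨by rw [herm_link_self, hunit], hunit _, ?_⟩
  simpa using horth (Fin.last k).castSucc (Fin.last (k + 1)) (by simp)

lemma orthonormalPair_star_lastSection (hb : b ∈ Sp2m (k + 2)) :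
    OrthonormalPair (star (b (Fin.last (k + 1)))) (lastSection b) :=
  (orthonormalPair_last_link hb).transport

@[fun_prop]
lemma contDiffAt_link {E : Type*} [NormedAddCommGroup E] [NormedSpace ℝ E] {n : WithTop ℕ∞}
    {f : E → ℍ[ℝ] × ℍ[ℝ]} {x : E} {i : ℕ} (hf : ContDiffAt ℝ n f x) :
    ContDiffAt ℝ n (fun x => link i (f x)) x := by
  unfold link; split_ifs <;> fun_prop

lemma contDiffAt_lastSection {n : WithTop ℕ∞} (hb : b ∈ Sp2m (k + 2)) :
    ContDiffAt ℝ n lastSection b :=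
  contDiffAt_transport (by fun_prop) (by fun_prop) (orthonormalPair_last_link hb)

lemma snoc_mem_Sp2m_iff {x : ℍ[ℝ] × ℍ[ℝ]} :
    (Fin.snoc (α := fun _ => ℍ[ℝ] × ℍ[ℝ]) b x : Fin (k + 3) → ℍ[ℝ] × ℍ[ℝ]) ∈ Sp2m (k + 3) ↔
      b ∈ Sp2m (k + 2) ∧ herm x x = 1 ∧ herm (star (b (Fin.last (k + 1)))) x = 0 := by
  simp only [mem_Sp2m_iff]
  constructor
  · rintro ⟨hunit, horth⟩
    refine ⟨⟨fun i => by simpa using hunit i.castSucc, fun i j hij => ?_⟩, ?_, ?_⟩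
    · simpa using horth i.castSucc j.castSucc (by simpa using hij)
    · simpa using hunit (Fin.last _)
    · simpa [link] using horth (Fin.last (k + 1)).castSucc (Fin.last _) (by simp)
  · rintro ⟨⟨hunit, horth⟩, hx, hlast⟩
    refine ⟨fun i => ?_, fun i j => ?_⟩
    · induction i using Fin.lastCases with
      | last => simpa using hx
      | cast i => simpa using hunit i
    · induction j using Fin.lastCases with
      | last =>
        intro hi
        obtain rfl : i = (Fin.last (k + 1)).castSucc := Fin.ext (by simpa using hi.symm)
        simpa [link] using hlast
      | cast j =>
        induction i using Fin.lastCases with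
        | last => intro hi; simp at hi; omega
        | cast i => intro hi; simpa using horth i j (by simpa using hi)

/-- The trivialization `Sp(2,k+2) × S³ → Sp(2,k+3)`. -/
def trivialization (x : (Fin (k + 2) → ℍ[ℝ] × ℍ[ℝ]) × ℍ[ℝ]) : Fin (k + 3) → ℍ[ℝ] × ℍ[ℝ] :=
  Fin.snoc (α := fun _ => ℍ[ℝ] × ℍ[ℝ]) x.1 (lastSection x.1 <• star x.2)

/-- The inverse of `trivialization` on `Sp(2,k+3)`. -/
def trivializationInv (u : Fin (k + 3) → ℍ[ℝ] × ℍ[ℝ]) : (Fin (k + 2) → ℍ[ℝ] × ℍ[ℝ]) × ℍ[ℝ] :=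
  (Fin.init (α := fun _ => ℍ[ℝ] × ℍ[ℝ]) u,
    star (herm (lastSection (Fin.init (α := fun _ => ℍ[ℝ] × ℍ[ℝ]) u)) (u (Fin.last _))))

lemma trivializationInv_snoc (x : ℍ[ℝ] × ℍ[ℝ]) :
    trivializationInv (Fin.snoc (α := fun _ => ℍ[ℝ] × ℍ[ℝ]) b x) =
      (b, star (herm (lastSection b) x)) := by
  simp [trivializationInv]

lemma exists_snoc_of_mem_Sp2m {u : Fin (k + 3) → ℍ[ℝ] × ℍ[ℝ]} (hu : u ∈ Sp2m (k + 3)) :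
    ∃ b x, u = Fin.snoc (α := fun _ => ℍ[ℝ] × ℍ[ℝ]) b x ∧ b ∈ Sp2m (k + 2) ∧ herm x x = 1 ∧
      x = lastSection b <• herm (lastSection b) x := by
  rw [← Fin.snoc_init_self (α := fun _ => ℍ[ℝ] × ℍ[ℝ]) u, snoc_mem_Sp2m_iff] at hu
  obtain ⟨hb, hx, hlast⟩ := hu
  refine ⟨_, _, (Fin.snoc_init_self (α := fun _ => ℍ[ℝ] × ℍ[ℝ]) u).symm, hb, hx, ?_⟩
  have := (orthonormalPair_star_lastSection hb).expand (u (Fin.last _))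
  rw [hlast, MulOpposite.op_zero, zero_smul, zero_add] at this
  exact this.symm

lemma contDiffOn_trivialization :
    ContDiffOn ℝ ∞ (trivialization (k := k)) (Sp2m (k + 2) ×ˢ S3) := by
  rintro ⟨b, s⟩ ⟨hb, -⟩
  have hlast : ContDiffAt ℝ ∞
      (fun x : (Fin (k + 2) → ℍ[ℝ] × ℍ[ℝ]) × ℍ[ℝ] => lastSection x.1) (b, s) :=
    (contDiffAt_lastSection hb).comp (b, s) contDiffAt_fst
  refine ContDiffAt.contDiffWithinAt (contDiffAt_pi.2 fun i => ?_)
  induction i using Fin.lastCases with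
  | last => simp only [trivialization, Fin.snoc_last]; fun_prop
  | cast i => simp only [trivialization, Fin.snoc_castSucc]; fun_prop

lemma contDiffOn_trivializationInv :
    ContDiffOn ℝ ∞ (trivializationInv (k := k)) (Sp2m (k + 3)) := by
  intro u hu
  have hinit : ContDiffAt ℝ ∞ (fun u : Fin (k + 3) → ℍ[ℝ] × ℍ[ℝ] =>
      Fin.init (α := fun _ => ℍ[ℝ] × ℍ[ℝ]) u) u := by
    unfold Fin.init; fun_prop
  obtain ⟨b, x, rfl, hb, -⟩ := exists_snoc_of_mem_Sp2m hu
  have hlast := ContDiffAt.comp _ (n := ∞) (g := lastSection (k := k))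
    (contDiffAt_lastSection (by simpa using hb)) hinit
  exact (hinit.prodMk (contDiffAt_star (contDiffAt_herm hlast (by fun_prop)))).contDiffWithinAt

lemma isDiffeo_trivialization :
    IsDiffeo (trivialization (k := k)) (Sp2m (k + 2) ×ˢ S3) (Sp2m (k + 3)) := by
  refine ⟨contDiffOn_trivialization, ?_, trivializationInv, contDiffOn_trivializationInv, ?_, ?_,
    ?_⟩
  · rintro ⟨b, s⟩ ⟨hb, hs⟩
    obtain ⟨-, hunit, horth⟩ := orthonormalPair_star_lastSection hb
    refine snoc_mem_Sp2m_iff.2 ⟨hb, ?_, ?_⟩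
    · rw [herm_op_smul_right, herm_op_smul_left, hunit, mul_one, star_star,
        mul_star_self_eq_one_iff, mem_S3_iff.1 hs]
    · rw [herm_op_smul_right, horth, zero_mul]
  · intro u hu
    obtain ⟨b, x, rfl, hb, hx, hxb⟩ := exists_snoc_of_mem_Sp2m hu
    rw [trivializationInv_snoc]
    refine ⟨hb, mem_S3_iff.2 ?_⟩
    rw [norm_star, ← star_mul_self_eq_one_iff, ← herm_op_smul_left, ← hxb, hx]
  · rintro ⟨b, s⟩ ⟨hb, -⟩
    rw [trivialization, trivializationInv_snoc, herm_op_smul_right,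
      (orthonormalPair_star_lastSection hb).herm_right, one_mul, star_star]
  · intro u hu
    obtain ⟨b, x, rfl, -, -, hxb⟩ := exists_snoc_of_mem_Sp2m hu
    rw [trivializationInv_snoc, trivialization, star_star, ← hxb]

theorem isTrivialPrincipalS3Bundle_Sp2m (k : ℕ) :
    IsTrivialPrincipalS3Bundle (Sp2m (k + 3)) (Sp2m (k + 2)) (forgetLast (k + 3))
      (lastAction (k + 3)) := by
  refine ⟨trivialization, isDiffeo_trivialization, fun b _ s _ => ⟨?_, fun q _ => ?_⟩⟩
  · funext i
    exact Fin.snoc_castSucc (α := fun _ => ℍ[ℝ] × ℍ[ℝ]) _ _ i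
  · funext i
    induction i using Fin.lastCases with
    | last => simp [lastAction, trivialization, twoSided_eq, smul_smul]
    | cast i =>
      have : (i : ℕ) ≠ k + 2 := by omega
      simp [lastAction, trivialization, this]

end Bundle

/-! ### The diffeomorphism type of `Sp(2,m)` -/

section Diffeo

variable {E F G : Type*} [NormedAddCommGroup E] [NormedSpace ℝ E]
  [NormedAddCommGroup F] [NormedSpace ℝ F] [NormedAddCommGroup G] [NormedSpace ℝ G]
  {S : Set E} {T : Set F} {R : Set G}

lemma AreDiffeomorphic.symm (h : AreDiffeomorphic S T) : AreDiffeomorphic T S := by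
  obtain ⟨f, hf, hfST, k, hk, hkTS, hleft, hright⟩ := h
  exact ⟨k, hk, hkTS, f, hf, hfST, hright, hleft⟩

lemma AreDiffeomorphic.trans (hST : AreDiffeomorphic S T) (hTR : AreDiffeomorphic T R) :
    AreDiffeomorphic S R := by
  obtain ⟨f, hf, hfST, k, hk, hkTS, hleft, hright⟩ := hST
  obtain ⟨f', hf', hfTR, k', hk', hkRT, hleft', hright'⟩ := hTR
  exact ⟨f' ∘ f, hf'.comp hf hfST, hfTR.comp hfST, k ∘ k', hk.comp hk' hkRT, hkTS.comp hkRT,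
    hleft.comp hleft' hfST, hright.comp hright' hkRT⟩

lemma AreDiffeomorphic.prod_right (h : AreDiffeomorphic S T) (R : Set G) :
    AreDiffeomorphic (S ×ˢ R) (T ×ˢ R) := by
  obtain ⟨f, hf, hfST, k, hk, hkTS, hleft, hright⟩ := h
  exact ⟨Prod.map f id, hf.prodMap contDiffOn_id, fun _ hx => ⟨hfST hx.1, hx.2⟩,
    Prod.map k id, hk.prodMap contDiffOn_id, fun _ hx => ⟨hkTS hx.1, hx.2⟩,
    fun _ hx => Prod.ext (hleft hx.1) rfl, fun _ hx => Prod.ext (hright hx.1) rfl⟩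

end Diffeo

lemma mem_Sp2m_two_iff {u : Fin 2 → ℍ[ℝ] × ℍ[ℝ]} : u ∈ Sp2m 2 ↔ (u 0, u 1) ∈ Sp2 := by
  rw [mem_Sp2m_iff, mem_Sp2_iff]
  constructor
  · rintro ⟨hunit, horth⟩
    exact ⟨hunit 0, hunit 1, by simpa [link] using horth 0 1 (by simp)⟩
  · rintro ⟨h₀, h₁, h₀₁⟩
    refine ⟨Fin.forall_fin_two.2 ⟨h₀, h₁⟩, fun i j hij => ?_⟩
    obtain rfl : i = 0 := by omega
    obtain rfl : j = 1 := by omega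
    simpa [link] using h₀₁

lemma areDiffeomorphic_Sp2m_two : AreDiffeomorphic (Sp2m 2) (S3pow 0 ×ˢ Sp2) := by
  refine ⟨fun u => (0, (u 0, u 1)), by fun_prop,
    fun u hu => ⟨fun i => i.elim0, mem_Sp2m_two_iff.1 hu⟩, fun x => ![x.2.1, x.2.2], ?_, ?_, ?_, ?_⟩
  · refine ContDiff.contDiffOn (contDiff_pi.2 (Fin.forall_fin_two.2 ⟨?_, ?_⟩))
    · exact contDiff_snd.fst
    · exact contDiff_snd.snd
  · rintro ⟨a, x⟩ ⟨-, hx⟩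
    exact mem_Sp2m_two_iff.2 hx
  · exact fun u _ => funext (Fin.forall_fin_two.2 ⟨rfl, rfl⟩)
  · exact fun x _ => Prod.ext (Subsingleton.elim _ _) rfl

lemma areDiffeomorphic_S3pow_succ {E : Type*} [NormedAddCommGroup E] [NormedSpace ℝ E] (n : ℕ)
    (R : Set E) : AreDiffeomorphic ((S3pow n ×ˢ R) ×ˢ S3) (S3pow (n + 1) ×ˢ R) := by
  refine ⟨fun x => (Fin.snoc (α := fun _ => ℍ[ℝ]) x.1.1 x.2, x.1.2), ?_, ?_,
    fun y => ((Fin.init (α := fun _ => ℍ[ℝ]) y.1, y.2), y.1 (Fin.last n)), ?_, ?_, ?_, ?_⟩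
  · refine ContDiff.contDiffOn (ContDiff.prodMk (contDiff_pi.2 fun i => ?_) (by fun_prop))
    induction i using Fin.lastCases with
    | last => simp only [Fin.snoc_last]; fun_prop
    | cast i => simp only [Fin.snoc_castSucc]; fun_prop
  · rintro ⟨⟨q, r⟩, s⟩ ⟨⟨hq, hr⟩, hs⟩
    refine ⟨fun i => ?_, hr⟩
    induction i using Fin.lastCases with
    | last => simpa using hs
    | cast i => simpa using hq i
  · unfold Fin.init; fun_prop
  · rintro ⟨q, r⟩ ⟨hq, hr⟩
    exact ⟨⟨fun i => hq _, hr⟩, hq _⟩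
  · rintro ⟨⟨q, r⟩, s⟩ _
    simp
  · rintro ⟨q, r⟩ _
    simp

theorem areDiffeomorphic_Sp2m (n : ℕ) : AreDiffeomorphic (Sp2m (n + 2)) (S3pow n ×ˢ Sp2) := by
  induction n with
  | zero => exact areDiffeomorphic_Sp2m_two
  | succ n ih =>
    exact (AreDiffeomorphic.symm ⟨_, isDiffeo_trivialization⟩).trans
      ((ih.prod_right S3).trans (areDiffeomorphic_S3pow_succ n Sp2))

/-! ### The Ricci tensor in terms of the 2-jet of the metric -/

section Pderiv

variable {d : ℕ} {f g : (Fin d → ℝ) → ℝ} {x : Fin d → ℝ} {i : Fin d}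

lemma pderiv_congr (h : f =ᶠ[𝓝 x] g) : pderiv i f x = pderiv i g x := by
  rw [pderiv, pderiv, h.fderiv_eq]

lemma pderiv_add (hf : DifferentiableAt ℝ f x) (hg : DifferentiableAt ℝ g x) :
    pderiv i (fun y => f y + g y) x = pderiv i f x + pderiv i g x := by
  simp [pderiv, fderiv_fun_add hf hg]

lemma pderiv_sub (hf : DifferentiableAt ℝ f x) (hg : DifferentiableAt ℝ g x) :
    pderiv i (fun y => f y - g y) x = pderiv i f x - pderiv i g x := by
  simp [pderiv, fderiv_fun_sub hf hg]

lemma pderiv_mul (hf : DifferentiableAt ℝ f x) (hg : DifferentiableAt ℝ g x) :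
    pderiv i (fun y => f y * g y) x = f x * pderiv i g x + pderiv i f x * g x := by
  simp [pderiv, fderiv_fun_mul hf hg, mul_comm]

lemma pderiv_const_mul (c : ℝ) (hf : DifferentiableAt ℝ f x) :
    pderiv i (fun y => c * f y) x = c * pderiv i f x := by
  simp [pderiv, fderiv_const_mul hf]

@[simp] lemma pderiv_const (c : ℝ) : pderiv i (fun _ => c) x = 0 := by simp [pderiv]

lemma pderiv_sum {ι : Type*} {s : Finset ι} {F : ι → (Fin d → ℝ) → ℝ}
    (h : ∀ l ∈ s, DifferentiableAt ℝ (F l) x) :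
    pderiv i (fun y => ∑ l ∈ s, F l y) x = ∑ l ∈ s, pderiv i (F l) x := by
  simp [pderiv, fderiv_fun_sum h]

lemma contDiffAt_pderiv {m n : WithTop ℕ∞} (hf : ContDiffAt ℝ n f x) (hmn : m + 1 ≤ n) :
    ContDiffAt ℝ m (pderiv i f) x := by
  unfold pderiv
  exact (hf.fderiv_right hmn).clm_apply contDiffAt_const

end Pderiv

section TwoJet

variable {ι : Type*} [Fintype ι]

/-- Christoffel symbols at a point where the metric is the identity matrix, in terms of the first
derivatives `D k i j = ∂_k g_{ij}`. -/
def jetChristoffel (D : ι → ι → ι → ℝ) (k i j : ι) : ℝ := (1 / 2) * (D i j k + D j i k - D k i j)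

/-- Derivatives of the Christoffel symbols at a point where the metric is the identity matrix, in
terms of `D k i j = ∂_k g_{ij}` and `H p k i j = ∂_p ∂_k g_{ij}`. -/
def jetDChristoffel (D : ι → ι → ι → ℝ) (H : ι → ι → ι → ι → ℝ) (p k i j : ι) : ℝ :=
  (1 / 2) * (H p i j k + H p j i k - H p k i j) - ∑ l, D p k l * jetChristoffel D l i j

/-- The Ricci tensor at a point where the metric is the identity matrix. -/
def jetRicci (D : ι → ι → ι → ℝ) (H : ι → ι → ι → ι → ℝ) (i j : ι) : ℝ :=
  ∑ k, (jetDChristoffel D H k k i j - jetDChristoffel D H j k i k +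
    ∑ l, (jetChristoffel D k k l * jetChristoffel D l i j -
      jetChristoffel D k j l * jetChristoffel D l i k))

lemma jetDChristoffel_reindex {κ : Type*} [Fintype κ] (e : ι ≃ κ) (D : κ → κ → κ → ℝ)
    (H : κ → κ → κ → κ → ℝ) (p k i j : ι) :
    jetDChristoffel (fun k i j => D (e k) (e i) (e j))
        (fun p k i j => H (e p) (e k) (e i) (e j)) p k i j =
      jetDChristoffel D H (e p) (e k) (e i) (e j) := by
  simp only [jetDChristoffel, jetChristoffel]
  rw [← e.sum_comp]

lemma jetRicci_reindex {κ : Type*} [Fintype κ] (e : ι ≃ κ) (D : κ → κ → κ → ℝ)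
    (H : κ → κ → κ → κ → ℝ) (i j : ι) :
    jetRicci (fun k i j => D (e k) (e i) (e j)) (fun p k i j => H (e p) (e k) (e i) (e j)) i j =
      jetRicci D H (e i) (e j) := by
  simp only [jetRicci, jetDChristoffel_reindex]
  simp only [jetChristoffel, ← e.sum_comp]

variable {d : ℕ} {G : (Fin d → ℝ) → Matrix (Fin d) (Fin d) ℝ} {x : Fin d → ℝ} {n : WithTop ℕ∞}

lemma contDiffAt_det {E κ : Type*} [NormedAddCommGroup E] [NormedSpace ℝ E] [Fintype κ]
    [DecidableEq κ] {A : E → Matrix κ κ ℝ} {x : E}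
    (hA : ∀ i j, ContDiffAt ℝ n (fun y => A y i j) x) : ContDiffAt ℝ n (fun y => (A y).det) x := by
  simp only [Matrix.det_apply']
  exact ContDiffAt.sum fun s _ => contDiffAt_const.mul (contDiffAt_prod fun i _ => hA _ _)

lemma contDiffAt_matrix_inv {E κ : Type*} [NormedAddCommGroup E] [NormedSpace ℝ E] [Fintype κ]
    [DecidableEq κ] {A : E → Matrix κ κ ℝ} {x : E}
    (hA : ∀ i j, ContDiffAt ℝ n (fun y => A y i j) x) (hdet : (A x).det ≠ 0) (k l : κ) :
    ContDiffAt ℝ n (fun y => (A y)⁻¹ k l) x := by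
  simp only [Matrix.inv_def, Matrix.smul_apply, Ring.inverse_eq_inv', smul_eq_mul,
    Matrix.adjugate_apply]
  refine ContDiffAt.mul ((contDiffAt_det hA).inv hdet) (contDiffAt_det fun i j => ?_)
  by_cases h : i = l
  · subst h
    simp only [Matrix.updateRow_self]
    exact contDiffAt_const
  · simp only [Matrix.updateRow_ne h]
    exact hA i j

lemma pderiv_matrix_inv (hG : ∀ i j, ContDiffAt ℝ 1 (fun y => G y i j) x) (hGx : G x = 1)
    (p k l : Fin d) :
    pderiv p (fun y => (G y)⁻¹ k l) x = -pderiv p (fun y => G y k l) x := by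
  have hdiff : ∀ i j, DifferentiableAt ℝ (fun y => G y i j) x := fun i j =>
    (hG i j).differentiableAt one_ne_zero
  have hdiff_inv : ∀ i j, DifferentiableAt ℝ (fun y => (G y)⁻¹ i j) x := fun i j =>
    (contDiffAt_matrix_inv hG (by simp [hGx]) i j).differentiableAt one_ne_zero
  have hdet : ∀ᶠ y in 𝓝 x, (G y).det ≠ 0 :=
    (contDiffAt_det hG).continuousAt.eventually_ne (by simp [hGx])
  have hmul : (fun y => ∑ j, G y k j * (G y)⁻¹ j l) =ᶠ[𝓝 x] fun _ => (1 : Matrix _ _ ℝ) k l := by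
    filter_upwards [hdet] with y hy
    rw [← Matrix.mul_apply, Matrix.mul_nonsing_inv _ (isUnit_iff_ne_zero.2 hy)]
  have hderiv := pderiv_congr (i := p) hmul
  rw [pderiv_sum fun j _ => (hdiff k j).fun_mul (hdiff_inv j l), pderiv_const] at hderiv
  simp only [fun j => pderiv_mul (i := p) (hdiff k j) (hdiff_inv j l), Finset.sum_add_distrib, hGx,
    inv_one, Matrix.one_apply, ite_mul, mul_ite, one_mul, zero_mul, mul_one, mul_zero,
    Finset.sum_ite_eq, Finset.sum_ite_eq', Finset.mem_univ, if_true] at hderiv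
  linarith

lemma christoffel_eq_jetChristoffel (hGx : G x = 1) (k i j : Fin d) :
    christoffel G k i j x = jetChristoffel (fun k i j => pderiv k (fun y => G y i j) x) k i j := by
  simp [christoffel, jetChristoffel, hGx, Matrix.one_apply]

lemma pderiv_christoffel (hG : ∀ i j, ContDiffAt ℝ 2 (fun y => G y i j) x) (hGx : G x = 1)
    (p k i j : Fin d) :
    pderiv p (christoffel G k i j) x =
      jetDChristoffel (fun k i j => pderiv k (fun y => G y i j) x)
        (fun p k i j => pderiv p (pderiv k (fun y => G y i j)) x) p k i j := by
  have hG₁ : ∀ i j, ContDiffAt ℝ 1 (fun y => G y i j) x := fun i j =>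
    (hG i j).of_le one_le_two
  have hinv : ∀ i j, DifferentiableAt ℝ (fun y => (G y)⁻¹ i j) x := fun i j =>
    (contDiffAt_matrix_inv hG₁ (by simp [hGx]) i j).differentiableAt one_ne_zero
  have hD : ∀ l i j, DifferentiableAt ℝ (pderiv l (fun y => G y i j)) x := fun l i j =>
    (contDiffAt_pderiv (m := 1) (hG i j) one_add_one_eq_two.le).differentiableAt one_ne_zero
  have hsum : ∀ l, DifferentiableAt ℝ (fun y => pderiv i (fun y => G y j l) y +
      pderiv j (fun y => G y i l) y - pderiv l (fun y => G y i j) y) x := fun l =>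
    ((hD i j l).fun_add (hD j i l)).fun_sub (hD l i j)
  unfold christoffel
  rw [pderiv_const_mul _ (DifferentiableAt.fun_sum fun l _ => (hinv k l).fun_mul (hsum l)),
    pderiv_sum fun l _ => (hinv k l).fun_mul (hsum l)]
  simp only [fun l => pderiv_mul (i := p) (hinv k l) (hsum l), pderiv_matrix_inv hG₁ hGx, hGx,
    inv_one, Finset.sum_add_distrib]
  simp only [fun l => pderiv_sub (i := p) ((hD i j l).fun_add (hD j i l)) (hD l i j),
    fun l => pderiv_add (i := p) (hD i j l) (hD j i l), Matrix.one_apply, ite_mul, one_mul,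
    zero_mul, Finset.sum_ite_eq, Finset.mem_univ, if_true]
  rw [jetDChristoffel, mul_add, Finset.mul_sum, sub_eq_add_neg (1 / 2 * _),
    ← Finset.sum_neg_distrib]
  congr 1
  refine Finset.sum_congr rfl fun l _ => ?_
  rw [jetChristoffel]
  ring

theorem ricci_eq_jetRicci (hG : ∀ i j, ContDiffAt ℝ 2 (fun y => G y i j) x) (hGx : G x = 1)
    (i j : Fin d) :
    ricci G i j x = jetRicci (fun k i j => pderiv k (fun y => G y i j) x)
        (fun p k i j => pderiv p (pderiv k (fun y => G y i j)) x) i j := by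
  simp only [ricci, jetRicci, pderiv_christoffel hG hGx, christoffel_eq_jetChristoffel hGx]

end TwoJet

/-! ### The Ricci tensor of a connection metric -/

lemma sum_gram_mul {ι κ : Type*} [Fintype ι] [Fintype κ] (g : ι → κ → ℝ) (v : ι → ℝ) :
    ∑ i, ∑ j, (∑ k, g i k * g j k) * (v i * v j) = ∑ k, (∑ i, g i k * v i) ^ 2 := by
  simp only [sq, Finset.sum_mul_sum, Finset.sum_mul _ _ (_ * _)]
  rw [Finset.sum_comm_cycle]
  exact Finset.sum_congr rfl fun k _ => Finset.sum_congr rfl fun i _ =>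
    Finset.sum_congr rfl fun j _ => by ring

lemma sq_sum_mul_le {ι : Type*} [Fintype ι] {g : ι → ℝ} {K : ℝ} (hg : ∀ i, |g i| ≤ K)
    (v : ι → ℝ) : (∑ i, g i * v i) ^ 2 ≤ Fintype.card ι * K ^ 2 * ∑ i, v i ^ 2 := by
  refine (Finset.sum_mul_sq_le_sq_mul_sq _ g v).trans ?_
  gcongr
  calc ∑ i, g i ^ 2 ≤ ∑ _i : ι, K ^ 2 := Finset.sum_le_sum fun i _ =>
        sq_le_sq' (abs_le.1 (hg i)).1 (abs_le.1 (hg i)).2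
    _ = Fintype.card ι * K ^ 2 := by simp

lemma abs_sum_mul_mul_le {ι κ : Type*} [Fintype ι] [Fintype κ] {g : ι → κ → ℝ} {K : ℝ}
    (hg : ∀ i a, |g i a| ≤ K) (x : ι → ℝ) (u : κ → ℝ) :
    |∑ i, ∑ a, g i a * (x i * u a)| ≤
      K / 2 * (Fintype.card κ * ∑ i, x i ^ 2 + Fintype.card ι * ∑ a, u a ^ 2) := by
  have hterm (i : ι) (a : κ) : |g i a * (x i * u a)| ≤ K / 2 * (x i ^ 2 + u a ^ 2) := by
    have hxu : |x i * u a| ≤ (x i ^ 2 + u a ^ 2) / 2 :=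
      abs_le.2 ⟨by nlinarith [sq_nonneg (x i + u a)], by nlinarith [sq_nonneg (x i - u a)]⟩
    rw [abs_mul]
    linarith [mul_le_mul (hg i a) hxu (abs_nonneg _) ((abs_nonneg _).trans (hg i a))]
  calc |∑ i, ∑ a, g i a * (x i * u a)| ≤ ∑ i, ∑ a, K / 2 * (x i ^ 2 + u a ^ 2) :=
        (Finset.abs_sum_le_sum_abs _ _).trans <| Finset.sum_le_sum fun i _ =>
          (Finset.abs_sum_le_sum_abs _ _).trans <| Finset.sum_le_sum fun a _ => hterm i a
    _ = _ := by
        simp only [← Finset.mul_sum, Finset.sum_add_distrib, Finset.sum_const, Finset.card_univ,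
          nsmul_eq_mul]

lemma sum_sq_inl_add_sum_sq_inr_pos {ι κ : Type*} [Fintype ι] [Fintype κ] {v : ι ⊕ κ → ℝ}
    (hv : v ≠ 0) :
    0 < ∑ i, v (.inl i) ^ 2 + ∑ a, v (.inr a) ^ 2 := by
  obtain ⟨i, hi⟩ := Function.ne_iff.1 hv
  rw [← Fintype.sum_sum_type fun i => v i ^ 2]
  exact Finset.sum_pos' (fun _ _ => sq_nonneg _) ⟨i, Finset.mem_univ i, pow_two_pos_of_ne_zero hi⟩

lemma sum_sq_sum_mul_le {α β : Type*} [Fintype α] [Fintype β]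
    {f : α → α → β → ℝ} {K : ℝ} (hfK : ∀ k i a, |f k i a| ≤ K) (x : α → ℝ) :
    ∑ k, ∑ a, (∑ i, f i k a * x i) ^ 2 ≤
      Fintype.card α ^ 2 * Fintype.card β * K ^ 2 * ∑ i, x i ^ 2 :=
  calc _ ≤ ∑ _k : α, ∑ _a : β, Fintype.card α * K ^ 2 * ∑ i, x i ^ 2 :=
        Finset.sum_le_sum fun k _ => Finset.sum_le_sum fun a _ =>
          sq_sum_mul_le (fun i => hfK i k a) x
    _ = _ := by simp only [Finset.sum_const, Finset.card_univ, nsmul_eq_mul]; ring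

section Block

variable {α β : Type*}

/-- First derivatives at a point of a connection metric over `α` with fibre `β`. The connection form
vanishes at the point and has derivatives `f`, and `t` is the length scale of the fibre. -/
def blockD (t : ℝ) (f : α → α → β → ℝ) : α ⊕ β → α ⊕ β → α ⊕ β → ℝ
  | .inl k, .inl i, .inr a => t * f k i a
  | .inl k, .inr a, .inl i => t * f k i a
  | _, _, _ => 0

/-- The Christoffel symbols of a connection metric whose first derivatives are `blockD t f`. -/
def blockChristoffel (t : ℝ) (f : α → α → β → ℝ) : α ⊕ β → α ⊕ β → α ⊕ β → ℝ
  | .inl k, .inl i, .inr a => t * f i k a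
  | .inl k, .inr a, .inl i => t * f i k a
  | _, _, _ => 0

/-- Second derivatives at a point of a connection metric over `α` with fibre `β`, in the situation
of `blockD`. The base has constant curvature `4` in conformal coordinates, `s` and `e` are the
second derivatives of the connection form in horizontal and mixed directions, and `w` is the second
derivative of the metric of the fibre. -/
def blockH [Fintype β] [DecidableEq α] (t : ℝ) (f : α → α → β → ℝ) (s : α → α → α → β → ℝ)
    (e : α → α → β → β → ℝ) (w : β → β → β → β → ℝ) : α ⊕ β → α ⊕ β → α ⊕ β → α ⊕ β → ℝ
  | .inl k, .inl l, .inl i, .inl j => -4 * ((if k = l then 1 else 0) * (if i = j then 1 else 0)) +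
      t ^ 2 * ∑ a, (f k i a * f l j a + f l i a * f k j a)
  | .inl k, .inl l, .inl i, .inr a => t * s k l i a
  | .inl k, .inl l, .inr a, .inl i => t * s k l i a
  | .inl k, .inr d, .inl i, .inr a => e k i d a
  | .inl k, .inr d, .inr a, .inl i => e k i d a
  | .inr d, .inl k, .inl i, .inr a => e k i d a
  | .inr d, .inl k, .inr a, .inl i => e k i d a
  | .inr d, .inr d', .inr a, .inr b => w d d' a b
  | _, _, _, _ => 0

variable {t : ℝ} {f : α → α → β → ℝ} {s : α → α → α → β → ℝ} {e : α → α → β → β → ℝ}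
    {w : β → β → β → β → ℝ}

lemma jetChristoffel_blockD (hf : ∀ k i a, f k i a = -f i k a) (p q r : α ⊕ β) :
    jetChristoffel (blockD t f) p q r = blockChristoffel t f p q r := by
  rcases p with k | a <;> rcases q with i | b <;> rcases r with j | c <;>
    simp only [jetChristoffel, blockD, blockChristoffel, add_zero, zero_add, sub_self, sub_zero,
      mul_zero]
  · rw [hf k i c]; ring
  · rw [hf k j b]; ring
  · rw [hf i j a]; ring

variable [Fintype α] [Fintype β] [DecidableEq α]

lemma jetRicci_inl_inl (hf : ∀ k i a, f k i a = -f i k a) (he : ∀ k i d a, e k i d a = -e i k d a)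
    (i j : α) :
    jetRicci (blockD t f) (blockH t f s e w) (.inl i) (.inl j) =
      (if i = j then 4 * (Fintype.card α - 1 : ℝ) else 0) -
        2 * t ^ 2 * ∑ k, ∑ a, f i k a * f j k a := by
  have hf₀ : ∀ k a, f k k a = 0 := fun k a => by linarith [hf k k a]
  simp only [jetRicci, jetDChristoffel, jetChristoffel_blockD hf, Fintype.sum_sum_type, blockD,
    blockH, blockChristoffel]
  have hi : ∀ k a, f k i a = -f i k a := fun k a => hf k i a
  have hj : ∀ k a, f k j a = -f j k a := fun k a => hf k j a
  have hij : ∀ k a l b, f j k a * f i l b = f i l b * f j k a := fun _ _ _ _ => mul_comm _ _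
  have hcurv : ∑ a, ∑ k, t * f j k a * (t * f i k a) = t ^ 2 * ∑ k, ∑ a, f i k a * f j k a := by
    rw [Finset.sum_comm]
    simp only [Finset.mul_sum]
    exact Finset.sum_congr rfl fun k _ => Finset.sum_congr rfl fun a _ => by ring
  have hij_delta : ∀ k : α, ((if k = i then 1 else 0) * if j = k then 1 else 0 : ℝ) =
      (if k = i then 1 else 0) * if i = j then 1 else 0 := fun k => by
    by_cases hk : k = i
    · subst hk
      simp only [eq_comm (a := j)]
    · simp [hk]
  have hji_delta : ∀ k : α, ((if k = j then 1 else 0) * if i = k then 1 else 0 : ℝ) =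
      (if k = j then 1 else 0) * if i = j then 1 else 0 := fun k => by
    by_cases hk : k = j
    · rw [hk]
    · simp [hk]
  simp only [hf₀, he j i, mul_zero, zero_mul, add_zero, sub_zero, zero_sub, Finset.sum_const_zero,
    neg_add_cancel, zero_add, sub_neg_eq_add, Finset.sum_add_distrib,
    hij_delta, hji_delta, eq_comm (a := j) (b := i)]
  simp only [hi, hj, hij, hcurv, mul_neg, neg_mul, neg_neg, mul_add, mul_sub,
    Finset.sum_neg_distrib, Finset.sum_add_distrib, Finset.sum_sub_distrib, ← Finset.mul_sum,
    ← Finset.sum_mul, Finset.sum_ite_eq', Finset.mem_univ, if_true, Finset.sum_const,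
    Finset.card_univ, nsmul_eq_mul, add_neg_cancel]
  split_ifs <;> ring

lemma jetRicci_inl_inr (hf : ∀ k i a, f k i a = -f i k a) (i : α) (a : β) :
    jetRicci (blockD t f) (blockH t f s e w) (.inl i) (.inr a) =
        (t / 2) * ∑ k, (s k i k a - s k k i a) ∧
      jetRicci (blockD t f) (blockH t f s e w) (.inr a) (.inl i) =
        (t / 2) * ∑ k, (s k i k a - s k k i a) := by
  have hf₀ : ∀ k a, f k k a = 0 := fun k a => by linarith [hf k k a]
  simp only [jetRicci, jetDChristoffel, jetChristoffel_blockD hf, Fintype.sum_sum_type, blockD,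
    blockH, blockChristoffel]
  constructor
  · simp only [hf₀, add_zero, sub_zero, sub_self, zero_mul, mul_zero,
      Finset.sum_const_zero, ← mul_sub, ← Finset.mul_sum]
    ring
  · simp only [hf₀, add_zero, zero_add, sub_zero, sub_self, zero_mul, mul_zero,
      Finset.sum_const_zero, ← mul_sub, ← Finset.mul_sum]
    ring

lemma jetRicci_inr_inr (hf : ∀ k i a, f k i a = -f i k a)
    (he : ∀ k i d a, e k i d a = -e i k d a) (a b : β) :
    jetRicci (blockD t f) (blockH t f s e w) (.inr a) (.inr b) =
      (1 / 2) * ∑ d, (w d a b d + w d b a d - w d d a b - w b a d d) +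
        t ^ 2 * ∑ k, ∑ l, f k l a * f k l b := by
  have hf₀ : ∀ k a, f k k a = 0 := fun k a => by linarith [hf k k a]
  have he₀ : ∀ k d a, e k k d a = 0 := fun k d a => by linarith [he k k d a]
  simp only [jetRicci, jetDChristoffel, jetChristoffel_blockD hf, Fintype.sum_sum_type, blockD,
    blockH, blockChristoffel]
  have hquad : ∑ x, ∑ y, t * f y x b * (t * f x y a) =
      -(t ^ 2 * ∑ k, ∑ l, f k l a * f k l b) := by
    simp only [Finset.mul_sum, ← Finset.sum_neg_distrib]
    refine Finset.sum_congr rfl fun k _ => Finset.sum_congr rfl fun l _ => ?_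
    rw [hf l k b]
    ring
  simp only [hf₀, he₀, add_zero, zero_add, sub_zero, zero_sub, sub_self, zero_mul, mul_zero,
    Finset.sum_const_zero, Finset.sum_neg_distrib, Finset.sum_sub_distrib, hquad]
  simp only [← Finset.mul_sum, Finset.sum_add_distrib, Finset.sum_sub_distrib]
  ring

lemma sum_jetRicci_mul [DecidableEq β] (hf : ∀ k i a, f k i a = -f i k a)
    (he : ∀ k i d a, e k i d a = -e i k d a) {c : ℝ}
    (hw : ∀ a b, (1 / 2) * ∑ d, (w d a b d + w d b a d - w d d a b - w b a d d) =
      if a = b then c else 0) (v : α ⊕ β → ℝ) :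
    ∑ i, ∑ j, jetRicci (blockD t f) (blockH t f s e w) i j * v i * v j =
      4 * (Fintype.card α - 1) * ∑ i, v (.inl i) ^ 2 -
        2 * t ^ 2 * ∑ k, ∑ a, (∑ i, f i k a * v (.inl i)) ^ 2 +
        t * ∑ i, ∑ a, (∑ k, (s k i k a - s k k i a)) * (v (.inl i) * v (.inr a)) +
        c * ∑ a, v (.inr a) ^ 2 + t ^ 2 * ∑ k, ∑ l, (∑ a, f k l a * v (.inr a)) ^ 2 := by
  have hgram₁ := sum_gram_mul (fun i (p : α × β) => f i p.1 p.2) (fun i => v (.inl i))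
  have hgram₂ := sum_gram_mul (fun a (p : α × α) => f p.1 p.2 a) (fun a => v (.inr a))
  simp only [Fintype.sum_prod_type] at hgram₁ hgram₂
  simp only [Fintype.sum_sum_type, jetRicci_inl_inl hf he, (jetRicci_inl_inr hf _ _).1,
    (jetRicci_inl_inr hf _ _).2, jetRicci_inr_inr hf he, hw, mul_assoc _ (v _) (v _)]
  obtain ⟨δ, hδ⟩ : ∃ δ : α → β → ℝ, ∀ i a, ∑ k, (s k i k a - s k k i a) = δ i a :=
    ⟨_, fun _ _ => rfl⟩
  simp only [hδ]
  have hcross : ∑ a, ∑ i, δ i a * (v (.inr a) * v (.inl i)) =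
      ∑ i, ∑ a, δ i a * (v (.inl i) * v (.inr a)) := by
    rw [Finset.sum_comm]
    simp only [mul_comm (v (.inr _)) (v (.inl _))]
  simp only [sub_mul, add_mul, mul_assoc, Finset.sum_add_distrib, Finset.sum_sub_distrib, ite_mul,
    zero_mul, Finset.sum_ite_eq, Finset.mem_univ, if_true, ← Finset.mul_sum, hgram₁, hgram₂,
    hcross, ← sq]
  ring

theorem jetRicci_pos [DecidableEq β] (hα : 2 ≤ Fintype.card α) (hf : ∀ k i a, f k i a = -f i k a)
    (he : ∀ k i d a, e k i d a = -e i k d a)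
    (hw : ∀ a b, (1 / 2) * ∑ d, (w d a b d + w d b a d - w d d a b - w b a d d) =
      if a = b then 2 / t ^ 2 else 0)
    {K : ℝ} (hK : 0 ≤ K) (ht : 0 < t) (ht_one : t ≤ 1)
    (htK : t * (2 * Fintype.card α ^ 2 * Fintype.card β * K ^ 2 + Fintype.card β * K +
      Fintype.card α * K) ≤ 1)
    (hfK : ∀ k i a, |f k i a| ≤ K) (hsK : ∀ i a, |∑ k, (s k i k a - s k k i a)| ≤ K)
    {v : α ⊕ β → ℝ} (hv : v ≠ 0) :
    0 < ∑ i, ∑ j, jetRicci (blockD t f) (blockH t f s e w) i j * v i * v j := by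
  rw [sum_jetRicci_mul hf he hw]
  have hN : (2 : ℝ) ≤ Fintype.card α := by exact_mod_cast hα
  have hpos := sum_sq_inl_add_sum_sq_inr_pos hv
  have hmixed := neg_le_of_abs_le (abs_sum_mul_mul_le hsK (fun i => v (.inl i)) fun a => v (.inr a))
  have hcurv := sum_sq_sum_mul_le hfK fun i => v (.inl i)
  have hfibre : 0 ≤ t ^ 2 * ∑ k, ∑ l, (∑ a, f k l a * v (.inr a)) ^ 2 := by positivity
  set q := ∑ k, ∑ a, (∑ i, f i k a * v (.inl i)) ^ 2
  set x := ∑ i, v (.inl i) ^ 2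
  set u := ∑ a, v (.inr a) ^ 2
  set m := ∑ i, ∑ a, (∑ k, (s k i k a - s k k i a)) * (v (.inl i) * v (.inr a))
  set N : ℝ := (Fintype.card α : ℝ)
  set n : ℝ := (Fintype.card β : ℝ)
  have hx : 0 ≤ x := by positivity
  have hu : 0 ≤ u := by positivity
  have hq : 2 * t ^ 2 * q ≤ t * (t * (2 * N ^ 2 * n * K ^ 2)) * x := by
    linarith [mul_le_mul_of_nonneg_left hcurv (by positivity : 0 ≤ 2 * t ^ 2)]
  have hq_le : t * (t * (2 * N ^ 2 * n * K ^ 2)) * x ≤ 1 * (t * (2 * N ^ 2 * n * K ^ 2)) * x := by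
    gcongr
  have hm := mul_le_mul_of_nonneg_left hmixed ht.le
  have hbase : 4 * x ≤ 4 * (N - 1) * x := by nlinarith
  have hsmall_x := mul_le_mul_of_nonneg_right htK hx
  have hsmall_u := mul_le_mul_of_nonneg_right htK hu
  have hfibre_ric : 2 * u ≤ 2 / t ^ 2 * u := by
    gcongr
    rw [le_div_iff₀ (by positivity)]
    linarith [pow_le_one₀ ht.le ht_one (n := 2)]
  have : 0 ≤ t * (N * K) * x := by positivity
  have : 0 ≤ t * (n * K) * u := by positivity
  have : 0 ≤ t * (n * K) * x := by positivity
  have : 0 ≤ t * (2 * N ^ 2 * n * K ^ 2) * u := by positivity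
  have : 0 ≤ t * (2 * N ^ 2 * n * K ^ 2) * x := by positivity
  linarith

end Block

/-! ### The connection form and the connection metrics -/

/-- A finite sequence, extended by zero to all of `ℕ`; recursions along the columns of a point of
`Sp(2,m)` are then free of bounds on the index. -/
def zeroExtend {m : ℕ} {V : Type*} [Zero V] (u : Fin m → V) (n : ℕ) : V :=
  if h : n < m then u ⟨n, h⟩ else 0

section ZeroExtend

variable {m : ℕ} {V : Type*}

lemma zeroExtend_of_lt [Zero V] (u : Fin m → V) {n : ℕ} (h : n < m) :
    zeroExtend u n = u ⟨n, h⟩ := dif_pos h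

@[simp] lemma zeroExtend_val [Zero V] (u : Fin m → V) (i : Fin m) : zeroExtend u (i : ℕ) = u i :=
  zeroExtend_of_lt u i.isLt

lemma zeroExtend_add [AddZeroClass V] (u v : Fin m → V) (n : ℕ) :
    zeroExtend (u + v) n = zeroExtend u n + zeroExtend v n := by
  unfold zeroExtend; split_ifs <;> simp

lemma zeroExtend_smul {R : Type*} [Zero V] [SMulZeroClass R V] (c : R) (u : Fin m → V) (n : ℕ) :
    zeroExtend (c • u) n = c • zeroExtend u n := by
  unfold zeroExtend; split_ifs <;> simp

@[fun_prop]
lemma contDiffAt_zeroExtend {E : Type*} [NormedAddCommGroup E] [NormedSpace ℝ E]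
    [NormedAddCommGroup V] [NormedSpace ℝ V] {k : WithTop ℕ∞} {f : E → Fin m → V} {x : E} {n : ℕ}
    (hf : ContDiffAt ℝ k f x) : ContDiffAt ℝ k (fun x => zeroExtend (f x) n) x := by
  unfold zeroExtend; split_ifs
  · exact contDiffAt_pi.1 hf _
  · exact contDiffAt_const

end ZeroExtend

/-- The value at the tangent vector `v` at `u` of the `n`-th component of the principal connection
of `Sp(2,m) → S⁴`. From the third column on, `u (n + 2)` is moved on the left by the fibre
coordinate of `u (n + 1)`, which is compensated by the second summand. -/
def connForm (u v : ℕ → ℍ[ℝ] × ℍ[ℝ]) : ℕ → ℍ[ℝ]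
  | 0 => herm (u 0) (v 0)
  | 1 => herm (u 1) (v 1)
  | n + 2 => herm (u (n + 2)) (v (n + 2)) + herm (u (n + 2)) (connForm u v (n + 1) • u (n + 2))

section ConnForm

variable {u v w : ℕ → ℍ[ℝ] × ℍ[ℝ]}

lemma connForm_add (n : ℕ) :
    connForm u (fun k => v k + w k) n = connForm u v n + connForm u w n := by
  induction n using connForm.induct with
  | case1 => exact herm_add_right _ _ _
  | case2 => exact herm_add_right _ _ _
  | case3 n ih => simp only [connForm, herm_add_right, ih, add_smul]; abel

lemma connForm_smul (c : ℝ) (n : ℕ) : connForm u (fun k => c • v k) n = c • connForm u v n := by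
  induction n using connForm.induct with
  | case1 => exact herm_real_smul_right _ _ _
  | case2 => exact herm_real_smul_right _ _ _
  | case3 n ih => simp only [connForm, herm_real_smul_right, ih, smul_assoc, smul_add]

lemma connForm_congr {u' v' : ℕ → ℍ[ℝ] × ℍ[ℝ]} {n : ℕ} (hu : ∀ k ≤ n, u k = u' k)
    (hv : ∀ k ≤ n, v k = v' k) : connForm u v n = connForm u' v' n := by
  induction n using connForm.induct with
  | case1 => simp only [connForm, hu 0 le_rfl, hv 0 le_rfl]
  | case2 => simp only [connForm, hu 1 le_rfl, hv 1 le_rfl]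
  | case3 n ih =>
    simp only [connForm, hu _ le_rfl, hv _ le_rfl,
      ih (fun k hk => hu k (by omega)) fun k hk => hv k (by omega)]

lemma contDiffAt_connForm {E : Type*} [NormedAddCommGroup E] [NormedSpace ℝ E] {k : WithTop ℕ∞}
    {x : E} {f g : E → ℕ → ℍ[ℝ] × ℍ[ℝ]} {n : ℕ} (hf : ∀ j ≤ n, ContDiffAt ℝ k (fun x => f x j) x)
    (hg : ∀ j ≤ n, ContDiffAt ℝ k (fun x => g x j) x) :
    ContDiffAt ℝ k (fun x => connForm (f x) (g x) n) x := by
  induction n using connForm.induct with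
  | case1 => exact contDiffAt_herm (hf 0 le_rfl) (hg 0 le_rfl)
  | case2 => exact contDiffAt_herm (hf 1 le_rfl) (hg 1 le_rfl)
  | case3 n ih =>
    have hfn := hf (n + 2) le_rfl
    have hgn := hg (n + 2) le_rfl
    have hω := ih (fun j hj => hf j (by omega)) fun j hj => hg j (by omega)
    simp only [connForm]
    fun_prop

end ConnForm

section Gauge

/-- The factor by which `wilhelmAction` multiplies the `n`-th column on the left, where `r n` is the
factor on the right. -/
def leftFactor (p : ℍ[ℝ]) (r : ℕ → ℍ[ℝ]) : ℕ → ℍ[ℝ]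
  | 0 => p
  | 1 => p
  | n + 2 => star (r (n + 1))

variable {a x y : ℍ[ℝ]} {w z : ℍ[ℝ] × ℍ[ℝ]}

lemma herm_smul_op_smul (ha : ‖a‖ = 1) :
    herm ((a • w) <• x) ((a • z) <• y) = star x * herm w z * y := by
  rw [herm_op_smul_right, herm_op_smul_left, herm_smul_smul ha]

lemma conj_smul_star_smul (ha : ‖a‖ = 1) :
    (star a * x * a) • ((star a • w) <• y) = (star a • (x • w)) <• y := by
  rw [smul_comm (star a * x * a) (op y), smul_smul, smul_smul, mul_assoc,
    mul_star_self_eq_one_iff.2 ha, mul_one]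

/- The rotation `r' * star r` of the previous fibre coordinate cancels against the variation of the
left factor. -/
lemma herm_add_herm_conj_smul {r r' s : ℍ[ℝ]} (hr : ‖r‖ = 1)
    (hr' : r * star r' + r' * star r = 0) :
    herm ((star r • w) <• s) ((star r' • w) <• s) +
        herm ((star r • w) <• s) ((star r * (x + r' * star r) * r) • ((star r • w) <• s)) =
      star s * herm w (x • w) * s := by
  have hr'_star : star r' = star r * -(r' * star r) := by
    rw [← eq_neg_of_add_eq_zero_left hr', ← mul_assoc, star_mul_self_eq_one_iff.2 hr, one_mul]
  have hstar : ‖star r‖ = 1 := by rwa [norm_star]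
  rw [conj_smul_star_smul hr, hr'_star, mul_smul, herm_smul_op_smul hstar, herm_smul_op_smul hstar,
    ← add_mul, ← mul_add, ← herm_add_right, ← add_smul, neg_add_cancel_comm_assoc]

lemma star_mul_add_mul_star_mul (ha : ‖a‖ = 1) :
    star a * (x + y * star a) * a = star a * x * a + star a * y := by
  rw [mul_add, add_mul, mul_assoc (star a) (y * star a), mul_assoc y,
    star_mul_self_eq_one_iff.2 ha, mul_one]

/- The second argument is the derivative of the transformed curve when `u` moves with velocity `v`
and `r` with velocity `r'`. -/
lemma connForm_gauge {u v : ℕ → ℍ[ℝ] × ℍ[ℝ]} {r r' : ℕ → ℍ[ℝ]} {p : ℍ[ℝ]} {n : ℕ} (hp : ‖p‖ = 1)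
    (hu : ∀ k ≤ n, herm (u k) (u k) = 1) (hr : ∀ k ≤ n, ‖r k‖ = 1)
    (hr' : ∀ k < n, r k * star (r' k) + r' k * star (r k) = 0) :
    connForm (fun k => (leftFactor p r k • u k) <• r k)
      (fun k => (leftFactor 0 r' k • u k) <• r k + (leftFactor p r k • v k) <• r k +
        (leftFactor p r k • u k) <• r' k) n =
      star (r n) * (connForm u v n + r' n * star (r n)) * r n := by
  rw [star_mul_add_mul_star_mul (hr n le_rfl)]
  induction n using connForm.induct with
  | case1 =>
    simp only [connForm, leftFactor, zero_smul, smul_zero, zero_add, herm_add_right,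
      herm_smul_op_smul hp, hu 0 le_rfl, mul_one]
  | case2 =>
    simp only [connForm, leftFactor, zero_smul, smul_zero, zero_add, herm_add_right,
      herm_smul_op_smul hp, hu 1 le_rfl, mul_one]
  | case3 n ih =>
    have hprev := hr (n + 1) (by omega)
    have hprev' := hr' (n + 1) (by omega)
    have hstar : ‖star (r (n + 1))‖ = 1 := by rwa [norm_star]
    rw [connForm, connForm, ih (fun k hk => hu k (by omega)) (fun k hk => hr k (by omega))
      fun k hk => hr' k (by omega), ← star_mul_add_mul_star_mul hprev]
    simp only [leftFactor, herm_add_right, herm_smul_op_smul hstar, hu (n + 2) le_rfl, mul_one]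
    rw [add_right_comm, add_right_comm (herm _ _), herm_add_herm_conj_smul hprev hprev']
    noncomm_ring

lemma orthComp_gauge {r r' : ℍ[ℝ]} (ha : ‖a‖ = 1) (hr : ‖r‖ = 1) (hw : herm w w = 1) :
    orthComp ((a • w) <• r) ((a • z) <• r + (a • w) <• r') = (a • orthComp w z) <• r := by
  have hherm : r * herm ((a • w) <• r) ((a • z) <• r + (a • w) <• r') = herm w z * r + r' := by
    rw [herm_add_right, herm_smul_op_smul ha, herm_smul_op_smul ha, hw, mul_one, mul_assoc,
      ← mul_add, ← mul_assoc, mul_star_self_eq_one_iff.2 hr, one_mul]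
  rw [orthComp, smul_smul, ← MulOpposite.op_mul, hherm, orthComp]
  simp only [smul_sub, add_smul, MulOpposite.op_add, MulOpposite.op_mul, mul_smul,
    smul_comm a (op _)]
  abel

lemma inner_conj_conj {r : ℍ[ℝ]} (hr : ‖r‖ = 1) :
    inner ℝ (star r * x * r) (star r * y * r) = inner ℝ x y := by
  have hpolar (b c : ℍ[ℝ]) : inner ℝ b c = (‖b + c‖ ^ 2 - ‖b‖ ^ 2 - ‖c‖ ^ 2) / 2 := by
    rw [norm_add_sq_real]; ring
  have hnorm (b : ℍ[ℝ]) : ‖star r * b * r‖ = ‖b‖ := by simp [hr]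
  rw [hpolar, hpolar, ← add_mul, ← mul_add, hnorm, hnorm, hnorm]

lemma re_herm_gauge {r : ℍ[ℝ]} (ha : ‖a‖ = 1) (hr : ‖r‖ = 1) :
    (herm ((a • w) <• r) ((a • z) <• r)).re = (herm w z).re := by
  have hre (b : ℍ[ℝ]) : b.re = inner ℝ b 1 := by simp [Quaternion.inner_def]
  rw [herm_smul_op_smul ha, hre, hre (herm w z), ← inner_conj_conj hr (x := herm w z), mul_one,
    star_mul_self_eq_one_iff.2 hr]

end Gauge

section ConnMetric

variable {m : ℕ} {t : ℝ} {u v w w' : Fin m → ℍ[ℝ] × ℍ[ℝ]}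

lemma connForm_zeroExtend_add (n : ℕ) :
    connForm (zeroExtend u) (zeroExtend (v + w)) n =
      connForm (zeroExtend u) (zeroExtend v) n + connForm (zeroExtend u) (zeroExtend w) n := by
  rw [← connForm_add]
  exact connForm_congr (fun _ _ => rfl) fun k _ => zeroExtend_add _ _ _

lemma connForm_zeroExtend_smul (c : ℝ) (n : ℕ) :
    connForm (zeroExtend u) (zeroExtend (c • v)) n =
      c • connForm (zeroExtend u) (zeroExtend v) n := by
  rw [← connForm_smul]
  exact connForm_congr (fun _ _ => rfl) fun k _ => zeroExtend_smul _ _ _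

/-- The connection metric with fibres of size `t`, as a function: the round metric on the part of
the first column orthogonal to the fibre, plus `t ^ 2` times the square of the connection form. -/
def connMetricFun (m : ℕ) (t : ℝ) (u v w : Fin m → ℍ[ℝ] × ℍ[ℝ]) : ℝ :=
  (herm (orthComp (zeroExtend u 0) (zeroExtend v 0))
    (orthComp (zeroExtend u 0) (zeroExtend w 0))).re +
    t ^ 2 * ∑ n ∈ Finset.range m, inner ℝ (connForm (zeroExtend u) (zeroExtend v) n)
      (connForm (zeroExtend u) (zeroExtend w) n)

lemma orthComp_add (x y z : ℍ[ℝ] × ℍ[ℝ]) : orthComp x (y + z) = orthComp x y + orthComp x z := by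
  simp only [orthComp, herm_add_right, MulOpposite.op_add, add_smul]; abel

lemma orthComp_real_smul (c : ℝ) (x y : ℍ[ℝ] × ℍ[ℝ]) : orthComp x (c • y) = c • orthComp x y := by
  rw [orthComp, herm_real_smul_right, op_real_smul, ← smul_sub, orthComp]

lemma connMetricFun_comm : connMetricFun m t u v w = connMetricFun m t u w v := by
  unfold connMetricFun
  rw [← star_herm, Quaternion.re_star]
  simp only [real_inner_comm]

lemma connMetricFun_add_right :
    connMetricFun m t u v (w + w') = connMetricFun m t u v w + connMetricFun m t u v w' := by
  simp only [connMetricFun, zeroExtend_add, orthComp_add, herm_add_right, connForm_zeroExtend_add,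
    inner_add_right, Quaternion.re_add, Finset.sum_add_distrib]
  ring

lemma connMetricFun_smul_right (c : ℝ) :
    connMetricFun m t u v (c • w) = c * connMetricFun m t u v w := by
  simp only [connMetricFun, zeroExtend_smul, orthComp_real_smul, herm_real_smul_right,
    connForm_zeroExtend_smul, real_inner_smul_right, Quaternion.re_smul, smul_eq_mul,
    ← Finset.mul_sum]
  ring

/-- The connection metric with fibres of size `t`, as a field of bilinear forms. -/
def connMetric (m : ℕ) (t : ℝ) (u : Fin m → ℍ[ℝ] × ℍ[ℝ]) :
    (Fin m → ℍ[ℝ] × ℍ[ℝ]) →L[ℝ] (Fin m → ℍ[ℝ] × ℍ[ℝ]) →L[ℝ] ℝ :=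
  LinearMap.toContinuousLinearMap
    ((LinearMap.toContinuousLinearMap : ((Fin m → ℍ[ℝ] × ℍ[ℝ]) →ₗ[ℝ] ℝ) ≃ₗ[ℝ] _).toLinearMap ∘ₗ
      LinearMap.mk₂ ℝ (connMetricFun m t u)
        (fun v v' w => by
          rw [connMetricFun_comm, connMetricFun_add_right, connMetricFun_comm,
            connMetricFun_comm (w := v')])
        (fun c v w => by
          rw [connMetricFun_comm, connMetricFun_smul_right, connMetricFun_comm, smul_eq_mul])
        (fun _ _ _ => connMetricFun_add_right)
        (fun c _ _ => connMetricFun_smul_right c))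

lemma connMetric_apply : connMetric m t u v w = connMetricFun m t u v w := rfl

lemma contDiff_connMetric_apply {k : WithTop ℕ∞} (v w : Fin m → ℍ[ℝ] × ℍ[ℝ]) :
    ContDiff ℝ k (fun u => connMetric m t u v w) := by
  refine contDiff_iff_contDiffAt.2 fun u => ?_
  have hω (v : Fin m → ℍ[ℝ] × ℍ[ℝ]) (n : ℕ) :
      ContDiffAt ℝ k (fun u => connForm (zeroExtend u) (zeroExtend v) n) u :=
    contDiffAt_connForm (fun j _ => by fun_prop) fun j _ => by fun_prop
  simp only [connMetric_apply, connMetricFun]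
  exact ContDiffAt.add (by fun_prop)
    (contDiffAt_const.mul (ContDiffAt.sum fun n _ => (hω v n).inner ℝ (hω w n)))

end ConnMetric

lemma isRiemannianMetric_of_apply {E : Type*} [NormedAddCommGroup E] [NormedSpace ℝ E]
    [FiniteDimensional ℝ E] {S : Set E} {g : E → E →L[ℝ] E →L[ℝ] ℝ}
    (hsmooth : ∀ v w, ContDiff ℝ ∞ (fun u => g u v w)) (hsymm : ∀ u v w, g u v w = g u w v)
    (hpos : ∀ p ∈ S, ∀ v ∈ tangentVectors S p, v ≠ 0 → 0 < g p v v) : IsRiemannianMetric S g :=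
  ⟨(contDiff_clm_apply_iff.2 fun v => contDiff_clm_apply_iff.2 fun w => hsmooth v w).contDiffOn,
    fun p hp => ⟨fun v _ w _ => hsymm p v w, hpos p hp⟩⟩

section Invariance

variable {m : ℕ} {p : ℍ[ℝ]} {q : Fin m → ℍ[ℝ]} {u : Fin m → ℍ[ℝ] × ℍ[ℝ]}

lemma zeroExtend_wilhelmAction (p : ℍ[ℝ]) (q : Fin m → ℍ[ℝ]) (u : Fin m → ℍ[ℝ] × ℍ[ℝ]) {n : ℕ}
    (hn : n < m) : zeroExtend (wilhelmAction m p q u) n =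
      (leftFactor p (fun k => star (zeroExtend q k)) n • zeroExtend u n) <•
        star (zeroExtend q n) := by
  rw [zeroExtend_of_lt _ hn, zeroExtend_of_lt q hn, zeroExtend_of_lt u hn, wilhelmAction,
    twoSided_eq]
  match n with
  | 0 => simp [leftFactor]
  | 1 => simp [leftFactor]
  | n + 2 => simp [leftFactor, zeroExtend_of_lt q (show n + 1 < m by omega)]

lemma wilhelmAction_mem (hp : p ∈ S3) (hq : q ∈ S3pow m) (hu : u ∈ Sp2m m) :
    wilhelmAction m p q u ∈ Sp2m m := by
  rw [mem_S3_iff] at hp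
  replace hq (i) : ‖q i‖ = 1 := mem_S3_iff.1 (hq i)
  have hstar (i) : star (star (q i)) * star (q i) = 1 :=
    star_mul_self_eq_one_iff.2 (by rw [norm_star, hq])
  rw [mem_Sp2m_iff] at hu ⊢
  refine ⟨fun i => ?_, fun i j hij => ?_⟩
  · simp only [wilhelmAction, twoSided_eq]
    rw [herm_smul_op_smul (by split_ifs <;> simp [hp, hq]), hu.1 i, mul_one, hstar]
  · have hlink := hu.2 i j hij
    simp only [wilhelmAction, twoSided_eq, link] at hlink ⊢
    by_cases hi : (i : ℕ) = 0
    · have hj : (j : ℕ) < 2 := by omega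
      simp only [hi, hj, if_true] at hlink ⊢
      rw [if_pos (by norm_num), herm_smul_op_smul hp, hlink, mul_zero, zero_mul]
    · have hj : ¬(j : ℕ) < 2 := by omega
      have hpred : (⟨(j : ℕ) - 1, lt_of_le_of_lt (Nat.sub_le _ _) j.isLt⟩ : Fin m) = i :=
        Fin.ext (by simp; omega)
      simp only [hi, hj, if_false, hpred] at hlink ⊢
      rw [star_op_smul_column, star_smul_column, star_star, smul_comm (q i) (op _),
        herm_op_smul_left, herm_op_smul_right, herm_smul_smul (hq i), hlink, zero_mul, mul_zero]

lemma isLinearMap_wilhelmAction (p : ℍ[ℝ]) (q : Fin m → ℍ[ℝ]) :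
    IsLinearMap ℝ (wilhelmAction m p q) where
  map_add u v := by
    funext i
    simp only [wilhelmAction, twoSided_eq, Pi.add_apply, smul_add]
  map_smul c u := by
    funext i
    simp only [wilhelmAction, twoSided_eq, Pi.smul_apply, smul_comm _ c]

lemma fderiv_wilhelmAction (p : ℍ[ℝ]) (q : Fin m → ℍ[ℝ]) (u v : Fin m → ℍ[ℝ] × ℍ[ℝ]) :
    fderiv ℝ (wilhelmAction m p q) u v = wilhelmAction m p q v :=
  congrArg (· v)
    ((isLinearMap_wilhelmAction p q).mk'.toContinuousLinearMap.hasFDerivAt (x := u)).fderiv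

lemma connForm_wilhelmAction (hp : ‖p‖ = 1) (hq : ∀ i, ‖q i‖ = 1)
    (hu : ∀ i, herm (u i) (u i) = 1) (v : Fin m → ℍ[ℝ] × ℍ[ℝ]) {n : ℕ} (hn : n < m) :
    connForm (zeroExtend (wilhelmAction m p q u)) (zeroExtend (wilhelmAction m p q v)) n =
      star (star (zeroExtend q n)) * connForm (zeroExtend u) (zeroExtend v) n *
        star (zeroExtend q n) := by
  have hgauge := connForm_gauge (u := zeroExtend u) (v := zeroExtend v) (r' := fun _ => 0) (n := n)
    (r := fun k => star (zeroExtend q k)) hp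
    (fun k hk => by rw [zeroExtend_of_lt u (by omega)]; exact hu _)
    (fun k hk => by rw [zeroExtend_of_lt q (by omega), norm_star]; exact hq _) (by simp)
  have hleft (k : ℕ) : leftFactor 0 (fun _ => 0) k = 0 := by
    match k with
    | 0 => rfl
    | 1 => rfl
    | _ + 2 => exact star_zero _
  simp only [hleft, zero_mul, add_zero, zero_smul, smul_zero, zero_add, MulOpposite.op_zero]
    at hgauge
  rw [← hgauge]
  exact connForm_congr (fun k hk => zeroExtend_wilhelmAction p q u (by omega))
    fun k hk => zeroExtend_wilhelmAction p q v (by omega)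

lemma preservesMetric_wilhelmAction (hm : 0 < m) (t : ℝ) (hp : p ∈ S3) (hq : q ∈ S3pow m) :
    PreservesMetric (Sp2m m) (connMetric m t) (wilhelmAction m p q) := by
  refine ⟨fun u hu => wilhelmAction_mem hp hq hu, fun u hu v _ w _ => ?_⟩
  replace hu := (mem_Sp2m_iff.1 hu).1
  rw [mem_S3_iff] at hp
  replace hq (i) : ‖q i‖ = 1 := mem_S3_iff.1 (hq i)
  have hr {k : ℕ} (hk : k < m) : ‖star (zeroExtend q k)‖ = 1 := by
    rw [zeroExtend_of_lt q hk, norm_star, hq]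
  rw [fderiv_wilhelmAction, fderiv_wilhelmAction, connMetric_apply, connMetric_apply,
    connMetricFun, connMetricFun]
  refine congrArg₂ (· + t ^ 2 * ·) ?_ ?_
  · have horth (v : ℍ[ℝ] × ℍ[ℝ]) :
        orthComp ((p • zeroExtend u 0) <• star (zeroExtend q 0))
          ((p • v) <• star (zeroExtend q 0)) =
        (p • orthComp (zeroExtend u 0) v) <• star (zeroExtend q 0) := by
      simpa using orthComp_gauge (z := v) (r' := 0) hp (hr hm)
        (by rw [zeroExtend_of_lt u hm]; exact hu _)
    simp only [zeroExtend_wilhelmAction p q _ hm, leftFactor, horth, re_herm_gauge hp (hr hm)]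
  · refine Finset.sum_congr rfl fun n hn => ?_
    rw [Finset.mem_range] at hn
    rw [connForm_wilhelmAction hp hq hu v hn, connForm_wilhelmAction hp hq hu w hn,
      inner_conj_conj (hr hn)]

end Invariance

/-- The equations of `Sp(2,m)` for the first `m` terms of a sequence of columns. -/
structure IsAdmissible (m : ℕ) (u : ℕ → ℍ[ℝ] × ℍ[ℝ]) : Prop where
  herm_self : ∀ k < m, herm (u k) (u k) = 1
  herm_link : ∀ k, k + 1 < m → herm (link k (u k)) (u (k + 1)) = 0

lemma mem_Sp2m_iff_isAdmissible {m : ℕ} {u : Fin m → ℍ[ℝ] × ℍ[ℝ]} :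
    u ∈ Sp2m m ↔ IsAdmissible m (zeroExtend u) := by
  rw [mem_Sp2m_iff]
  refine ⟨fun ⟨hself, hlink⟩ => ⟨fun k hk => ?_, fun k hk => ?_⟩, fun h =>
    ⟨fun i => by simpa using h.herm_self i i.isLt, fun i j hij => ?_⟩⟩
  · rw [zeroExtend_of_lt u hk]
    exact hself _
  · rw [zeroExtend_of_lt u hk, zeroExtend_of_lt u (show k < m by omega)]
    exact hlink ⟨k, by omega⟩ ⟨k + 1, hk⟩ rfl
  · simpa [← hij] using h.herm_link i (hij ▸ j.isLt)

lemma IsAdmissible.orthonormalPair {m : ℕ} {u : ℕ → ℍ[ℝ] × ℍ[ℝ]} (hu : IsAdmissible m u)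
    (hm : 1 < m) : OrthonormalPair (u 0) (u 1) :=
  ⟨hu.herm_self 0 (by omega), hu.herm_self 1 hm, hu.herm_link 0 hm⟩

/-! ### Rotations of orthonormal pairs -/

/-- The normalizing factor of `x + y a` for orthonormal columns `x` and `y`. -/
def projScale (a : ℍ[ℝ]) : ℝ := (√(1 + ‖a‖ ^ 2))⁻¹

lemma projScale_pos (a : ℍ[ℝ]) : 0 < projScale a := by unfold projScale; positivity

lemma projScale_sq_mul (a : ℍ[ℝ]) : projScale a ^ 2 * (1 + ‖a‖ ^ 2) = 1 := by
  rw [projScale, inv_pow, Real.sq_sqrt (by positivity), inv_mul_cancel₀ (by positivity)]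

@[simp] lemma projScale_zero : projScale 0 = 1 := by simp [projScale]

lemma projScale_neg_star (a : ℍ[ℝ]) : projScale (-star a) = projScale a := by simp [projScale]

@[fun_prop]
lemma contDiffAt_projScale {E : Type*} [NormedAddCommGroup E] [NormedSpace ℝ E] {n : WithTop ℕ∞}
    {f : E → ℍ[ℝ]} {x : E} (hf : ContDiffAt ℝ n f x) :
    ContDiffAt ℝ n (fun x => projScale (f x)) x := by
  have hsq : ContDiffAt ℝ n (fun x => 1 + ‖f x‖ ^ 2) x := contDiffAt_const.add (hf.norm_sq ℝ)
  exact (hsq.sqrt (by positivity)).inv (by positivity)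

/-- The unit column proportional to `x + y a`, for orthonormal columns `x` and `y`. -/
def unitCombo (x y : ℍ[ℝ] × ℍ[ℝ]) (a : ℍ[ℝ]) : ℍ[ℝ] × ℍ[ℝ] := projScale a • (x + y <• a)

@[simp] lemma unitCombo_zero (x y : ℍ[ℝ] × ℍ[ℝ]) : unitCombo x y 0 = x := by simp [unitCombo]

@[fun_prop]
lemma contDiffAt_unitCombo {E : Type*} [NormedAddCommGroup E] [NormedSpace ℝ E] {n : WithTop ℕ∞}
    {f g : E → ℍ[ℝ] × ℍ[ℝ]} {a : E → ℍ[ℝ]} {x : E} (hf : ContDiffAt ℝ n f x)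
    (hg : ContDiffAt ℝ n g x) (ha : ContDiffAt ℝ n a x) :
    ContDiffAt ℝ n (fun x => unitCombo (f x) (g x) (a x)) x := by
  unfold unitCombo; fun_prop

section UnitCombo

variable {x y : ℍ[ℝ] × ℍ[ℝ]}

lemma OrthonormalPair.herm_unitCombo_left (h : OrthonormalPair x y) (a : ℍ[ℝ]) :
    herm (unitCombo x y a) x = projScale a := by
  rw [unitCombo, herm_real_smul_left, herm_add_left, h.herm_left, herm_op_smul_left,
    h.symm.herm_eq_zero, mul_zero, add_zero, ← Quaternion.coe_one, ← Quaternion.coe_smul,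
    smul_eq_mul, mul_one]

lemma OrthonormalPair.herm_unitCombo_right (h : OrthonormalPair x y) (a : ℍ[ℝ]) :
    herm (unitCombo x y a) y = projScale a • star a := by
  rw [unitCombo, herm_real_smul_left, herm_add_left, h.herm_eq_zero, herm_op_smul_left,
    h.herm_right, mul_one, zero_add]

lemma OrthonormalPair.herm_unitCombo_unitCombo (h : OrthonormalPair x y) (a b : ℍ[ℝ]) :
    herm (unitCombo x y a) (unitCombo x y b) = (projScale a * projScale b) • (1 + star a * b) := by
  rw [unitCombo, unitCombo, herm_real_smul_left, herm_real_smul_right, smul_smul, herm_add_left,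
    herm_add_right, herm_add_right]
  simp only [herm_op_smul_left, herm_op_smul_right, h.herm_left, h.herm_right, h.herm_eq_zero,
    h.symm.herm_eq_zero, mul_one, zero_mul, mul_zero, zero_add, add_zero]

lemma OrthonormalPair.herm_unitCombo_self (h : OrthonormalPair x y) (a : ℍ[ℝ]) :
    herm (unitCombo x y a) (unitCombo x y a) = 1 := by
  rw [h.herm_unitCombo_unitCombo, star_mul_self_eq_norm_sq, ← Quaternion.coe_one,
    ← Quaternion.coe_add, ← Quaternion.coe_smul, smul_eq_mul, ← sq, projScale_sq_mul]

lemma OrthonormalPair.unitCombo (h : OrthonormalPair x y) (a : ℍ[ℝ]) :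
    OrthonormalPair (unitCombo x y a) (unitCombo y x (-star a)) := by
  refine ⟨h.herm_unitCombo_self a, h.symm.herm_unitCombo_self _, ?_⟩
  rw [Wilhelm.unitCombo.eq_def y, herm_real_smul_right, herm_add_right, herm_op_smul_right,
    h.herm_unitCombo_left, h.herm_unitCombo_right, Quaternion.coe_mul_eq_smul, smul_neg,
    add_neg_cancel, smul_zero]

lemma OrthonormalPair.orthComp_eq (h : OrthonormalPair x y) (v : ℍ[ℝ] × ℍ[ℝ]) :
    orthComp x v = y <• herm y v := by
  rw [orthComp, sub_eq_iff_eq_add', h.expand]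

end UnitCombo

/-! ### Derivatives along curves -/

section Curves

variable {f g : ℝ → ℍ[ℝ] × ℍ[ℝ]} {f' g' : ℍ[ℝ] × ℍ[ℝ]} {a : ℝ → ℍ[ℝ]} {a' : ℍ[ℝ]} {s : ℝ}

lemma hasDerivAt_fst (hf : HasDerivAt f f' s) : HasDerivAt (fun s => (f s).1) f'.1 s :=
  (ContinuousLinearMap.fst ℝ ℍ[ℝ] ℍ[ℝ]).hasFDerivAt.comp_hasDerivAt s hf

lemma hasDerivAt_snd (hf : HasDerivAt f f' s) : HasDerivAt (fun s => (f s).2) f'.2 s :=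
  (ContinuousLinearMap.snd ℝ ℍ[ℝ] ℍ[ℝ]).hasFDerivAt.comp_hasDerivAt s hf

lemma hasDerivAt_im (ha : HasDerivAt a a' s) : HasDerivAt (fun s => (a s).im) a'.im s := by
  let imL : ℍ[ℝ] →ₗ[ℝ] ℍ[ℝ] :=
    ⟨⟨Quaternion.im, Quaternion.im_add⟩, fun r a => Quaternion.im_smul a r⟩
  exact imL.toContinuousLinearMap.hasFDerivAt.comp_hasDerivAt s ha

lemma hasDerivAt_op_smul (hf : HasDerivAt f f' s) (ha : HasDerivAt a a' s) :
    HasDerivAt (fun s => f s <• a s) (f' <• a s + f s <• a') s :=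
  ((MulOpposite.opContinuousLinearEquiv ℝ).hasFDerivAt.comp_hasDerivAt s ha).smul hf

lemma hasDerivAt_herm (hf : HasDerivAt f f' s) (hg : HasDerivAt g g' s) :
    HasDerivAt (fun s => herm (f s) (g s)) (herm f' (g s) + herm (f s) g') s := by
  refine (((hasDerivAt_fst hf).star.fun_mul (hasDerivAt_fst hg)).fun_add
    ((hasDerivAt_snd hf).star.fun_mul (hasDerivAt_snd hg))).congr_deriv ?_
  simp only [herm]
  abel

lemma re_herm_deriv_eq_zero (hf : HasDerivAt f f' s)
    (hunit : ∀ᶠ z in 𝓝 s, herm (f z) (f z) = 1) : (herm (f s) f').re = 0 := by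
  have hderiv := (hasDerivAt_herm hf hf).unique
    ((hasDerivAt_const s (1 : ℍ[ℝ])).congr_of_eventuallyEq hunit)
  have hre := congrArg (fun q : ℍ[ℝ] => q.re) hderiv
  simp only [Quaternion.re_add, Quaternion.re_zero, ← star_herm (f s) f', Quaternion.re_star] at hre
  linarith

lemma exists_hasDerivAt_unitCombo (x y : ℍ[ℝ] × ℍ[ℝ]) (ha : HasDerivAt a a' s) :
    ∃ c : ℝ, HasDerivAt (fun s => unitCombo x y (a s))
      (c • unitCombo x y (a s) + projScale (a s) • (y <• a')) s := by
  have hscale : DifferentiableAt ℝ projScale (a s) :=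
    ContDiffAt.differentiableAt (n := ω) (contDiffAt_projScale contDiffAt_id) (by simp)
  have hscale' := (hscale.comp s ha.differentiableAt).hasDerivAt
  refine ⟨deriv (projScale ∘ a) s * (projScale (a s))⁻¹, (hscale'.fun_smul
    ((hasDerivAt_op_smul (hasDerivAt_const s y) ha).const_add x)).congr_deriv ?_⟩
  rw [unitCombo, smul_smul, mul_assoc, inv_mul_cancel₀ (projScale_pos _).ne']
  simp [add_comm]

lemma exists_hasDerivAt_unitOrthComp {q : ℍ[ℝ] × ℍ[ℝ]} (hf : HasDerivAt f f' s)
    (hq : orthComp (f s) q ≠ 0) :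
    ∃ c : ℝ, HasDerivAt (fun s => unitOrthComp (f s) q)
      (c • orthComp (f s) q - (√(normSq (orthComp (f s) q)))⁻¹ •
        (f' <• herm (f s) q + f s <• herm f' q)) s := by
  have hpos := normSq_pos_iff.2 hq
  have hscale : DifferentiableAt ℝ (fun x => (√(normSq (orthComp x q)))⁻¹) (f s) := by
    have hsq : ContDiffAt ℝ ω (fun x => normSq (orthComp x q)) (f s) := by fun_prop
    exact ((hsq.sqrt hpos.ne').inv (Real.sqrt_pos.2 hpos).ne').differentiableAt (by simp)
  have hherm : HasDerivAt (fun s => herm (f s) q) (herm f' q) s := by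
    simpa using hasDerivAt_herm hf (hasDerivAt_const s q)
  have hscale' := (hscale.comp s hf.differentiableAt).hasDerivAt
  refine ⟨deriv ((fun x => (√(normSq (orthComp x q)))⁻¹) ∘ f) s,
    (hscale'.fun_smul ((hasDerivAt_op_smul hf hherm).const_sub q)).congr_deriv ?_⟩
  rw [smul_neg, add_comm, ← sub_eq_add_neg]
  rfl

lemma im_herm_unitOrthComp_deriv {q w : ℍ[ℝ] × ℍ[ℝ]} (hf : HasDerivAt f f' s)
    (hunit : herm (f s) (f s) = 1) (hq : orthComp (f s) q ≠ 0)
    (hw : HasDerivAt (fun s => unitOrthComp (f s) q) w s) :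
    (herm (unitOrthComp (f s) q) w).im = ((normSq (orthComp (f s) q))⁻¹ •
      (star (herm (f s) q) * herm (f s) f' * herm (f s) q -
        star (herm f' q) * herm (f s) q)).im := by
  obtain ⟨c, hc⟩ := exists_hasDerivAt_unitOrthComp hf hq
  rw [hw.unique hc]
  set ν := √(normSq (orthComp (f s) q)) with hν
  have hν_sq : ν⁻¹ * ν⁻¹ = (normSq (orthComp (f s) q))⁻¹ := by
    rw [← mul_inv, hν, Real.mul_self_sqrt (normSq_pos_iff.2 hq).le]
  have horth : herm (orthComp (f s) q) (f s) = 0 := by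
    rw [← star_herm, herm_orthComp hunit, star_zero]
  have hvel : herm (orthComp (f s) q) f' =
      star (herm f' q) - star (herm (f s) q) * herm (f s) f' := by
    rw [orthComp, herm_sub_left, herm_op_smul_left, ← star_herm f' q]
  rw [unitOrthComp, ← hν, herm_real_smul_left, herm_sub_right, herm_real_smul_right,
    herm_real_smul_right, herm_self_eq_normSq, herm_add_right, herm_op_smul_right,
    herm_op_smul_right, horth, hvel, zero_mul, add_zero, smul_sub, smul_smul, smul_smul, hν_sq,
    ← Quaternion.coe_smul, sub_eq_add_neg, Quaternion.im_add, Quaternion.im_coe, zero_add,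
    ← smul_neg, sub_mul, neg_sub]

end Curves

/-! ### Local sections of `Sp(2,m) → S⁴` -/

/-- The local section through the admissible sequence `p` of `Sp(2,m) → S⁴` over the affine chart of
`S⁴ = ℍP¹` in which `y` is the line spanned by `p 0 + (p 1) y`; its value at `y = 0` is `p`. -/
def hopfSection (p : ℕ → ℍ[ℝ] × ℍ[ℝ]) (y : ℍ[ℝ]) : ℕ → ℍ[ℝ] × ℍ[ℝ]
  | 0 => unitCombo (p 0) (p 1) y
  | 1 => unitCombo (p 1) (p 0) (-star y)
  | n + 2 => unitOrthComp (star (hopfSection p y (n + 1))) (p (n + 2))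

/-- The parameters at which none of the projections in the recursion for `hopfSection` vanishes. -/
def InSectionDomain (m : ℕ) (p : ℕ → ℍ[ℝ] × ℍ[ℝ]) (y : ℍ[ℝ]) : Prop :=
  ∀ n, n + 2 < m → orthComp (star (hopfSection p y (n + 1))) (p (n + 2)) ≠ 0

section Section

variable {m : ℕ} {p : ℕ → ℍ[ℝ] × ℍ[ℝ]} {y : ℍ[ℝ]}

lemma IsAdmissible.hopfSection (hm : 1 < m) (hp : IsAdmissible m p) (hy : InSectionDomain m p y) :
    IsAdmissible m (hopfSection p y) := by
  have hpair := (hp.orthonormalPair hm).unitCombo y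
  have hself : ∀ k < m, herm (Wilhelm.hopfSection p y k) (Wilhelm.hopfSection p y k) = 1
    | 0, _ => hpair.herm_left
    | 1, _ => hpair.herm_right
    | k + 2, hk => herm_unitOrthComp_self (hy k hk)
  refine ⟨hself, fun k hk => ?_⟩
  cases k with
  | zero => exact hpair.herm_eq_zero
  | succ k => exact herm_unitOrthComp ((herm_star_self _).trans (hself (k + 1) (by omega)))

lemma IsAdmissible.herm_star (hp : IsAdmissible m p) {n : ℕ} (hn : n + 2 < m) :
    herm (star (p (n + 1))) (p (n + 2)) = 0 :=
  hp.herm_link (n + 1) hn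

lemma hopfSection_zero (hp : IsAdmissible m p) {n : ℕ} (hn : n < m) : hopfSection p 0 n = p n := by
  induction n using Nat.twoStepInduction with
  | zero => exact unitCombo_zero _ _
  | one => rw [hopfSection, star_zero, neg_zero, unitCombo_zero]
  | more n _ ih =>
    have hunit := hp.herm_self (n + 2) hn
    rw [herm_self_eq_normSq, coe_eq_one_iff] at hunit
    rw [hopfSection, ih (by omega), unitOrthComp, orthComp_eq_self (hp.herm_star hn), hunit,
      Real.sqrt_one, inv_one, one_smul]

lemma inSectionDomain_zero (hp : IsAdmissible m p) : InSectionDomain m p 0 := by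
  intro n hn hzero
  rw [hopfSection_zero hp (by omega), orthComp_eq_self (hp.herm_star hn)] at hzero
  simpa [hzero] using hp.herm_self (n + 2) hn

variable {E : Type*} [NormedAddCommGroup E] [NormedSpace ℝ E] {k : WithTop ℕ∞} {x : E}
  {f : E → ℕ → ℍ[ℝ] × ℍ[ℝ]} {g : E → ℍ[ℝ]}

lemma contDiffAt_hopfSection (hf : ∀ j, ContDiffAt ℝ k (fun x => f x j) x)
    (hg : ContDiffAt ℝ k g x) (hdom : InSectionDomain m (f x) (g x)) {n : ℕ} (hn : n < m) :
    ContDiffAt ℝ k (fun x => hopfSection (f x) (g x) n) x := by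
  induction n using Nat.twoStepInduction with
  | zero => simp only [hopfSection]; fun_prop
  | one => simp only [hopfSection]; fun_prop
  | more n _ ih =>
    exact contDiffAt_unitOrthComp (contDiffAt_star (ih (by omega))) (hf _) (hdom n hn)

lemma eventually_inSectionDomain (hf : ∀ j, ContDiffAt ℝ k (fun x => f x j) x)
    (hg : ContDiffAt ℝ k g x) (hdom : InSectionDomain m (f x) (g x)) :
    ∀ᶠ x in 𝓝 x, InSectionDomain m (f x) (g x) := by
  have hcolumn : ∀ n ∈ Finset.range m, ∀ᶠ x in 𝓝 x, n + 2 < m →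
      orthComp (star (hopfSection (f x) (g x) (n + 1))) (f x (n + 2)) ≠ 0 := by
    intro n _
    by_cases hn : n + 2 < m
    · have hcont : ContDiffAt ℝ k
          (fun x => orthComp (star (hopfSection (f x) (g x) (n + 1))) (f x (n + 2))) x :=
        contDiffAt_orthComp (contDiffAt_star (contDiffAt_hopfSection hf hg hdom (by omega))) (hf _)
      filter_upwards [hcont.continuousAt.eventually_ne (hdom n hn)] with z hz _ using hz
    · exact .of_forall fun _ h => absurd h hn
  filter_upwards [(Finset.eventually_all _).2 hcolumn] with z hz n hn
  exact hz n (Finset.mem_range.2 (by omega)) hn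

end Section

/-! ### The connection form along a local section -/

/-- The local section as a function of its centre and its parameter. -/
def sectionPoint (m : ℕ) (z : (Fin m → ℍ[ℝ] × ℍ[ℝ]) × ℍ[ℝ]) : Fin m → ℍ[ℝ] × ℍ[ℝ] :=
  fun i => hopfSection (zeroExtend z.1) z.2 i

/-- The velocity of the local section when its parameter moves in the direction `X`. -/
def sectionVelocity (m : ℕ) (z : (Fin m → ℍ[ℝ] × ℍ[ℝ]) × ℍ[ℝ]) (X : ℍ[ℝ]) :
    Fin m → ℍ[ℝ] × ℍ[ℝ] :=
  fderiv ℝ (sectionPoint m) z (0, X)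

/-- The `n`-th component of the pull-back of the connection form by the local section, evaluated
on `X`. -/
def sectionForm (m : ℕ) (z : (Fin m → ℍ[ℝ] × ℍ[ℝ]) × ℍ[ℝ]) (X : ℍ[ℝ]) (n : ℕ) : ℍ[ℝ] :=
  connForm (zeroExtend (sectionPoint m z)) (zeroExtend (sectionVelocity m z X)) n

lemma im_eq_self_of_re_eq_zero {a : ℍ[ℝ]} (ha : a.re = 0) : a.im = a := by
  rw [← Quaternion.sub_re_self, ha, Quaternion.coe_zero, sub_zero]

lemma re_herm_smul_self {a : ℍ[ℝ]} (ha : a.re = 0) (x : ℍ[ℝ] × ℍ[ℝ]) :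
    (herm x (a • x)).re = 0 := by
  simp [herm, ha]
  ring

lemma re_connForm {u v : ℕ → ℍ[ℝ] × ℍ[ℝ]} {n : ℕ} (h : ∀ k ≤ n, (herm (u k) (v k)).re = 0) :
    (connForm u v n).re = 0 := by
  induction n using connForm.induct with
  | case1 => exact h 0 le_rfl
  | case2 => exact h 1 le_rfl
  | case3 n ih =>
    rw [connForm, Quaternion.re_add, h _ le_rfl, zero_add,
      re_herm_smul_self (ih fun k hk => h k (by omega))]

section Form

variable {m : ℕ} {p : Fin m → ℍ[ℝ] × ℍ[ℝ]} {y : ℍ[ℝ]} {X : ℍ[ℝ]} {n : ℕ}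

lemma zeroExtend_sectionPoint (hn : n < m) :
    zeroExtend (sectionPoint m (p, y)) n = hopfSection (zeroExtend p) y n :=
  zeroExtend_of_lt _ hn

lemma contDiffAt_sectionPoint (hy : InSectionDomain m (zeroExtend p) y) :
    ContDiffAt ℝ ω (sectionPoint m) (p, y) :=
  contDiffAt_pi.2 fun i => contDiffAt_hopfSection (m := m)
    (f := fun z : (Fin m → ℍ[ℝ] × ℍ[ℝ]) × ℍ[ℝ] => zeroExtend z.1) (g := Prod.snd)
    (fun j => by fun_prop) (by fun_prop) hy i.isLt

lemma contDiffAt_sectionVelocity (hy : InSectionDomain m (zeroExtend p) y) (X : ℍ[ℝ]) :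
    ContDiffAt ℝ ω (fun z => sectionVelocity m z X) (p, y) :=
  ((contDiffAt_sectionPoint hy).fderiv_right (m := ω) (by simp)).clm_apply contDiffAt_const

lemma contDiffAt_sectionForm (hy : InSectionDomain m (zeroExtend p) y) (X : ℍ[ℝ]) (n : ℕ) :
    ContDiffAt ℝ ω (fun z => sectionForm m z X n) (p, y) :=
  contDiffAt_connForm (fun _ _ => contDiffAt_zeroExtend (contDiffAt_sectionPoint hy))
    fun _ _ => contDiffAt_zeroExtend (contDiffAt_sectionVelocity hy X)

lemma hasDerivAt_sectionPoint (hy : InSectionDomain m (zeroExtend p) y) (X : ℍ[ℝ]) :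
    HasDerivAt (fun s : ℝ => sectionPoint m (p, y + s • X)) (sectionVelocity m (p, y) X) 0 := by
  have h := ((contDiffAt_sectionPoint hy).differentiableAt
    (by simp)).hasFDerivAt.hasLineDerivAt (0, X)
  simp only [HasLineDerivAt, Prod.smul_mk, Prod.mk_add_mk, smul_zero, add_zero] at h
  exact h

lemma hasDerivAt_hopfSection (hy : InSectionDomain m (zeroExtend p) y) (X : ℍ[ℝ]) (hn : n < m) :
    HasDerivAt (fun s : ℝ => hopfSection (zeroExtend p) (y + s • X) n)
      (zeroExtend (sectionVelocity m (p, y) X) n) 0 := by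
  rw [zeroExtend_of_lt _ hn]
  exact hasDerivAt_pi.1 (hasDerivAt_sectionPoint hy X) ⟨n, hn⟩

lemma eventually_inSectionDomain_add_smul (hy : InSectionDomain m (zeroExtend p) y) (X : ℍ[ℝ]) :
    ∀ᶠ s : ℝ in 𝓝 0, InSectionDomain m (zeroExtend p) (y + s • X) :=
  eventually_inSectionDomain (k := 0) (f := fun _ : ℝ => zeroExtend p)
    (g := fun s : ℝ => y + s • X) (fun _ => contDiffAt_const) (by fun_prop) (by simpa using hy)

lemma re_sectionForm (hm : 1 < m) (hp : IsAdmissible m (zeroExtend p))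
    (hy : InSectionDomain m (zeroExtend p) y) (X : ℍ[ℝ]) (hn : n < m) :
    (sectionForm m (p, y) X n).re = 0 := by
  refine re_connForm fun k hk => ?_
  have hperp := re_herm_deriv_eq_zero (hasDerivAt_hopfSection hy X (show k < m by omega)) (by
    filter_upwards [eventually_inSectionDomain_add_smul hy X] with s hs
      using (hp.hopfSection hm hs).herm_self k (by omega))
  simpa [zeroExtend_sectionPoint (show k < m by omega)] using hperp

lemma exists_sectionVelocity_zero (hm : 1 < m) (hy : InSectionDomain m (zeroExtend p) y)
    (X : ℍ[ℝ]) :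
    ∃ c : ℝ, zeroExtend (sectionVelocity m (p, y) X) 0 = c • hopfSection (zeroExtend p) y 0 +
      projScale y • (zeroExtend p 1 <• X) := by
  have hline : HasDerivAt (fun s : ℝ => y + s • X) X 0 := (hasFDerivAt_id y).hasLineDerivAt X
  obtain ⟨c, hc⟩ := exists_hasDerivAt_unitCombo (zeroExtend p 0) (zeroExtend p 1) hline
  refine ⟨c, (hasDerivAt_hopfSection hy X (by omega)).unique (hc.congr_deriv ?_)⟩
  rw [zero_smul, add_zero, hopfSection]

lemma exists_sectionVelocity_one (hm : 1 < m) (hy : InSectionDomain m (zeroExtend p) y)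
    (X : ℍ[ℝ]) :
    ∃ c : ℝ, zeroExtend (sectionVelocity m (p, y) X) 1 = c • hopfSection (zeroExtend p) y 1 +
      projScale y • (zeroExtend p 0 <• (-star X)) := by
  have hline : HasDerivAt (fun s : ℝ => y + s • X) X 0 := (hasFDerivAt_id y).hasLineDerivAt X
  obtain ⟨c, hc⟩ :=
    exists_hasDerivAt_unitCombo (zeroExtend p 1) (zeroExtend p 0) hline.star.fun_neg
  refine ⟨c, (hasDerivAt_hopfSection hy X hm).unique (hc.congr_deriv ?_)⟩
  rw [zero_smul, add_zero, hopfSection, projScale_neg_star]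

lemma orthComp_sectionVelocity (hm : 1 < m) (hp : IsAdmissible m (zeroExtend p))
    (hy : InSectionDomain m (zeroExtend p) y) (X : ℍ[ℝ]) :
    orthComp (hopfSection (zeroExtend p) y 0) (zeroExtend (sectionVelocity m (p, y) X) 0) =
      projScale y ^ 2 • (hopfSection (zeroExtend p) y 1 <• X) := by
  obtain ⟨c, hc⟩ := exists_sectionVelocity_zero hm hy X
  have hpair := (hp.hopfSection hm hy).orthonormalPair hm
  rw [hpair.orthComp_eq, hc, herm_add_right, herm_real_smul_right, hpair.symm.herm_eq_zero,
    smul_zero, zero_add, herm_real_smul_right, herm_op_smul_right, hopfSection,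
    (hp.orthonormalPair hm).symm.herm_unitCombo_left, projScale_neg_star,
    Quaternion.coe_mul_eq_smul, op_real_smul, op_real_smul, smul_smul, sq]

lemma herm_unitCombo_velocity {x z : ℍ[ℝ] × ℍ[ℝ]} (h : OrthonormalPair x z) (a b : ℍ[ℝ]) (c : ℝ) :
    herm (unitCombo x z a) (c • unitCombo x z a + projScale a • (z <• b)) =
      c + projScale a ^ 2 • (star a * b) := by
  rw [herm_add_right, herm_real_smul_right, h.herm_unitCombo_self, herm_real_smul_right,
    herm_op_smul_right, h.herm_unitCombo_right, smul_mul_assoc, smul_smul, sq,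
    ← Quaternion.coe_one, ← Quaternion.coe_smul, smul_eq_mul, mul_one]

lemma sectionForm_zero (hm : 1 < m) (hp : IsAdmissible m (zeroExtend p))
    (hy : InSectionDomain m (zeroExtend p) y) (X : ℍ[ℝ]) :
    sectionForm m (p, y) X 0 = projScale y ^ 2 • (star y * X).im := by
  obtain ⟨c, hc⟩ := exists_sectionVelocity_zero hm hy X
  rw [← im_eq_self_of_re_eq_zero (re_sectionForm hm hp hy X (by omega)), sectionForm, connForm,
    zeroExtend_sectionPoint (by omega), hc, hopfSection,
    herm_unitCombo_velocity (hp.orthonormalPair hm), Quaternion.im_add, Quaternion.im_coe, zero_add,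
    Quaternion.im_smul]

lemma sectionForm_one (hm : 1 < m) (hp : IsAdmissible m (zeroExtend p))
    (hy : InSectionDomain m (zeroExtend p) y) (X : ℍ[ℝ]) :
    sectionForm m (p, y) X 1 = projScale y ^ 2 • (y * star X).im := by
  obtain ⟨c, hc⟩ := exists_sectionVelocity_one hm hy X
  rw [← im_eq_self_of_re_eq_zero (re_sectionForm hm hp hy X hm), sectionForm, connForm,
    zeroExtend_sectionPoint hm, hc, hopfSection, ← projScale_neg_star y,
    herm_unitCombo_velocity (hp.orthonormalPair hm).symm, Quaternion.im_add, Quaternion.im_coe,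
    zero_add, Quaternion.im_smul, star_neg, star_star, neg_mul_neg]

lemma sectionForm_add_two (hm : 1 < m) (hp : IsAdmissible m (zeroExtend p))
    (hy : InSectionDomain m (zeroExtend p) y) (X : ℍ[ℝ]) (hn : n + 2 < m) :
    let x := star (hopfSection (zeroExtend p) y (n + 1))
    let x' := star (zeroExtend (sectionVelocity m (p, y) X) (n + 1))
    let q := zeroExtend p (n + 2)
    sectionForm m (p, y) X (n + 2) = ((normSq (orthComp x q))⁻¹ •
        (star (herm x q) * herm x x' * herm x q - star (herm x' q) * herm x q)).im +
      herm (hopfSection (zeroExtend p) y (n + 2))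
        (sectionForm m (p, y) X (n + 1) • hopfSection (zeroExtend p) y (n + 2)) := by
  intro x x' q
  have hvel := im_herm_unitOrthComp_deriv (q := q)
    (hasDerivAt_hopfSection hy X (show n + 1 < m by omega)).star
    (by simpa [herm_star_self] using (hp.hopfSection hm hy).herm_self (n + 1) (by omega))
    (by simpa using hy n hn) (hasDerivAt_hopfSection hy X hn)
  simp only [zero_smul, add_zero] at hvel
  rw [← im_eq_self_of_re_eq_zero (re_sectionForm hm hp hy X hn), ← hvel, sectionForm, connForm,
    zeroExtend_sectionPoint hn, Quaternion.im_add, ← sectionForm,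
    im_eq_self_of_re_eq_zero (re_herm_smul_self (re_sectionForm hm hp hy X (by omega)) _)]
  rfl

/-! ### Radial directions -/

lemma sectionForm_radial_zero (hm : 1 < m) (hp : IsAdmissible m (zeroExtend p)) {s : ℝ}
    (hs : InSectionDomain m (zeroExtend p) (s • X)) : sectionForm m (p, s • X) X 0 = 0 := by
  rw [sectionForm_zero hm hp hs, Quaternion.star_smul, smul_mul_assoc, star_mul_self_eq_norm_sq,
    Quaternion.im_smul, Quaternion.im_coe, smul_zero, smul_zero]

lemma sectionForm_radial_one (hm : 1 < m) (hp : IsAdmissible m (zeroExtend p)) {s : ℝ}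
    (hs : InSectionDomain m (zeroExtend p) (s • X)) : sectionForm m (p, s • X) X 1 = 0 := by
  rw [sectionForm_one hm hp hs, smul_mul_assoc, mul_star_self_eq_norm_sq, Quaternion.im_smul,
    Quaternion.im_coe, smul_zero, smul_zero]

/- If `C` vanishes at `0`, the only term of first order is `-star (D 0) * C`, whose derivative
`-|D 0|²` is real. -/
lemma hasDerivAt_im_smul_sub {N : ℝ → ℝ} {C D R : ℝ → ℍ[ℝ]} {s : ℝ} (hN : DifferentiableAt ℝ N s)
    (hD : DifferentiableAt ℝ D s) (hR : DifferentiableAt ℝ R s) (hC : HasDerivAt C (D s) s)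
    (hCs : C s = 0) :
    HasDerivAt (fun s => (N s • (star (C s) * R s * C s - star (D s) * C s)).im) 0 s := by
  have hquad := (hC.star.fun_mul hR.hasDerivAt).fun_mul hC
  have hlin := hD.hasDerivAt.star.fun_mul hC
  refine (hasDerivAt_im (hN.hasDerivAt.fun_smul (hquad.fun_sub hlin))).congr_deriv ?_
  simp [hCs, star_mul_self_eq_norm_sq, -Quaternion.coe_pow]

lemma herm_star_hopfSection_zero (hp : IsAdmissible m (zeroExtend p)) (hn : n + 2 < m) :
    herm (star (hopfSection (zeroExtend p) 0 (n + 1))) (zeroExtend p (n + 2)) = 0 := by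
  rw [hopfSection_zero hp (by omega), hp.herm_star hn]

lemma sectionForm_center_add_two (hm : 1 < m) (hp : IsAdmissible m (zeroExtend p)) (X : ℍ[ℝ])
    (hn : n + 2 < m) (hzero : sectionForm m (p, 0) X (n + 1) = 0) :
    sectionForm m (p, 0) X (n + 2) = 0 := by
  simp only [sectionForm_add_two hm hp (inSectionDomain_zero hp) X hn, hzero,
    herm_star_hopfSection_zero hp hn, mul_zero, sub_zero, smul_zero, zero_smul, herm_zero_right,
    Quaternion.im_zero, add_zero]

lemma hasDerivAt_sectionForm_radial_add_two (hm : 1 < m) (hp : IsAdmissible m (zeroExtend p))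
    (X : ℍ[ℝ]) (hn : n + 2 < m) (hzero : sectionForm m (p, 0) X (n + 1) = 0)
    (hderiv : HasDerivAt (fun s : ℝ => sectionForm m (p, s • X) X (n + 1)) 0 0) :
    HasDerivAt (fun s : ℝ => sectionForm m (p, s • X) X (n + 2)) 0 0 := by
  have hdom : InSectionDomain m (zeroExtend p) ((0 : ℝ) • X) := by
    simpa using inSectionDomain_zero hp
  have hsec {k : ℕ} (hk : k < m) :
      ContDiffAt ℝ ω (fun s : ℝ => hopfSection (zeroExtend p) (s • X) k) 0 :=
    contDiffAt_hopfSection (m := m) (f := fun _ : ℝ => zeroExtend p) (g := fun s : ℝ => s • X)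
      (fun _ => contDiffAt_const) (by fun_prop) hdom hk
  have hvel : ContDiffAt ℝ ω (fun s : ℝ => sectionVelocity m (p, s • X) X) 0 :=
    (contDiffAt_sectionVelocity hdom X).comp (f := fun s : ℝ => (p, s • X)) 0 (by fun_prop)
  have hsec₁ := hsec (show n + 1 < m by omega)
  have hsec₂ := (hsec hn).differentiableAt (by simp) |>.hasDerivAt
  set q := zeroExtend p (n + 2)
  let C (s : ℝ) := herm (star (hopfSection (zeroExtend p) (s • X) (n + 1))) q
  let D (s : ℝ) := herm (star (zeroExtend (sectionVelocity m (p, s • X) X) (n + 1))) q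
  let R (s : ℝ) := herm (star (hopfSection (zeroExtend p) (s • X) (n + 1)))
    (star (zeroExtend (sectionVelocity m (p, s • X) X) (n + 1)))
  let N (s : ℝ) := (normSq (orthComp (star (hopfSection (zeroExtend p) (s • X) (n + 1))) q))⁻¹
  have hD : ContDiffAt ℝ ω D 0 := by fun_prop
  have hR : ContDiffAt ℝ ω R 0 := by fun_prop
  have hN : ContDiffAt ℝ ω N 0 :=
    ContDiffAt.inv (by fun_prop) (normSq_pos_iff.2 (hdom n hn)).ne'
  have hC_zero : C 0 = 0 := by
    simpa only [C, zero_smul] using herm_star_hopfSection_zero hp hn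
  have hC : HasDerivAt C (D 0) 0 := by
    have h := hasDerivAt_herm
      (hasDerivAt_hopfSection (inSectionDomain_zero hp) X (show n + 1 < m by omega)).star
      (hasDerivAt_const (0 : ℝ) q)
    simpa [C, D] using h
  have hsum := (hasDerivAt_im_smul_sub (hN.differentiableAt (by simp))
    (hD.differentiableAt (by simp)) (hR.differentiableAt (by simp)) hC hC_zero).fun_add
    (hasDerivAt_herm hsec₂ (hderiv.fun_smul hsec₂))
  have hsection : (fun s : ℝ => sectionForm m (p, s • X) X (n + 2)) =ᶠ[𝓝 0] fun s =>
      (N s • (star (C s) * R s * C s - star (D s) * C s)).im +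
        herm (hopfSection (zeroExtend p) (s • X) (n + 2))
          (sectionForm m (p, s • X) X (n + 1) • hopfSection (zeroExtend p) (s • X) (n + 2)) := by
    filter_upwards [eventually_inSectionDomain_add_smul (inSectionDomain_zero hp) X] with s hs
    exact sectionForm_add_two hm hp (by simpa using hs) X hn
  refine (hsum.congr_of_eventuallyEq hsection).congr_deriv ?_
  simp only [zero_smul, hzero, herm_zero_right, add_zero]

lemma hasDerivAt_sectionForm_radial (hm : 1 < m) (hp : IsAdmissible m (zeroExtend p)) (X : ℍ[ℝ])
    (hn : n < m) :
    sectionForm m (p, 0) X n = 0 ∧ HasDerivAt (fun s : ℝ => sectionForm m (p, s • X) X n) 0 0 := by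
  have hdom := inSectionDomain_zero hp
  have hzero_of_radial {k : ℕ} (hk : ∀ {s : ℝ}, InSectionDomain m (zeroExtend p) (s • X) →
      sectionForm m (p, s • X) X k = 0) : sectionForm m (p, 0) X k = 0 ∧
        HasDerivAt (fun s : ℝ => sectionForm m (p, s • X) X k) 0 0 := by
    refine ⟨by simpa using hk (s := 0) (by simpa using hdom),
      (hasDerivAt_const (0 : ℝ) (0 : ℍ[ℝ])).congr_of_eventuallyEq ?_⟩
    filter_upwards [eventually_inSectionDomain_add_smul hdom X] with s hs
    exact hk (by simpa using hs)
  induction n using Nat.twoStepInduction with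
  | zero => exact hzero_of_radial (sectionForm_radial_zero hm hp)
  | one => exact hzero_of_radial (sectionForm_radial_one hm hp)
  | more n _ ih =>
    obtain ⟨hzero, hderiv⟩ := ih (by omega)
    exact ⟨sectionForm_center_add_two hm hp X hn hzero,
      hasDerivAt_sectionForm_radial_add_two hm hp X hn hzero hderiv⟩

end Form

/-! ### Coordinates on `ℍ × (Im ℍ)^m` -/

/-- The orthonormal basis `1, i, j, k` of `ℍ`; its members with index `Fin.succ _` are the basis
`i, j, k` of `Im ℍ`. -/
def quaternionBasis : OrthonormalBasis (Fin 4) ℝ ℍ[ℝ] :=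
  .ofRepr Quaternion.linearIsometryEquivTuple

lemma quaternionBasis_eq :
    ⇑quaternionBasis = ![(1 : ℍ[ℝ]), ⟨0, 1, 0, 0⟩, ⟨0, 0, 1, 0⟩, ⟨0, 0, 0, 1⟩] := by
  funext i
  fin_cases i <;> ext <;> simp [quaternionBasis, OrthonormalBasis.coe_ofRepr]

lemma quaternionBasis_zero : quaternionBasis 0 = 1 :=
  congrFun quaternionBasis_eq 0

lemma inner_quaternionBasis_succ_coe (b : Fin 3) (r : ℝ) :
    inner ℝ (quaternionBasis b.succ) (r : ℍ[ℝ]) = 0 := by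
  rw [← mul_one (r : ℍ[ℝ]), Quaternion.coe_mul_eq_smul, real_inner_smul_right,
    ← quaternionBasis_zero, quaternionBasis.inner_eq_zero (Fin.succ_ne_zero b), mul_zero]

lemma re_quaternionBasis_succ (b : Fin 3) : (quaternionBasis b.succ).re = 0 := by
  have h := inner_quaternionBasis_succ_coe b 1
  rwa [Quaternion.inner_def, Quaternion.coe_one, star_one, mul_one] at h

lemma sum_inner_quaternionBasis_succ (a : ℍ[ℝ]) :
    ∑ b : Fin 3, inner ℝ (quaternionBasis b.succ) a • quaternionBasis b.succ = a.im := by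
  have h := quaternionBasis.sum_repr' a
  rw [Fin.sum_univ_succ, quaternionBasis_zero, real_inner_comm, Quaternion.inner_def, star_one,
    mul_one, ← Quaternion.coe_mul_eq_smul, mul_one] at h
  rw [← Quaternion.sub_re_self, eq_sub_iff_add_eq', h]

/-- The splitting of the coordinates of `ℝ^{3m+4}` into those of `ℍ` and of `m` copies of `Im ℍ`. -/
def coordEquiv (m : ℕ) : Fin (3 * m + 4) ≃ Fin 4 ⊕ (Fin m × Fin 3) :=
  Fintype.equivOfCardEq (by simp; ring)

/-- The component in `ℍ` of a point of `ℝ^{3m+4}`. -/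
def baseParam (m : ℕ) : (Fin (3 * m + 4) → ℝ) →L[ℝ] ℍ[ℝ] :=
  ∑ k : Fin 4, (ContinuousLinearMap.proj (R := ℝ) (φ := fun _ => ℝ)
    ((coordEquiv m).symm (.inl k))).smulRight (quaternionBasis k)

/-- The component in the `s`-th copy of `Im ℍ` of a point of `ℝ^{3m+4}`, rescaled by `t⁻¹` so that
the coordinates are orthonormal at the origin for the connection metric with parameter `t`. -/
def fibreParam (m : ℕ) (t : ℝ) (s : Fin m) : (Fin (3 * m + 4) → ℝ) →L[ℝ] ℍ[ℝ] :=
  ∑ b : Fin 3, (t⁻¹ • ContinuousLinearMap.proj (R := ℝ) (φ := fun _ => ℝ)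
    ((coordEquiv m).symm (.inr (s, b)))).smulRight (quaternionBasis b.succ)

section Coordinates

variable {m : ℕ} {t : ℝ} (x : Fin (3 * m + 4) → ℝ)

lemma baseParam_apply :
    baseParam m x = ∑ k, x ((coordEquiv m).symm (.inl k)) • quaternionBasis k := by
  simp [baseParam]

lemma fibreParam_apply (s : Fin m) : fibreParam m t s x =
    ∑ b : Fin 3, (t⁻¹ * x ((coordEquiv m).symm (.inr (s, b)))) • quaternionBasis b.succ := by
  simp [fibreParam]

lemma inner_baseParam (k : Fin 4) :
    inner ℝ (quaternionBasis k) (baseParam m x) = x ((coordEquiv m).symm (.inl k)) := by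
  simp [baseParam_apply, inner_sum, real_inner_smul_right, quaternionBasis.inner_eq_ite]

lemma inner_fibreParam (s : Fin m) (b : Fin 3) :
    inner ℝ (quaternionBasis b.succ) (fibreParam m t s x) =
      t⁻¹ * x ((coordEquiv m).symm (.inr (s, b))) := by
  simp [fibreParam_apply, inner_sum, real_inner_smul_right, quaternionBasis.inner_eq_ite]

lemma re_fibreParam (s : Fin m) : (fibreParam m t s x).re = 0 := by
  rw [fibreParam_apply, Fin.sum_univ_three]
  simp only [Quaternion.re_add, Quaternion.re_smul, re_quaternionBasis_succ, smul_zero, add_zero]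

end Coordinates

/-! ### The central projection of `S³` -/

/-- The inverse of the central projection from the open half sphere of unit quaternions with
positive real part to `Im ℍ`. -/
def centralProj (z : ℍ[ℝ]) : ℍ[ℝ] := projScale z • (1 + z)

@[simp] lemma centralProj_zero : centralProj 0 = 1 := by simp [centralProj]

lemma norm_centralProj {z : ℍ[ℝ]} (hz : z.re = 0) : ‖centralProj z‖ = 1 := by
  have hsq : ‖1 + z‖ ^ 2 = 1 + ‖z‖ ^ 2 := by
    rw [norm_add_sq_real, norm_one, real_inner_comm, Quaternion.inner_def, star_one, mul_one, hz]
    ring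
  rw [← pow_eq_one_iff_of_nonneg (norm_nonneg _) two_ne_zero, centralProj, norm_smul, mul_pow, hsq,
    Real.norm_of_nonneg (projScale_pos z).le, projScale_sq_mul]

lemma centralProj_re_inv_smul_im {r : ℍ[ℝ]} (hr : ‖r‖ = 1) (hpos : 0 < r.re) :
    centralProj (r.re⁻¹ • r.im) = r := by
  have hadd : 1 + r.re⁻¹ • r.im = r.re⁻¹ • r := by
    rw [← Quaternion.sub_re_self, smul_sub, ← Quaternion.coe_smul, smul_eq_mul,
      inv_mul_cancel₀ hpos.ne', Quaternion.coe_one, add_sub_cancel]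
  have hnorm : 1 + ‖r.re⁻¹ • r.im‖ ^ 2 = r.re⁻¹ ^ 2 := by
    have hmul := norm_centralProj (z := r.re⁻¹ • r.im) (by simp)
    rw [centralProj, hadd, norm_smul, norm_smul, hr, mul_one, Real.norm_of_nonneg
      (projScale_pos _).le, Real.norm_of_nonneg (by positivity)] at hmul
    have hscale := projScale_sq_mul (r.re⁻¹ • r.im)
    rw [eq_inv_of_mul_eq_one_left hmul, inv_inv] at hscale
    rw [inv_pow, eq_inv_of_mul_eq_one_right hscale]
  rw [centralProj, hadd, projScale, hnorm, Real.sqrt_sq (by positivity), inv_inv, smul_smul,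
    mul_inv_cancel₀ hpos.ne', one_smul]

@[fun_prop]
lemma contDiffAt_centralProj {E : Type*} [NormedAddCommGroup E] [NormedSpace ℝ E] {n : WithTop ℕ∞}
    {f : E → ℍ[ℝ]} {x : E} (hf : ContDiffAt ℝ n f x) :
    ContDiffAt ℝ n (fun x => centralProj (f x)) x := by
  unfold centralProj; fun_prop

/-! ### Recovering the parameters of a point -/

section Line

variable {x y v : ℍ[ℝ] × ℍ[ℝ]} {a b : ℍ[ℝ]}

lemma OrthonormalPair.op_smul_herm (h : OrthonormalPair x y) (hv : herm x v = 0) :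
    y <• herm y v = v := by
  simpa [hv] using h.expand v

lemma norm_herm_eq_one (hy : herm y y = 1) (hv : herm v v = 1) (h : y <• herm y v = v) :
    ‖herm y v‖ = 1 := by
  rw [← h, herm_op_smul_left, herm_op_smul_right, hy, one_mul] at hv
  exact star_mul_self_eq_one_iff.1 hv

/-- The affine coordinate of the line spanned by `v`: the quaternion `a` such that `v` is a
multiple of `x + y a`, for orthonormal columns `x` and `y`. -/
def affineCoord (x y v : ℍ[ℝ] × ℍ[ℝ]) : ℍ[ℝ] := herm y v * (herm x v)⁻¹

lemma affineCoord_unitCombo_op_smul (h : OrthonormalPair x y) (a : ℍ[ℝ]) (hb : b ≠ 0) :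
    affineCoord x y (unitCombo x y a <• b) = a := by
  have hscale : (projScale a : ℍ[ℝ]) * b ≠ 0 :=
    mul_ne_zero (mt Quaternion.coe_inj.1 (projScale_pos a).ne') hb
  rw [affineCoord, herm_op_smul_right, herm_op_smul_right, ← star_herm _ y, ← star_herm _ x,
    h.herm_unitCombo_left, h.herm_unitCombo_right, star_smul, star_trivial, star_star,
    Quaternion.star_coe, ← Quaternion.mul_coe_eq_smul, mul_assoc a, mul_inv_cancel_right₀ hscale]

lemma unitCombo_affineCoord_op_smul (h : OrthonormalPair x y) (hv : herm x v ≠ 0) :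
    let w := unitCombo x y (affineCoord x y v)
    w <• herm w v = v := by
  refine (h.unitCombo _).symm.op_smul_herm ?_
  rw [unitCombo, herm_real_smul_left, herm_add_left, herm_op_smul_left, star_neg, star_star,
    affineCoord, neg_mul, inv_mul_cancel_right₀ hv, add_neg_cancel, smul_zero]

lemma contDiffAt_affineCoord {E : Type*} [NormedAddCommGroup E] [NormedSpace ℝ E] {n : WithTop ℕ∞}
    {f g k : E → ℍ[ℝ] × ℍ[ℝ]} {z : E} (hf : ContDiffAt ℝ n f z) (hg : ContDiffAt ℝ n g z)
    (hk : ContDiffAt ℝ n k z) (hne : herm (f z) (k z) ≠ 0) :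
    ContDiffAt ℝ n (fun z => affineCoord (f z) (g z) (k z)) z := by
  have hinv : ContDiffAt ℝ n (fun z => (herm (f z) (k z))⁻¹) z := by
    simp only [← Ring.inverse_eq_inv']
    exact (contDiffAt_ringInverse ℝ (Units.mk0 _ hne)).comp z (contDiffAt_herm hf hk)
  unfold affineCoord; fun_prop

end Line

/-- The sequence of right factors which carries `σ` to `u` when `u` is a translate of `σ` under the
action of `(S³)^m`. -/
def gaugeTo (σ u : ℕ → ℍ[ℝ] × ℍ[ℝ]) : ℕ → ℍ[ℝ]
  | 0 => herm (σ 0) (u 0)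
  | 1 => herm (σ 1) (u 1)
  | n + 2 => herm (σ (n + 2)) (gaugeTo σ u (n + 1) • u (n + 2))

section Gauge

variable {m n : ℕ} {σ u : ℕ → ℍ[ℝ] × ℍ[ℝ]} {r : ℕ → ℍ[ℝ]}

lemma gaugeTo_eq (hσ : ∀ k ≤ n, herm (σ k) (σ k) = 1) (hr : ∀ k < n, ‖r k‖ = 1)
    (hu : ∀ k ≤ n, u k = (leftFactor 1 r k • σ k) <• r k) : gaugeTo σ u n = r n := by
  induction n using gaugeTo.induct with
  | case1 =>
    rw [gaugeTo, hu 0 le_rfl, herm_op_smul_right, leftFactor, one_smul, hσ 0 le_rfl, one_mul]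
  | case2 =>
    rw [gaugeTo, hu 1 le_rfl, herm_op_smul_right, leftFactor, one_smul, hσ 1 le_rfl, one_mul]
  | case3 n ih =>
    rw [gaugeTo, ih (fun k hk => hσ k (by omega)) (fun k hk => hr k (by omega))
      (fun k hk => hu k (by omega)), hu _ le_rfl, smul_comm, herm_op_smul_right, leftFactor,
      smul_smul, mul_star_self_eq_one_iff.2 (hr (n + 1) (by omega)), one_smul, hσ _ le_rfl, one_mul]

lemma IsAdmissible.ne_zero (hu : IsAdmissible m u) (hn : n < m) : u n ≠ 0 := by
  intro h
  simpa [h] using hu.herm_self n hn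

lemma IsAdmissible.gaugeTo_spec (hσ : IsAdmissible m σ) (hu : IsAdmissible m u)
    (hbase : σ 0 <• herm (σ 0) (u 0) = u 0) (hn : n < m) :
    ‖gaugeTo σ u n‖ = 1 ∧ (leftFactor 1 (gaugeTo σ u) n • σ n) <• gaugeTo σ u n = u n := by
  induction n using gaugeTo.induct with
  | case1 =>
    rw [gaugeTo, leftFactor, one_smul]
    exact ⟨norm_herm_eq_one (hσ.herm_self 0 hn) (hu.herm_self 0 hn) hbase, hbase⟩
  | case2 =>
    have hnorm := norm_herm_eq_one (hσ.herm_self 0 (by omega)) (hu.herm_self 0 (by omega)) hbase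
    have hperp : herm (σ 0) (u 1) = 0 := by
      have hlink : herm (u 0) (u 1) = 0 := hu.herm_link 0 hn
      rw [← hbase, herm_op_smul_left] at hlink
      exact (mul_eq_zero.1 hlink).resolve_left fun h => by
        rw [← norm_star, h, norm_zero] at hnorm
        exact zero_ne_one hnorm
    have heq := (hσ.orthonormalPair hn).op_smul_herm hperp
    rw [gaugeTo, leftFactor, one_smul]
    exact ⟨norm_herm_eq_one (hσ.herm_self 1 hn) (hu.herm_self 1 hn) heq, heq⟩
  | case3 n ih =>
    obtain ⟨hnorm, hprev⟩ := ih (by omega)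
    have hleft : leftFactor 1 (gaugeTo σ u) (n + 1) ≠ 0 := fun h =>
      hu.ne_zero (show n + 1 < m by omega) (by rw [← hprev, h, zero_smul, smul_zero])
    have hperp : herm (star (σ (n + 1))) (gaugeTo σ u (n + 1) • u (n + 2)) = 0 := by
      have hlink := hu.herm_star hn
      rw [← hprev, star_op_smul_column, star_smul_column, herm_smul_left, star_star,
        herm_op_smul_left, star_star] at hlink
      exact (mul_eq_zero.1 hlink).resolve_left hleft
    have hpair : OrthonormalPair (star (σ (n + 1))) (σ (n + 2)) :=
      ⟨(herm_star_self _).trans (hσ.herm_self _ (by omega)), hσ.herm_self _ hn, hσ.herm_star hn⟩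
    have heq := hpair.op_smul_herm hperp
    rw [gaugeTo]
    refine ⟨norm_herm_eq_one hpair.herm_right ?_ heq, ?_⟩
    · rw [herm_smul_smul hnorm, hu.herm_self _ hn]
    · rw [leftFactor, ← smul_comm, heq, star_smul_smul hnorm]

variable {E : Type*} [NormedAddCommGroup E] [NormedSpace ℝ E] {k : WithTop ℕ∞} {x : E}
  {f g : E → ℕ → ℍ[ℝ] × ℍ[ℝ]}

lemma contDiffAt_gaugeTo (hf : ∀ j ≤ n, ContDiffAt ℝ k (fun x => f x j) x)
    (hg : ∀ j ≤ n, ContDiffAt ℝ k (fun x => g x j) x) :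
    ContDiffAt ℝ k (fun x => gaugeTo (f x) (g x) n) x := by
  have hfn := hf n le_rfl
  have hgn := hg n le_rfl
  induction n using gaugeTo.induct with
  | case1 => simp only [gaugeTo]; fun_prop
  | case2 => simp only [gaugeTo]; fun_prop
  | case3 n ih =>
    have hprev := ih (fun j hj => hf j (by omega)) (fun j hj => hg j (by omega))
      (hf _ (by omega)) (hg _ (by omega))
    simp only [gaugeTo]; fun_prop

end Gauge

/-! ### Local parametrizations with a smooth inverse -/

section LocalInverse

variable {E : Type*} [NormedAddCommGroup E] [NormedSpace ℝ E] {d : ℕ} {S : Set E}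
  {φ : (Fin d → ℝ) → E} {ψ : E → (Fin d → ℝ)}

lemma isLocalParam_of_inverse {U : Set (Fin d → ℝ)} {V : Set E} (hU : IsOpen U) (hV : IsOpen V)
    (hφ : ContDiffOn ℝ ∞ φ U) (hψ : ContDiffOn ℝ ∞ ψ V) (hφS : Set.MapsTo φ U S)
    (hleft : Set.LeftInvOn ψ φ U) (hright : Set.LeftInvOn φ ψ (S ∩ V)) :
    IsLocalParam S (U ∩ φ ⁻¹' V) φ := by
  have hUV := hφ.continuousOn.isOpen_inter_preimage hU hV
  have hVU := hψ.continuousOn.isOpen_inter_preimage hV hU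
  refine ⟨hUV, hφ.mono Set.inter_subset_left, fun x hx => ?_, ⟨V ∩ ψ ⁻¹' U, hVU, ?_⟩, ψ, ?_,
    hleft.mono Set.inter_subset_left⟩
  · have hφx := (hφ.contDiffAt (hU.mem_nhds hx.1)).differentiableAt (by simp)
    have hψx := (hψ.contDiffAt (hV.mem_nhds hx.2)).differentiableAt (by simp)
    have hid : fderiv ℝ (ψ ∘ φ) x = .id ℝ _ :=
      ((hasFDerivAt_id x).congr_of_eventuallyEq
        (Filter.eventually_of_mem (hU.mem_nhds hx.1) hleft)).fderiv
    rw [fderiv_comp x hψx hφx] at hid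
    exact Function.LeftInverse.injective fun v => DFunLike.congr_fun hid v
  · refine Set.Subset.antisymm ?_ fun u ⟨hu, huV, hψu⟩ => ?_
    · rintro _ ⟨x, ⟨hx, hxV⟩, rfl⟩
      exact ⟨hφS hx, hxV, by rwa [Set.mem_preimage, hleft hx]⟩
    · have heq := hright ⟨hu, huV⟩
      exact ⟨ψ u, ⟨hψu, by rwa [Set.mem_preimage, heq]⟩, heq⟩
  · exact hψ.continuousOn.mono (Set.image_subset_iff.2 Set.inter_subset_right)

lemma exists_fderiv_eq_of_mem_tangentVectors {p v : E} (hφ : DifferentiableAt ℝ φ (ψ p))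
    (hψ : DifferentiableAt ℝ ψ p) (hright : ∀ᶠ u in 𝓝 p, u ∈ S → φ (ψ u) = u)
    (hv : v ∈ tangentVectors S p) : ∃ ξ, fderiv ℝ φ (ψ p) ξ = v := by
  obtain ⟨ε, c, hε, -, hcS, rfl, hcv⟩ := hv
  have hcomp := hφ.hasFDerivAt.comp_hasDerivAt 0 (hψ.hasFDerivAt.comp_hasDerivAt 0 hcv)
  refine ⟨_, (hcomp.congr_of_eventuallyEq ?_).unique hcv⟩
  filter_upwards [hcv.continuousAt.eventually hright, Ioo_mem_nhds (neg_lt_zero.2 hε) hε]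
    with s hs hmem using (hs (hcS s hmem)).symm

end LocalInverse

/-! ### The local parametrizations of `Sp(2,m)` -/

section LocalParam

variable {m : ℕ} {t : ℝ} {p u : Fin m → ℍ[ℝ] × ℍ[ℝ]}

/-- The quaternions acting from the right in `localParam`. -/
def rightFactor (m : ℕ) (t : ℝ) (x : Fin (3 * m + 4) → ℝ) : ℕ → ℍ[ℝ] :=
  zeroExtend fun s => centralProj (fibreParam m t s x)

/-- The local parametrization of `Sp(2,m)` around `p`: the local section of `Sp(2,m) → S⁴` through
`p`, translated along the fibres by the action of `(S³)^m`. -/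
def localParam (m : ℕ) (t : ℝ) (p : Fin m → ℍ[ℝ] × ℍ[ℝ]) (x : Fin (3 * m + 4) → ℝ) :
    Fin m → ℍ[ℝ] × ℍ[ℝ] :=
  wilhelmAction m 1 (fun s => star (centralProj (fibreParam m t s x)))
    (sectionPoint m (p, baseParam m x))

lemma rightFactor_of_lt (x : Fin (3 * m + 4) → ℝ) {n : ℕ} (hn : n < m) :
    rightFactor m t x n = centralProj (fibreParam m t ⟨n, hn⟩ x) := zeroExtend_of_lt _ hn

lemma norm_rightFactor (x : Fin (3 * m + 4) → ℝ) {n : ℕ} (hn : n < m) :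
    ‖rightFactor m t x n‖ = 1 := by
  rw [rightFactor_of_lt x hn, norm_centralProj (re_fibreParam _ _)]

lemma contDiffAt_rightFactor (x : Fin (3 * m + 4) → ℝ) (n : ℕ) :
    ContDiffAt ℝ ω (fun x => rightFactor m t x n) x := by
  unfold rightFactor
  exact contDiffAt_zeroExtend (by fun_prop)

@[fun_prop]
lemma contDiffAt_leftFactor {E : Type*} [NormedAddCommGroup E] [NormedSpace ℝ E]
    {k : WithTop ℕ∞} {r : E → ℕ → ℍ[ℝ]} {x : E} {a : ℍ[ℝ]} {n : ℕ}
    (hr : ∀ j, ContDiffAt ℝ k (fun x => r x j) x) :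
    ContDiffAt ℝ k (fun x => leftFactor a (r x) n) x := by
  match n with
  | 0 => exact contDiffAt_const
  | 1 => exact contDiffAt_const
  | n + 2 => exact contDiffAt_star (hr _)

lemma zeroExtend_localParam (x : Fin (3 * m + 4) → ℝ) {n : ℕ} (hn : n < m) :
    zeroExtend (localParam m t p x) n = (leftFactor 1 (rightFactor m t x) n •
      hopfSection (zeroExtend p) (baseParam m x) n) <• rightFactor m t x n := by
  have hstar (k : ℕ) : star (zeroExtend (fun s => star (centralProj (fibreParam m t s x))) k) =
      rightFactor m t x k := by
    unfold rightFactor zeroExtend; split_ifs <;> simp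
  rw [localParam, zeroExtend_wilhelmAction _ _ _ hn, zeroExtend_sectionPoint hn]
  simp only [hstar]

lemma contDiffAt_localParam {x : Fin (3 * m + 4) → ℝ}
    (hx : InSectionDomain m (zeroExtend p) (baseParam m x)) :
    ContDiffAt ℝ ω (localParam m t p) x := by
  refine contDiffAt_pi.2 fun i => ?_
  have hcoord (x) := zeroExtend_localParam (t := t) (p := p) x i.isLt
  simp only [zeroExtend_val] at hcoord
  simp only [hcoord]
  have hsection : ContDiffAt ℝ ω (fun x => hopfSection (zeroExtend p) (baseParam m x) i) x :=
    contDiffAt_hopfSection (m := m) (f := fun _ => zeroExtend p) (fun _ => contDiffAt_const)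
      (by fun_prop) hx i.isLt
  have hright := contDiffAt_rightFactor (m := m) (t := t) x
  have hrighti := hright i
  fun_prop

lemma localParam_mem (hm : 1 < m) (hp : IsAdmissible m (zeroExtend p)) {x : Fin (3 * m + 4) → ℝ}
    (hx : InSectionDomain m (zeroExtend p) (baseParam m x)) : localParam m t p x ∈ Sp2m m := by
  refine wilhelmAction_mem (mem_S3_iff.2 norm_one) (fun s => mem_S3_iff.2 ?_) ?_
  · rw [norm_star, norm_centralProj (re_fibreParam _ _)]
  · have hadm := hp.hopfSection hm hx
    refine mem_Sp2m_iff_isAdmissible.2 ⟨fun k hk => ?_, fun k hk => ?_⟩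
    · rw [zeroExtend_sectionPoint hk, hadm.herm_self k hk]
    · rw [zeroExtend_sectionPoint hk, zeroExtend_sectionPoint (by omega), hadm.herm_link k hk]

lemma localParam_zero (hp : IsAdmissible m (zeroExtend p)) : localParam m t p 0 = p := by
  funext i
  have hright : ∀ n < m, rightFactor m t 0 n = 1 := fun n hn => by
    rw [rightFactor_of_lt 0 hn, map_zero, centralProj_zero]
  have hleft : ∀ n < m, leftFactor 1 (rightFactor m t 0) n = 1
    | 0, _ => rfl
    | 1, _ => rfl
    | n + 2, hn => by rw [leftFactor, hright (n + 1) (by omega), star_one]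
  rw [← zeroExtend_val (localParam m t p 0), zeroExtend_localParam 0 i.isLt, map_zero,
    hopfSection_zero hp i.isLt, hright i i.isLt, hleft i i.isLt, one_smul, MulOpposite.op_one,
    one_smul, zeroExtend_val]

/-- The base coordinate of a point `u` near `p`. -/
def baseCoord (p u : ℕ → ℍ[ℝ] × ℍ[ℝ]) : ℍ[ℝ] := affineCoord (p 0) (p 1) (u 0)

/-- The fibre coordinates of a point `u` near `p`, as unit quaternions. -/
def fibreCoord (p u : ℕ → ℍ[ℝ] × ℍ[ℝ]) : ℕ → ℍ[ℝ] := gaugeTo (hopfSection p (baseCoord p u)) u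

/-- The inverse of `localParam` near `p`. -/
def localParamInv (m : ℕ) (t : ℝ) (p u : Fin m → ℍ[ℝ] × ℍ[ℝ]) (i : Fin (3 * m + 4)) : ℝ :=
  match coordEquiv m i with
  | .inl k => inner ℝ (quaternionBasis k) (baseCoord (zeroExtend p) (zeroExtend u))
  | .inr (s, b) => t * inner ℝ (quaternionBasis b.succ)
      ((fibreCoord (zeroExtend p) (zeroExtend u) s).re⁻¹ •
        fibreCoord (zeroExtend p) (zeroExtend u) s)

/-- The conditions on `u` under which all divisions in `localParamInv` are genuine. -/
structure InParamImage (m : ℕ) (p u : ℕ → ℍ[ℝ] × ℍ[ℝ]) : Prop where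
  herm_ne_zero : herm (p 0) (u 0) ≠ 0
  inSectionDomain : InSectionDomain m p (baseCoord p u)
  re_pos : ∀ n < m, 0 < (fibreCoord p u n).re

lemma baseCoord_localParam (hm : 1 < m) (hp : IsAdmissible m (zeroExtend p))
    (x : Fin (3 * m + 4) → ℝ) :
    baseCoord (zeroExtend p) (zeroExtend (localParam m t p x)) = baseParam m x := by
  have hright : rightFactor m t x 0 ≠ 0 := fun h => by
    simpa [h] using norm_rightFactor (t := t) x (show 0 < m by omega)
  rw [baseCoord, zeroExtend_localParam x (by omega), leftFactor, one_smul, hopfSection,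
    affineCoord_unitCombo_op_smul (hp.orthonormalPair hm) _ hright]

lemma fibreCoord_localParam (hm : 1 < m) (hp : IsAdmissible m (zeroExtend p))
    {x : Fin (3 * m + 4) → ℝ} (hx : InSectionDomain m (zeroExtend p) (baseParam m x)) {n : ℕ}
    (hn : n < m) :
    fibreCoord (zeroExtend p) (zeroExtend (localParam m t p x)) n = rightFactor m t x n := by
  rw [fibreCoord, baseCoord_localParam hm hp]
  exact gaugeTo_eq (fun k hk => (hp.hopfSection hm hx).herm_self k (by omega))
    (fun k hk => norm_rightFactor x (by omega)) fun k hk => zeroExtend_localParam x (by omega)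

lemma localParamInv_localParam (hm : 1 < m) (ht : t ≠ 0) (hp : IsAdmissible m (zeroExtend p))
    {x : Fin (3 * m + 4) → ℝ} (hx : InSectionDomain m (zeroExtend p) (baseParam m x)) :
    localParamInv m t p (localParam m t p x) = x := by
  funext i
  unfold localParamInv
  split
  · next k hk =>
    rw [baseCoord_localParam hm hp, inner_baseParam, ← hk, Equiv.symm_apply_apply]
  · next s b hk =>
    have hre : (centralProj (fibreParam m t s x)).re = projScale (fibreParam m t s x) := by
      simp [centralProj, re_fibreParam]
    rw [fibreCoord_localParam hm hp hx s.isLt, rightFactor, zeroExtend_val, hre, centralProj,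
      smul_smul, inv_mul_cancel₀ (projScale_pos _).ne', one_smul, inner_add_right,
      ← Quaternion.coe_one, inner_quaternionBasis_succ_coe, zero_add, inner_fibreParam, ← hk,
      Equiv.symm_apply_apply, mul_inv_cancel_left₀ ht]

lemma fibreCoord_spec (hm : 1 < m) {p u : ℕ → ℍ[ℝ] × ℍ[ℝ]} (hp : IsAdmissible m p)
    (hu : IsAdmissible m u) (hne : herm (p 0) (u 0) ≠ 0)
    (hdom : InSectionDomain m p (baseCoord p u)) {n : ℕ} (hn : n < m) :
    ‖fibreCoord p u n‖ = 1 ∧ (leftFactor 1 (fibreCoord p u) n •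
      hopfSection p (baseCoord p u) n) <• fibreCoord p u n = u n :=
  (hp.hopfSection hm hdom).gaugeTo_spec hu
    (unitCombo_affineCoord_op_smul (hp.orthonormalPair hm) hne) hn

lemma baseParam_localParamInv :
    baseParam m (localParamInv m t p u) = baseCoord (zeroExtend p) (zeroExtend u) := by
  rw [baseParam_apply]
  simpa only [localParamInv, Equiv.apply_symm_apply] using quaternionBasis.sum_repr' _

lemma rightFactor_localParamInv (ht : t ≠ 0) {n : ℕ} (hn : n < m)
    (hnorm : ‖fibreCoord (zeroExtend p) (zeroExtend u) n‖ = 1)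
    (hpos : 0 < (fibreCoord (zeroExtend p) (zeroExtend u) n).re) :
    rightFactor m t (localParamInv m t p u) n = fibreCoord (zeroExtend p) (zeroExtend u) n := by
  rw [rightFactor_of_lt _ hn, ← centralProj_re_inv_smul_im hnorm hpos, ← Quaternion.im_smul,
    ← sum_inner_quaternionBasis_succ, fibreParam_apply]
  simp only [localParamInv, Equiv.apply_symm_apply, inv_mul_cancel_left₀ ht]

lemma localParam_localParamInv (hm : 1 < m) (ht : t ≠ 0) (hp : IsAdmissible m (zeroExtend p))
    (hu : IsAdmissible m (zeroExtend u)) (hdom : InParamImage m (zeroExtend p) (zeroExtend u)) :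
    localParam m t p (localParamInv m t p u) = u := by
  have hspec {n : ℕ} (hn : n < m) :=
    fibreCoord_spec hm hp hu hdom.herm_ne_zero hdom.inSectionDomain hn
  have hright : ∀ n < m, rightFactor m t (localParamInv m t p u) n =
      fibreCoord (zeroExtend p) (zeroExtend u) n := fun n hn =>
    rightFactor_localParamInv ht hn (hspec hn).1 (hdom.re_pos n hn)
  have hleft : ∀ n < m, leftFactor 1 (rightFactor m t (localParamInv m t p u)) n =
      leftFactor 1 (fibreCoord (zeroExtend p) (zeroExtend u)) n
    | 0, _ => rfl
    | 1, _ => rfl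
    | n + 2, hn => by rw [leftFactor, leftFactor, hright (n + 1) (by omega)]
  funext i
  rw [← zeroExtend_val (localParam m t p _), zeroExtend_localParam _ i.isLt,
    baseParam_localParamInv, hright i i.isLt, hleft i i.isLt, (hspec i.isLt).2, zeroExtend_val]

lemma contDiffAt_baseCoord (hne : herm (zeroExtend p 0) (zeroExtend u 0) ≠ 0) :
    ContDiffAt ℝ ω (fun u : Fin m → ℍ[ℝ] × ℍ[ℝ] => baseCoord (zeroExtend p) (zeroExtend u)) u :=
  contDiffAt_affineCoord contDiffAt_const contDiffAt_const (by fun_prop) hne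

lemma contDiffAt_fibreCoord (hne : herm (zeroExtend p 0) (zeroExtend u 0) ≠ 0)
    (hdom : InSectionDomain m (zeroExtend p) (baseCoord (zeroExtend p) (zeroExtend u))) {n : ℕ}
    (hn : n < m) :
    ContDiffAt ℝ ω (fun u : Fin m → ℍ[ℝ] × ℍ[ℝ] => fibreCoord (zeroExtend p) (zeroExtend u) n) u :=
  contDiffAt_gaugeTo (fun _ hj => contDiffAt_hopfSection (m := m)
    (f := fun _ : Fin m → ℍ[ℝ] × ℍ[ℝ] => zeroExtend p) (fun _ => contDiffAt_const)
    (contDiffAt_baseCoord hne) hdom (by omega)) fun _ _ => by fun_prop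

lemma contDiffAt_localParamInv (hdom : InParamImage m (zeroExtend p) (zeroExtend u)) :
    ContDiffAt ℝ ω (localParamInv m t p) u := by
  refine contDiffAt_pi.2 fun i => ?_
  unfold localParamInv
  rcases coordEquiv m i with k | ⟨s, b⟩
  · exact contDiffAt_const.inner ℝ (contDiffAt_baseCoord hdom.herm_ne_zero)
  · have hfibre := contDiffAt_fibreCoord hdom.herm_ne_zero hdom.inSectionDomain s.isLt
    have hinv := (contDiffAt_re hfibre).inv (hdom.re_pos s s.isLt).ne'
    exact contDiffAt_const.mul (contDiffAt_const.inner ℝ (hinv.smul hfibre))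

lemma inParamImage_self (hm : 1 < m) (hp : IsAdmissible m (zeroExtend p)) :
    InParamImage m (zeroExtend p) (zeroExtend p) := by
  have hbase : baseCoord (zeroExtend p) (zeroExtend p) = 0 := by
    simpa [localParam_zero hp] using baseCoord_localParam (t := 1) hm hp 0
  refine ⟨?_, by rw [hbase]; exact inSectionDomain_zero hp, fun n hn => ?_⟩
  · rw [hp.herm_self 0 (by omega)]
    exact one_ne_zero
  · have hfibre := fibreCoord_localParam (t := 1) (x := 0) hm hp
      (by rw [map_zero]; exact inSectionDomain_zero hp) hn
    rw [localParam_zero hp, rightFactor_of_lt _ hn, map_zero, centralProj_zero] at hfibre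
    simp [hfibre]

lemma eventually_inParamImage (hm : 1 < m) (hp : IsAdmissible m (zeroExtend p)) :
    ∀ᶠ u in 𝓝 p, InParamImage m (zeroExtend p) (zeroExtend u) := by
  obtain ⟨hne, hdom, hpos⟩ := inParamImage_self hm hp
  have hherm : ContDiffAt ℝ ω
      (fun u : Fin m → ℍ[ℝ] × ℍ[ℝ] => herm (zeroExtend p 0) (zeroExtend u 0)) p := by fun_prop
  have hfibre : ∀ n ∈ Finset.range m, ∀ᶠ u : Fin m → ℍ[ℝ] × ℍ[ℝ] in 𝓝 p,
      0 < (fibreCoord (zeroExtend p) (zeroExtend u) n).re := fun n hn =>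
    have hn := Finset.mem_range.1 hn
    (contDiffAt_re (contDiffAt_fibreCoord hne hdom hn)).continuousAt.eventually_const_lt (hpos n hn)
  filter_upwards [hherm.continuousAt.eventually_ne hne,
    eventually_inSectionDomain (f := fun _ : Fin m → ℍ[ℝ] × ℍ[ℝ] => zeroExtend p)
      (fun _ => contDiffAt_const) (contDiffAt_baseCoord hne) hdom,
    (Finset.eventually_all _).2 hfibre] with u h₁ h₂ h₃
  exact ⟨h₁, h₂, fun n hn => h₃ n (Finset.mem_range.2 hn)⟩

theorem exists_isLocalParam (hm : 1 < m) (ht : t ≠ 0) (hp : p ∈ Sp2m m) :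
    ∃ U : Set (Fin (3 * m + 4) → ℝ), IsLocalParam (Sp2m m) U (localParam m t p) ∧ 0 ∈ U := by
  rw [mem_Sp2m_iff_isAdmissible] at hp
  have hdom : ∀ᶠ x in 𝓝 (0 : Fin (3 * m + 4) → ℝ),
      InSectionDomain m (zeroExtend p) (baseParam m x) :=
    eventually_inSectionDomain (k := ω) (f := fun _ => zeroExtend p) (fun _ => contDiffAt_const)
      (by fun_prop) (by rw [map_zero]; exact inSectionDomain_zero hp)
  obtain ⟨U, hU, hUopen, hU₀⟩ := mem_nhds_iff.1 hdom
  obtain ⟨V, hV, hVopen, hVp⟩ := mem_nhds_iff.1 (eventually_inParamImage hm hp)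
  refine ⟨_, isLocalParam_of_inverse (ψ := localParamInv m t p) hUopen hVopen
    (fun x hx => ((contDiffAt_localParam (hU hx)).of_le le_top).contDiffWithinAt)
    (fun u hu => ((contDiffAt_localParamInv (hV hu)).of_le le_top).contDiffWithinAt)
    (fun x hx => localParam_mem hm hp (hU hx))
    (fun x hx => localParamInv_localParam hm ht hp (hU hx))
    fun u hu => localParam_localParamInv hm ht hp (mem_Sp2m_iff_isAdmissible.1 hu.1) (hV hu.2),
    hU₀, ?_⟩
  rwa [Set.mem_preimage, localParam_zero hp]

lemma exists_fderiv_localParam_eq (hm : 1 < m) (ht : t ≠ 0) (hp : p ∈ Sp2m m)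
    {v : Fin m → ℍ[ℝ] × ℍ[ℝ]} (hv : v ∈ tangentVectors (Sp2m m) p) :
    ∃ ξ, fderiv ℝ (localParam m t p) 0 ξ = v := by
  rw [mem_Sp2m_iff_isAdmissible] at hp
  have hdom : InSectionDomain m (zeroExtend p) (baseParam m 0) := by
    rw [map_zero]; exact inSectionDomain_zero hp
  have hinv : localParamInv m t p p = 0 := by
    simpa only [localParam_zero hp] using localParamInv_localParam hm ht hp hdom
  have himage := eventually_inParamImage hm hp
  rw [← hinv] at hdom ⊢
  refine exists_fderiv_eq_of_mem_tangentVectors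
    ((contDiffAt_localParam hdom).differentiableAt (by simp))
    ((contDiffAt_localParamInv himage.self_of_nhds).differentiableAt (by simp)) ?_ hv
  filter_upwards [himage] with u hdomu hu
    using localParam_localParamInv hm ht hp (mem_Sp2m_iff_isAdmissible.1 hu) hdomu

end LocalParam

/-! ### The metric in the local parametrization -/

lemma inner_eq_sum_inner_quaternionBasis_succ {a : ℍ[ℝ]} (ha : a.re = 0) (b : ℍ[ℝ]) :
    inner ℝ a b = ∑ k : Fin 3, inner ℝ (quaternionBasis k.succ) a *
      inner ℝ (quaternionBasis k.succ) b := by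
  conv_lhs => rw [← im_eq_self_of_re_eq_zero ha, ← sum_inner_quaternionBasis_succ]
  simp only [sum_inner, real_inner_smul_left]

/-- The right-invariant Maurer–Cartan form `dr r⁻¹` of `S³` in the coordinate `r = centralProj z`,
evaluated on `Z`. -/
def maurerCartan (z Z : ℍ[ℝ]) : ℍ[ℝ] := projScale z ^ 2 • (Z - (Z * z).im)

lemma exists_hasDerivAt_centralProj {z Z : ℍ[ℝ]} (hz : z.re = 0) (hZ : Z.re = 0) :
    ∃ r', HasDerivAt (fun s : ℝ => centralProj (z + s • Z)) r' 0 ∧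
      centralProj z * star r' + r' * star (centralProj z) = 0 ∧
      r' * star (centralProj z) = maurerCartan z Z := by
  have hline : HasDerivAt (fun s : ℝ => z + s • Z) Z 0 := (hasFDerivAt_id z).hasLineDerivAt Z
  have hscale : DifferentiableAt ℝ (fun s : ℝ => projScale (z + s • Z)) 0 :=
    ContDiffAt.differentiableAt (n := 1) (by fun_prop) one_ne_zero
  set ρ' := deriv (fun s : ℝ => projScale (z + s • Z)) 0
  have hderiv : HasDerivAt (fun s : ℝ => centralProj (z + s • Z))
      (projScale z • Z + ρ' • (1 + z)) 0 :=
    (hscale.hasDerivAt.fun_smul (hline.const_add 1)).congr_deriv (by simp [ρ'])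
  have hskew : centralProj z * star (projScale z • Z + ρ' • (1 + z)) +
      (projScale z • Z + ρ' • (1 + z)) * star (centralProj z) = 0 := by
    have hunit : HasDerivAt (fun s : ℝ => centralProj (z + s • Z) * star (centralProj (z + s • Z)))
        0 0 := (hasDerivAt_const (0 : ℝ) (1 : ℍ[ℝ])).congr_of_eventuallyEq <| .of_forall fun s =>
      mul_star_self_eq_one_iff.2 (norm_centralProj (by simp [hz, hZ]))
    simpa [add_comm] using (hderiv.fun_mul hderiv.star).unique hunit
  refine ⟨_, hderiv, hskew, ?_⟩
  have him : ((projScale z • Z + ρ' • (1 + z)) * star (centralProj z)).re = 0 := by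
    have hre := congrArg (fun q : ℍ[ℝ] => q.re) hskew
    rw [← star_star (centralProj z * _), star_mul, star_star] at hre
    simp only [Quaternion.re_add, Quaternion.re_star, Quaternion.re_zero] at hre
    linarith
  have hstar : star z = -z := Quaternion.star_eq_neg.2 hz
  have hexpand : (projScale z • Z + ρ' • (1 + z)) * star (centralProj z) =
      projScale z ^ 2 • (Z - Z * z) + (ρ' * projScale z) • ((1 + z) * star (1 + z)) := by
    rw [centralProj, Quaternion.star_smul, add_mul, smul_mul_smul_comm, smul_mul_smul_comm, ← sq,
      star_add, star_one, hstar, mul_add, mul_one, mul_neg, ← sub_eq_add_neg]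
  rw [← im_eq_self_of_re_eq_zero him, hexpand, mul_star_self_eq_norm_sq, ← Quaternion.coe_smul,
    Quaternion.im_add, Quaternion.im_coe, add_zero, Quaternion.im_smul, Quaternion.im_sub,
    im_eq_self_of_re_eq_zero hZ, maurerCartan]

section LocalForm

variable {m : ℕ} {t : ℝ} {p : Fin m → ℍ[ℝ] × ℍ[ℝ]} {x : Fin (3 * m + 4) → ℝ}

/-- The `n`-th component of the pull-back of the connection form by `localParam`, evaluated on `v`
and conjugated by `rightFactor m t x n`. -/
def localForm (m : ℕ) (t : ℝ) (p : Fin m → ℍ[ℝ] × ℍ[ℝ]) (x v : Fin (3 * m + 4) → ℝ) (n : Fin m) :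
    ℍ[ℝ] :=
  sectionForm m (p, baseParam m x) (baseParam m v) n +
    maurerCartan (fibreParam m t n x) (fibreParam m t n v)

lemma re_localForm (hm : 1 < m) (hp : IsAdmissible m (zeroExtend p))
    (hx : InSectionDomain m (zeroExtend p) (baseParam m x)) (v : Fin (3 * m + 4) → ℝ) (n : Fin m) :
    (localForm m t p x v n).re = 0 := by
  rw [localForm, Quaternion.re_add, re_sectionForm hm hp hx _ n.isLt, maurerCartan,
    Quaternion.re_smul, Quaternion.re_sub, re_fibreParam, Quaternion.re_im]
  simp

lemma hasDerivAt_leftFactor {r : ℝ → ℕ → ℍ[ℝ]} {r' : ℕ → ℍ[ℝ]} {s : ℝ} {n : ℕ} (a : ℍ[ℝ])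
    (hr : ∀ k < n, HasDerivAt (fun s => r s k) (r' k) s) :
    HasDerivAt (fun s => leftFactor a (r s) n) (leftFactor 0 r' n) s := by
  match n with
  | 0 => exact hasDerivAt_const _ _
  | 1 => exact hasDerivAt_const _ _
  | n + 2 => exact (hr (n + 1) (by omega)).star

lemma exists_hasDerivAt_rightFactor (m : ℕ) (t : ℝ) (x v : Fin (3 * m + 4) → ℝ) :
    ∃ r' : ℕ → ℍ[ℝ], ∀ (n : ℕ) (hn : n < m),
      HasDerivAt (fun s : ℝ => rightFactor m t (x + s • v) n) (r' n) 0 ∧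
      rightFactor m t x n * star (r' n) + r' n * star (rightFactor m t x n) = 0 ∧
      r' n * star (rightFactor m t x n) =
        maurerCartan (fibreParam m t ⟨n, hn⟩ x) (fibreParam m t ⟨n, hn⟩ v) := by
  choose r' hr' using fun s : Fin m =>
    exists_hasDerivAt_centralProj (re_fibreParam (t := t) x s) (re_fibreParam v s)
  refine ⟨zeroExtend r', fun n hn => ?_⟩
  simp only [rightFactor_of_lt _ hn, zeroExtend_of_lt _ hn, map_add, map_smul]
  exact hr' ⟨n, hn⟩

lemma hasDerivAt_localParam (hx : InSectionDomain m (zeroExtend p) (baseParam m x))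
    (v : Fin (3 * m + 4) → ℝ) {n : ℕ} (hn : n < m) :
    HasDerivAt (fun s : ℝ => zeroExtend (localParam m t p (x + s • v)) n)
      (zeroExtend (fderiv ℝ (localParam m t p) x v) n) 0 := by
  have hline := ((contDiffAt_localParam (t := t) hx).differentiableAt
    (by simp)).hasFDerivAt.hasLineDerivAt v
  simp only [zeroExtend_of_lt _ hn]
  exact hasDerivAt_pi.1 hline ⟨n, hn⟩

lemma fderiv_localParam_eq (hx : InSectionDomain m (zeroExtend p) (baseParam m x))
    (v : Fin (3 * m + 4) → ℝ) {r' : ℕ → ℍ[ℝ]}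
    (hr' : ∀ k < m, HasDerivAt (fun s : ℝ => rightFactor m t (x + s • v) k) (r' k) 0) {n : ℕ}
    (hn : n < m) :
    zeroExtend (fderiv ℝ (localParam m t p) x v) n =
      (leftFactor 0 r' n • hopfSection (zeroExtend p) (baseParam m x) n) <• rightFactor m t x n +
      (leftFactor 1 (rightFactor m t x) n •
        zeroExtend (sectionVelocity m (p, baseParam m x) (baseParam m v)) n) <•
          rightFactor m t x n +
      (leftFactor 1 (rightFactor m t x) n • hopfSection (zeroExtend p) (baseParam m x) n) <•
        r' n := by
  have hsection : HasDerivAt (fun s : ℝ => hopfSection (zeroExtend p) (baseParam m (x + s • v)) n)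
      (zeroExtend (sectionVelocity m (p, baseParam m x) (baseParam m v)) n) 0 := by
    simpa using hasDerivAt_hopfSection hx (baseParam m v) hn
  have hleft := hasDerivAt_leftFactor 1 fun k (hk : k < n) => hr' k (hk.trans hn)
  have hparam := hasDerivAt_localParam (t := t) hx v hn
  simp only [zeroExtend_localParam _ hn] at hparam
  refine hparam.unique ((hasDerivAt_op_smul (hleft.fun_smul hsection) (hr' n hn)).congr_deriv ?_)
  simp only [zero_smul, add_zero, smul_add]
  abel

lemma connForm_fderiv_localParam (hm : 1 < m) (hp : IsAdmissible m (zeroExtend p))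
    (hx : InSectionDomain m (zeroExtend p) (baseParam m x)) (v : Fin (3 * m + 4) → ℝ) (n : Fin m) :
    connForm (zeroExtend (localParam m t p x)) (zeroExtend (fderiv ℝ (localParam m t p) x v)) n =
      star (rightFactor m t x n) * localForm m t p x v n * rightFactor m t x n := by
  obtain ⟨r', hr'⟩ := exists_hasDerivAt_rightFactor m t x v
  have hlt {k : ℕ} (hk : k ≤ n) : k < m := hk.trans_lt n.isLt
  have hgauge := connForm_gauge (u := hopfSection (zeroExtend p) (baseParam m x))
    (v := zeroExtend (sectionVelocity m (p, baseParam m x) (baseParam m v)))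
    (r := rightFactor m t x) (r' := r') norm_one
    (fun k hk => (hp.hopfSection hm hx).herm_self k (hlt hk))
    (fun k hk => norm_rightFactor x (hlt hk)) (fun k hk => (hr' k (hlt hk.le)).2.1)
  rw [(hr' n n.isLt).2.2] at hgauge
  rw [localForm, sectionForm, connForm_congr (u := zeroExtend (sectionPoint m _))
    (fun k hk => zeroExtend_sectionPoint (hlt hk)) fun _ _ => rfl, ← hgauge]
  exact connForm_congr (fun k hk => zeroExtend_localParam x (hlt hk))
    fun k hk => fderiv_localParam_eq hx v (fun k hk => (hr' k hk).1) (hlt hk)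

lemma orthComp_fderiv_localParam (hm : 1 < m) (hp : IsAdmissible m (zeroExtend p))
    (hx : InSectionDomain m (zeroExtend p) (baseParam m x)) (v : Fin (3 * m + 4) → ℝ) :
    orthComp (zeroExtend (localParam m t p x) 0)
        (zeroExtend (fderiv ℝ (localParam m t p) x v) 0) =
      ((1 : ℍ[ℝ]) • projScale (baseParam m x) ^ 2 •
        (hopfSection (zeroExtend p) (baseParam m x) 1 <• baseParam m v)) <•
          rightFactor m t x 0 := by
  have h0 : 0 < m := by omega
  obtain ⟨r', hr'⟩ := exists_hasDerivAt_rightFactor m t x v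
  rw [zeroExtend_localParam x h0, fderiv_localParam_eq hx v (fun k hk => (hr' k hk).1) h0,
    ← orthComp_sectionVelocity hm hp hx]
  simp only [leftFactor, zero_smul, smul_zero, zero_add]
  exact orthComp_gauge norm_one (norm_rightFactor x h0) ((hp.hopfSection hm hx).herm_self 0 h0)

lemma connMetricFun_localParam (hm : 1 < m) (hp : IsAdmissible m (zeroExtend p))
    (hx : InSectionDomain m (zeroExtend p) (baseParam m x)) (v w : Fin (3 * m + 4) → ℝ) :
    connMetricFun m t (localParam m t p x) (fderiv ℝ (localParam m t p) x v)
        (fderiv ℝ (localParam m t p) x w) =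
      (projScale (baseParam m x) ^ 2) ^ 2 * inner ℝ (baseParam m v) (baseParam m w) +
        t ^ 2 * ∑ a : Fin m × Fin 3,
          inner ℝ (quaternionBasis a.2.succ) (localForm m t p x v a.1) *
          inner ℝ (quaternionBasis a.2.succ) (localForm m t p x w a.1) := by
  have hunit := (hp.hopfSection hm hx).herm_self 1 hm
  unfold connMetricFun
  congr 1
  · rw [orthComp_fderiv_localParam hm hp hx, orthComp_fderiv_localParam hm hp hx,
      re_herm_gauge norm_one (norm_rightFactor x (by omega)), herm_real_smul_right,
      herm_real_smul_left, herm_op_smul_right, herm_op_smul_left, hunit, mul_one,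
      Quaternion.re_smul, Quaternion.re_smul, real_inner_comm, Quaternion.inner_def,
      Quaternion.re_mul, Quaternion.re_mul, smul_eq_mul, smul_eq_mul]
    simp
    ring
  · rw [Finset.sum_range, Fintype.sum_prod_type]
    simp only [connForm_fderiv_localParam hm hp hx, inner_conj_conj (norm_rightFactor x _),
      inner_eq_sum_inner_quaternionBasis_succ (re_localForm hm hp hx v _), Fin.is_lt]

end LocalForm

/-! ### Second-order jets of the metric coefficients -/

section Jets

variable {d : ℕ} {κ : Type*}

/-- The function `F` is twice continuously differentiable at `0`, and `c`, `D` and `H` are its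
value, first and second partial derivatives there. The coordinates are labelled by `κ` through
`e`. -/
structure HasJet (e : Fin d ≃ κ) (F : (Fin d → ℝ) → ℝ) (c : ℝ) (D : κ → ℝ) (H : κ → κ → ℝ) :
    Prop where
  contDiffAt : ContDiffAt ℝ 2 F 0
  apply_zero : F 0 = c
  pderiv_zero : ∀ k, pderiv (e.symm k) F 0 = D k
  pderiv_pderiv_zero : ∀ k l, pderiv (e.symm k) (pderiv (e.symm l) F) 0 = H k l

variable {e : Fin d ≃ κ} {F F' : (Fin d → ℝ) → ℝ} {c c' : ℝ} {D D' : κ → ℝ} {H H' : κ → κ → ℝ}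

lemma HasJet.of_contDiffAt (hF : ContDiffAt ℝ 2 F 0) : HasJet e F (F 0)
    (fun k => pderiv (e.symm k) F 0) (fun k l => pderiv (e.symm k) (pderiv (e.symm l) F) 0) :=
  ⟨hF, rfl, fun _ => rfl, fun _ _ => rfl⟩

lemma HasJet.cast (h : HasJet e F c D H) (hc : c = c') (hD : ∀ k, D k = D' k)
    (hH : ∀ k l, H k l = H' k l) : HasJet e F c' D' H' := by
  obtain rfl : D = D' := funext hD
  obtain rfl : H = H' := funext₂ hH
  exact hc ▸ h

lemma HasJet.congr (h : HasJet e F c D H) (hF : F' =ᶠ[𝓝 0] F) : HasJet e F' c D H where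
  contDiffAt := h.contDiffAt.congr_of_eventuallyEq hF
  apply_zero := hF.self_of_nhds.trans h.apply_zero
  pderiv_zero k := (pderiv_congr hF).trans (h.pderiv_zero k)
  pderiv_pderiv_zero k l :=
    (pderiv_congr (hF.eventually_nhds.mono fun _ => pderiv_congr)).trans
      (h.pderiv_pderiv_zero k l)

lemma HasJet.unique (h : HasJet e F c D H) (h' : HasJet e F c' D' H') :
    c = c' ∧ D = D' ∧ H = H' :=
  ⟨h.apply_zero.symm.trans h'.apply_zero,
    funext fun k => (h.pderiv_zero k).symm.trans (h'.pderiv_zero k),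
    funext₂ fun k l => (h.pderiv_pderiv_zero k l).symm.trans (h'.pderiv_pderiv_zero k l)⟩

lemma HasJet.differentiableAt (h : HasJet e F c D H) : DifferentiableAt ℝ F 0 :=
  h.contDiffAt.differentiableAt two_ne_zero

lemma HasJet.eventually_differentiableAt (h : HasJet e F c D H) :
    ∀ᶠ x in 𝓝 0, DifferentiableAt ℝ F x :=
  (h.contDiffAt.eventually (by simp)).mono fun _ hx => hx.differentiableAt two_ne_zero

lemma HasJet.differentiableAt_pderiv (h : HasJet e F c D H) (i : Fin d) :
    DifferentiableAt ℝ (pderiv i F) 0 :=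
  (contDiffAt_pderiv h.contDiffAt one_add_one_eq_two.le).differentiableAt one_ne_zero

lemma HasJet.const (c : ℝ) : HasJet e (fun _ => c) c 0 0 where
  contDiffAt := contDiffAt_const
  apply_zero := rfl
  pderiv_zero k := pderiv_const c
  pderiv_pderiv_zero k l := by
    rw [show pderiv (e.symm l) (fun _ => c) = fun _ => 0 from funext fun _ => pderiv_const c,
      pderiv_const, Pi.zero_apply, Pi.zero_apply]

lemma pderiv_coord (i k : Fin d) (x : Fin d → ℝ) :
    pderiv k (fun x => x i) x = if k = i then 1 else 0 := by
  rw [pderiv, (hasFDerivAt_apply (𝕜 := ℝ) i x).fderiv]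
  simp [Pi.single_apply, eq_comm]

lemma HasJet.coord [DecidableEq κ] (i : κ) :
    HasJet e (fun x => x (e.symm i)) 0 (fun k => if k = i then 1 else 0) 0 where
  contDiffAt := by fun_prop
  apply_zero := rfl
  pderiv_zero k := by simp [pderiv_coord]
  pderiv_pderiv_zero k l := by
    rw [show pderiv (e.symm l) (fun x => x (e.symm i)) = fun _ => _ from
      funext (pderiv_coord _ _), pderiv_const, Pi.zero_apply, Pi.zero_apply]

lemma HasJet.add (h : HasJet e F c D H) (h' : HasJet e F' c' D' H') :
    HasJet e (fun x => F x + F' x) (c + c') (fun k => D k + D' k) (fun k l => H k l + H' k l) := by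
  have hpderiv : ∀ k, pderiv (e.symm k) (fun x => F x + F' x) =ᶠ[𝓝 0]
      fun x => pderiv (e.symm k) F x + pderiv (e.symm k) F' x := fun k =>
    (h.eventually_differentiableAt.and h'.eventually_differentiableAt).mono
      fun _ hx => pderiv_add hx.1 hx.2
  refine ⟨h.contDiffAt.add h'.contDiffAt, by rw [h.apply_zero, h'.apply_zero], fun k => ?_,
    fun k l => ?_⟩
  · simp only [(hpderiv k).self_of_nhds, h.pderiv_zero, h'.pderiv_zero]
  · rw [pderiv_congr (hpderiv l), pderiv_add (h.differentiableAt_pderiv _)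
      (h'.differentiableAt_pderiv _), h.pderiv_pderiv_zero, h'.pderiv_pderiv_zero]

lemma HasJet.mul (h : HasJet e F c D H) (h' : HasJet e F' c' D' H') :
    HasJet e (fun x => F x * F' x) (c * c') (fun k => c * D' k + D k * c')
      (fun k l => c * H' k l + D k * D' l + D l * D' k + H k l * c') := by
  have hpderiv : ∀ k, pderiv (e.symm k) (fun x => F x * F' x) =ᶠ[𝓝 0]
      fun x => F x * pderiv (e.symm k) F' x + pderiv (e.symm k) F x * F' x := fun k =>
    (h.eventually_differentiableAt.and h'.eventually_differentiableAt).mono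
      fun _ hx => pderiv_mul hx.1 hx.2
  refine ⟨h.contDiffAt.mul h'.contDiffAt, by rw [h.apply_zero, h'.apply_zero], fun k => ?_,
    fun k l => ?_⟩
  · simp only [(hpderiv k).self_of_nhds, h.pderiv_zero, h'.pderiv_zero, h.apply_zero,
      h'.apply_zero]
  · have hF' := h'.differentiableAt_pderiv (e.symm l)
    have hF := h.differentiableAt_pderiv (e.symm l)
    rw [pderiv_congr (hpderiv l), pderiv_add (h.differentiableAt.fun_mul hF')
      (hF.fun_mul h'.differentiableAt), pderiv_mul h.differentiableAt hF',
      pderiv_mul hF h'.differentiableAt, h.pderiv_pderiv_zero, h'.pderiv_pderiv_zero,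
      h.pderiv_zero, h.pderiv_zero, h'.pderiv_zero, h'.pderiv_zero, h.apply_zero, h'.apply_zero]
    ring

lemma HasJet.const_mul (a : ℝ) (h : HasJet e F c D H) :
    HasJet e (fun x => a * F x) (a * c) (fun k => a * D k) (fun k l => a * H k l) :=
  ((HasJet.const a).mul h).cast rfl (by simp) (by simp)

lemma HasJet.sum {ι : Type*} {s : Finset ι} {F : ι → (Fin d → ℝ) → ℝ} {c : ι → ℝ} {D : ι → κ → ℝ}
    {H : ι → κ → κ → ℝ} (h : ∀ i ∈ s, HasJet e (F i) (c i) (D i) (H i)) :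
    HasJet e (fun x => ∑ i ∈ s, F i x) (∑ i ∈ s, c i) (fun k => ∑ i ∈ s, D i k)
      (fun k l => ∑ i ∈ s, H i k l) := by
  classical
  induction s using Finset.induction_on with
  | empty => exact (HasJet.const 0).cast (by simp) (by simp) (by simp)
  | insert i s hi ih =>
    simp only [Finset.sum_insert hi]
    exact (h i (Finset.mem_insert_self i s)).add
      (ih fun j hj => h j (Finset.mem_insert_of_mem hj))

lemma HasJet.sum_coord_sq [DecidableEq κ] {ι : Type*} (s : Finset ι) (f : ι → κ) :
    HasJet e (fun x => ∑ i ∈ s, x (e.symm (f i)) ^ 2) 0 0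
      (fun k l => ∑ i ∈ s, if k = f i ∧ l = f i then 2 else 0) := by
  simp only [sq]
  refine (HasJet.sum fun i _ => (HasJet.coord (f i)).mul (HasJet.coord (f i))).cast
    (by simp) (by simp) fun k l => Finset.sum_congr rfl fun i _ => ?_
  by_cases hk : k = f i <;> by_cases hl : l = f i <;> simp [hk, hl, one_add_one_eq_two]

lemma HasJet.of_mul_one_add_eq_one (hF : ContDiffAt ℝ 2 F 0) (h' : HasJet e F' 0 0 H')
    (hmul : ∀ x, F x * (1 + F' x) = 1) : HasJet e F 1 0 (fun k l => -H' k l) := by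
  have hjet := HasJet.of_contDiffAt (e := e) hF
  have hprod := (hjet.mul ((HasJet.const 1).add h')).congr (F' := fun _ => 1)
    (.of_forall fun x => (hmul x).symm)
  obtain ⟨hc, hD, hH⟩ := hprod.unique (HasJet.const 1)
  have hF_zero : F 0 = 1 := by simpa using hc
  refine hjet.cast hF_zero (fun k => by simpa using congrFun hD k) fun k l => ?_
  have hH_apply := congrFun₂ hH k l
  simp only [hF_zero, Pi.zero_apply, add_zero, zero_add, mul_zero, mul_one, one_mul] at hH_apply
  linarith

end Jets

section SndDeriv

variable {V W : Type*} [NormedAddCommGroup V] [NormedSpace ℝ V] [NormedAddCommGroup W]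
  [NormedSpace ℝ W] {Φ : V × W → ℝ} {q : V}

/-- The derivative of a function of two variables in the direction `X` of the second variable. -/
def sndDeriv (X : W) (Φ : V × W → ℝ) (z : V × W) : ℝ := fderiv ℝ Φ z (0, X)

@[simp] lemma sndDeriv_zero_left (Φ : V × W → ℝ) : sndDeriv 0 Φ = 0 :=
  funext fun z => map_zero (fderiv ℝ Φ z)

@[simp] lemma sndDeriv_zero_right (X : W) : sndDeriv X (0 : V × W → ℝ) = 0 := by
  funext z
  simp [sndDeriv]

lemma contDiffAt_sndDeriv {m n : WithTop ℕ∞} {z : V × W} (hΦ : ContDiffAt ℝ n Φ z)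
    (hmn : m + 1 ≤ n) (X : W) : ContDiffAt ℝ m (sndDeriv X Φ) z :=
  (hΦ.fderiv_right hmn).clm_apply contDiffAt_const

lemma sndDeriv_eq_of_hasDerivAt {X : W} {c : ℝ} (hΦ : DifferentiableAt ℝ Φ (q, 0))
    (h : HasDerivAt (fun s : ℝ => Φ (q, s • X)) c 0) : sndDeriv X Φ (q, 0) = c := by
  have hline : HasDerivAt (fun s : ℝ => (q, s • X)) (0, X) 0 := by
    simpa using (hasDerivAt_const (0 : ℝ) q).prodMk ((hasDerivAt_id (0 : ℝ)).smul_const X)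
  rw [← zero_smul ℝ X] at hΦ
  simpa [sndDeriv] using (hΦ.hasFDerivAt.comp_hasDerivAt (0 : ℝ) hline).unique h

variable {d : ℕ} (L : (Fin d → ℝ) →L[ℝ] W)

lemma pderiv_comp_prodMk {x : Fin d → ℝ} (hΦ : DifferentiableAt ℝ Φ (q, L x)) (i : Fin d) :
    pderiv i (fun x => Φ (q, L x)) x = sndDeriv (L (Pi.single i 1)) Φ (q, L x) := by
  have hcomp : HasFDerivAt (fun x => Φ (q, L x)) _ x :=
    hΦ.hasFDerivAt.comp x ((hasFDerivAt_const q x).prodMk L.hasFDerivAt)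
  rw [pderiv, hcomp.fderiv]
  rfl

lemma hasJet_comp_prodMk {κ : Type*} (e : Fin d ≃ κ) (hΦ : ContDiffAt ℝ 2 Φ (q, 0)) :
    HasJet e (fun x => Φ (q, L x)) (Φ (q, 0))
      (fun k => sndDeriv (L (Pi.single (e.symm k) 1)) Φ (q, 0))
      (fun k l => sndDeriv (L (Pi.single (e.symm k) 1))
        (sndDeriv (L (Pi.single (e.symm l) 1)) Φ) (q, 0)) := by
  have hL : (q, L 0) = (q, 0) := by rw [map_zero]
  rw [← hL] at hΦ ⊢
  have hcont : ContinuousAt (fun x => (q, L x)) 0 := by fun_prop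
  have hpderiv : ∀ i, pderiv i (fun x => Φ (q, L x)) =ᶠ[𝓝 0]
      fun x => sndDeriv (L (Pi.single i 1)) Φ (q, L x) := fun i =>
    (hcont.eventually (hΦ.eventually (by simp))).mono fun _ hx =>
      pderiv_comp_prodMk L (hx.differentiableAt two_ne_zero) i
  refine ⟨hΦ.comp (0 : Fin d → ℝ) (by fun_prop), rfl, fun k => (hpderiv _).self_of_nhds,
    fun k l => ?_⟩
  rw [pderiv_congr (hpderiv _), pderiv_comp_prodMk L]
  exact (contDiffAt_sndDeriv hΦ one_add_one_eq_two.le _).differentiableAt one_ne_zero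

end SndDeriv

section ParamJets

variable {m : ℕ} {t : ℝ}

lemma baseParam_single_inl (k : Fin 4) :
    baseParam m (Pi.single ((coordEquiv m).symm (.inl k)) 1) = quaternionBasis k := by
  simp [baseParam_apply, Pi.single_apply]

lemma baseParam_single_inr (a : Fin m × Fin 3) :
    baseParam m (Pi.single ((coordEquiv m).symm (.inr a)) 1) = 0 := by
  simp [baseParam_apply]

lemma fibreParam_single_inl (k : Fin 4) (s : Fin m) :
    fibreParam m t s (Pi.single ((coordEquiv m).symm (.inl k)) 1) = 0 := by
  simp [fibreParam_apply]

lemma fibreParam_single_inr (a : Fin m × Fin 3) (s : Fin m) :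
    fibreParam m t s (Pi.single ((coordEquiv m).symm (.inr a)) 1) =
      if s = a.1 then t⁻¹ • quaternionBasis a.2.succ else 0 := by
  rcases a with ⟨n, b⟩
  by_cases h : s = n
  · subst h; simp [fibreParam_apply, Pi.single_apply]
  · simp [fibreParam_apply, h]

lemma norm_sq_baseParam (x : Fin (3 * m + 4) → ℝ) :
    ‖baseParam m x‖ ^ 2 = ∑ k, x ((coordEquiv m).symm (.inl k)) ^ 2 := by
  simp only [← quaternionBasis.sum_sq_inner_right (baseParam m x), inner_baseParam]

lemma norm_sq_fibreParam (s : Fin m) (x : Fin (3 * m + 4) → ℝ) :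
    ‖fibreParam m t s x‖ ^ 2 = t⁻¹ ^ 2 * ∑ b, x ((coordEquiv m).symm (.inr (s, b))) ^ 2 := by
  rw [← real_inner_self_eq_norm_sq, inner_eq_sum_inner_quaternionBasis_succ (re_fibreParam x s)]
  simp only [inner_fibreParam, ← sq, mul_pow, Finset.mul_sum]

lemma hasJet_norm_sq_baseParam : HasJet (coordEquiv m) (fun x => ‖baseParam m x‖ ^ 2) 0 0
    (fun a b => match a, b with
      | .inl k, .inl l => if k = l then 2 else 0
      | _, _ => 0) := by
  simp only [norm_sq_baseParam]
  refine (HasJet.sum_coord_sq Finset.univ Sum.inl).cast rfl (fun _ => rfl) ?_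
  rintro (k | a) (l | b) <;> simp [ite_and, eq_comm]

lemma hasJet_norm_sq_fibreParam (s : Fin m) :
    HasJet (coordEquiv m) (fun x => ‖fibreParam m t s x‖ ^ 2) 0 0
      (fun a b => match a, b with
        | .inr k, .inr l => if k.1 = s ∧ k = l then 2 * t⁻¹ ^ 2 else 0
        | _, _ => 0) := by
  simp only [norm_sq_fibreParam]
  refine ((HasJet.sum_coord_sq Finset.univ fun b => Sum.inr (s, b)).const_mul _).cast
    (mul_zero _) (fun _ => mul_zero _) ?_
  rintro (k | ⟨n, b⟩) (l | ⟨n', b'⟩)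
  iterate 3 simp
  by_cases hn : n = s
  · subst hn
    simp [ite_and, eq_comm, mul_comm]
  · simp [hn]

lemma hasJet_projScale_sq_baseParam :
    HasJet (coordEquiv m) (fun x => projScale (baseParam m x) ^ 2) 1 0
      (fun a b => match a, b with
        | .inl k, .inl l => if k = l then -2 else 0
        | _, _ => 0) := by
  refine (HasJet.of_mul_one_add_eq_one (by fun_prop) hasJet_norm_sq_baseParam
    fun x => projScale_sq_mul _).cast rfl (fun _ => rfl) ?_
  rintro (k | a) (l | b) <;> simp [apply_ite]

lemma hasJet_projScale_sq_fibreParam (s : Fin m) :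
    HasJet (coordEquiv m) (fun x => projScale (fibreParam m t s x) ^ 2) 1 0
      (fun a b => match a, b with
        | .inr k, .inr l => if k.1 = s ∧ k = l then -(2 * t⁻¹ ^ 2) else 0
        | _, _ => 0) := by
  refine (HasJet.of_mul_one_add_eq_one (by fun_prop) (hasJet_norm_sq_fibreParam s)
    fun x => projScale_sq_mul _).cast rfl (fun _ => rfl) ?_
  rintro (k | a) (l | b) <;> simp only [neg_ite, neg_zero]

end ParamJets

section SectionCoeff

variable {m : ℕ} {p : Fin m → ℍ[ℝ] × ℍ[ℝ]}

/-- The component `a` of the pull-back of the connection form by the local section, evaluated on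
`quaternionBasis i`. -/
def sectionCoeff (m : ℕ) (i : Fin 4) (a : Fin m × Fin 3) (z : (Fin m → ℍ[ℝ] × ℍ[ℝ]) × ℍ[ℝ]) : ℝ :=
  inner ℝ (quaternionBasis a.2.succ) (sectionForm m z (quaternionBasis i) a.1)

/-- The first derivatives of `sectionCoeff` at the centre of the local section. -/
def sectionCoeffD (m : ℕ) (p : Fin m → ℍ[ℝ] × ℍ[ℝ]) (k i : Fin 4) (a : Fin m × Fin 3) : ℝ :=
  sndDeriv (quaternionBasis k) (sectionCoeff m i a) (p, 0)

/-- The second derivatives of `sectionCoeff` at the centre of the local section. -/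
def sectionCoeffDD (m : ℕ) (p : Fin m → ℍ[ℝ] × ℍ[ℝ]) (k l i : Fin 4) (a : Fin m × Fin 3) : ℝ :=
  sndDeriv (quaternionBasis k) (sndDeriv (quaternionBasis l) (sectionCoeff m i a)) (p, 0)

lemma contDiffAt_sectionCoeff (hp : IsAdmissible m (zeroExtend p)) (i : Fin 4)
    (a : Fin m × Fin 3) : ContDiffAt ℝ ω (sectionCoeff m i a) (p, 0) :=
  contDiffAt_const.inner ℝ (contDiffAt_sectionForm (inSectionDomain_zero hp) _ _)

lemma hasJet_sectionCoeff (hm : 1 < m) (hp : IsAdmissible m (zeroExtend p)) (i : Fin 4)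
    (a : Fin m × Fin 3) :
    HasJet (coordEquiv m) (fun x => sectionCoeff m i a (p, baseParam m x)) 0
      (fun k => match k with
        | .inl k => sectionCoeffD m p k i a
        | .inr _ => 0)
      (fun k l => match k, l with
        | .inl k, .inl l => sectionCoeffDD m p k l i a
        | _, _ => 0) := by
  refine (hasJet_comp_prodMk (baseParam m) (coordEquiv m)
    ((contDiffAt_sectionCoeff hp i a).of_le le_top)).cast ?_ ?_ ?_
  · rw [sectionCoeff, (hasDerivAt_sectionForm_radial hm hp _ a.1.2).1, inner_zero_right]
  · rintro (k | b)
    · simp only [baseParam_single_inl, sectionCoeffD]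
    · simp only [baseParam_single_inr, sndDeriv_zero_left, Pi.zero_apply]
  · rintro (k | b) (l | c)
    · simp only [baseParam_single_inl, sectionCoeffDD]
    all_goals simp only [baseParam_single_inr, sndDeriv_zero_left, sndDeriv_zero_right,
      Pi.zero_apply]

lemma sectionForm_add_right {z : (Fin m → ℍ[ℝ] × ℍ[ℝ]) × ℍ[ℝ]} (X Y : ℍ[ℝ]) (n : ℕ) :
    sectionForm m z (X + Y) n = sectionForm m z X n + sectionForm m z Y n := by
  rw [sectionForm, sectionForm, sectionForm, ← connForm_zeroExtend_add, sectionVelocity,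
    sectionVelocity, sectionVelocity, ← map_add, Prod.mk_add_mk, add_zero]

lemma sectionForm_zero_right {z : (Fin m → ℍ[ℝ] × ℍ[ℝ]) × ℍ[ℝ]} (n : ℕ) :
    sectionForm m z 0 n = 0 := by
  simpa using sectionForm_add_right (z := z) 0 0 n

lemma sndDeriv_inner_sectionForm_self (hm : 1 < m) (hp : IsAdmissible m (zeroExtend p))
    (b X : ℍ[ℝ]) (n : Fin m) :
    sndDeriv X (fun z => inner ℝ b (sectionForm m z X n)) (p, 0) = 0 := by
  refine sndDeriv_eq_of_hasDerivAt ((contDiffAt_const.inner ℝ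
    (contDiffAt_sectionForm (inSectionDomain_zero hp) X n)).differentiableAt (by simp)) ?_
  simpa using (hasDerivAt_const (0 : ℝ) b).inner ℝ (hasDerivAt_sectionForm_radial hm hp X n.isLt).2

/- On the direction of a ray from the centre, the form vanishes to second order along that ray, so
its first derivative is alternating. -/
lemma sectionCoeffD_antisymm (hm : 1 < m) (hp : IsAdmissible m (zeroExtend p)) (k i : Fin 4)
    (a : Fin m × Fin 3) : sectionCoeffD m p k i a = -sectionCoeffD m p i k a := by
  let coeff (X : ℍ[ℝ]) (z : (Fin m → ℍ[ℝ] × ℍ[ℝ]) × ℍ[ℝ]) : ℝ :=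
    inner ℝ (quaternionBasis a.2.succ) (sectionForm m z X a.1)
  have hdiff (X : ℍ[ℝ]) : DifferentiableAt ℝ (coeff X) (p, 0) :=
    (contDiffAt_const.inner ℝ
      (contDiffAt_sectionForm (inSectionDomain_zero hp) X a.1)).differentiableAt (by simp)
  have hadd_left (X Y Z : ℍ[ℝ]) : sndDeriv (Y + Z) (coeff X) (p, 0) =
      sndDeriv Y (coeff X) (p, 0) + sndDeriv Z (coeff X) (p, 0) := by
    simp only [sndDeriv, ← map_add, Prod.mk_add_mk, add_zero]
  have hadd_right (X Y Z : ℍ[ℝ]) : sndDeriv Z (coeff (X + Y)) (p, 0) =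
      sndDeriv Z (coeff X) (p, 0) + sndDeriv Z (coeff Y) (p, 0) := by
    simp only [sndDeriv]
    rw [← add_apply, ← fderiv_add (hdiff X) (hdiff Y)]
    congr 2
    funext z
    simp only [coeff, sectionForm_add_right, inner_add_right, Pi.add_apply]
  have hself (X : ℍ[ℝ]) : sndDeriv X (coeff X) (p, 0) = 0 :=
    sndDeriv_inner_sectionForm_self hm hp _ X a.1
  have hpolar := hself (quaternionBasis k + quaternionBasis i)
  rw [hadd_left, hadd_right, hadd_right, hself, hself, zero_add, add_zero] at hpolar
  exact eq_neg_of_add_eq_zero_left hpolar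

end SectionCoeff

/-- The structure constants of the multiplication of `Im ℍ`, in the basis
`quaternionBasis b.succ`. -/
def structConst (c d b : Fin 3) : ℝ :=
  inner ℝ (quaternionBasis b.succ) (quaternionBasis c.succ * quaternionBasis d.succ)

lemma structConst_eq_ite (c d b : Fin 3) : structConst c d b =
    if d = c + 1 ∧ b = c + 2 then 1 else if d = c + 2 ∧ b = c + 1 then -1 else 0 := by
  simp only [structConst, Quaternion.inner_def, Quaternion.re_mul, Quaternion.imI_mul,
    Quaternion.imJ_mul, Quaternion.imK_mul, Quaternion.re_star, Quaternion.imI_star,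
    Quaternion.imJ_star, Quaternion.imK_star, quaternionBasis_eq]
  fin_cases c <;> fin_cases d <;> fin_cases b <;> simp

lemma structConst_antisymm (c d b : Fin 3) : structConst c d b = -structConst b d c := by
  simp only [structConst_eq_ite]
  fin_cases c <;> fin_cases d <;> fin_cases b <;> simp

lemma sum_structConst_mul_structConst (a d b d' : Fin 3) :
    ∑ c, structConst a d c * structConst b d' c =
      (if d = d' ∧ a = b then 1 else 0) - (if a = d' ∧ b = d then 1 else 0) := by
  simp only [structConst_eq_ite, Fin.sum_univ_three]
  fin_cases a <;> fin_cases d <;> fin_cases b <;> fin_cases d' <;> simp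

section Coframe

variable {m : ℕ} {t : ℝ} {p : Fin m → ℍ[ℝ] × ℍ[ℝ]}

/-- The values at the centre of the vertical coframe, that is of the components of `t` times the
connection form in the local parametrization. -/
def coframeVal : Fin 4 ⊕ (Fin m × Fin 3) → Fin m × Fin 3 → ℝ
  | .inl _, _ => 0
  | .inr c, a => if a = c then 1 else 0

/-- The first derivatives at the centre of the vertical coframe, when `f` is the first derivative of
the connection form along the section. -/
def coframeD (t : ℝ) (f : Fin 4 → Fin 4 → Fin m × Fin 3 → ℝ) :
    Fin 4 ⊕ (Fin m × Fin 3) → Fin m × Fin 3 → Fin 4 ⊕ (Fin m × Fin 3) → ℝ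
  | .inl i, a, .inl k => t * f k i a
  | .inr c, a, .inr d =>
    if a.1 = c.1 ∧ d.1 = c.1 then -(t⁻¹ * structConst c.2 d.2 a.2) else 0
  | _, _, _ => 0

/-- The second derivatives at the centre of the vertical coframe, when `s` is the second derivative
of the connection form along the section. -/
def coframeH (t : ℝ) (s : Fin 4 → Fin 4 → Fin 4 → Fin m × Fin 3 → ℝ) :
    Fin 4 ⊕ (Fin m × Fin 3) → Fin m × Fin 3 → Fin 4 ⊕ (Fin m × Fin 3) →
      Fin 4 ⊕ (Fin m × Fin 3) → ℝ
  | .inl i, a, .inl k, .inl l => t * s k l i a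
  | .inr c, a, .inr d, .inr d' =>
    if a = c ∧ d.1 = c.1 ∧ d = d' then -(2 * t⁻¹ ^ 2) else 0
  | _, _, _, _ => 0

/-- The component `a` of the vertical coframe on the `i`-th coordinate field of the local
parametrization. -/
def coframe (t : ℝ) (p : Fin m → ℍ[ℝ] × ℍ[ℝ]) (i : Fin 4 ⊕ (Fin m × Fin 3)) (a : Fin m × Fin 3)
    (x : Fin (3 * m + 4) → ℝ) : ℝ :=
  t * inner ℝ (quaternionBasis a.2.succ)
    (localForm m t p x (Pi.single ((coordEquiv m).symm i) 1) a.1)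

lemma hasJet_coframe_inl (hm : 1 < m) (hp : IsAdmissible m (zeroExtend p)) (i : Fin 4)
    (a : Fin m × Fin 3) :
    HasJet (coordEquiv m) (coframe t p (.inl i) a) (coframeVal (.inl i) a)
      (coframeD t (sectionCoeffD m p) (.inl i) a)
      (coframeH t (sectionCoeffDD m p) (.inl i) a) := by
  refine (((hasJet_sectionCoeff hm hp i a).const_mul t).congr (.of_forall fun x => ?_)).cast
    (mul_zero t) ?_ ?_
  · simp [coframe, localForm, maurerCartan, fibreParam_single_inl, baseParam_single_inl,
      sectionCoeff]
  · rintro (k | d) <;> simp [coframeD]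
  · rintro (k | d) (l | d') <;> simp [coframeH]

lemma coframe_inr_of_ne {a c : Fin m × Fin 3} (hac : a.1 ≠ c.1) (x : Fin (3 * m + 4) → ℝ) :
    coframe t p (.inr c) a x = 0 := by
  simp [coframe, localForm, maurerCartan, baseParam_single_inr, sectionForm_zero_right,
    fibreParam_single_inr, hac]

lemma coframe_inr_of_eq (ht : t ≠ 0) (n : Fin m) (b c : Fin 3) (x : Fin (3 * m + 4) → ℝ) :
    coframe t p (.inr (n, c)) (n, b) x = projScale (fibreParam m t n x) ^ 2 *
      ((if b = c then 1 else 0) + -1 * ∑ d : Fin 3,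
        (t⁻¹ * structConst c d b) * x ((coordEquiv m).symm (.inr (n, d)))) := by
  have hstruct : inner ℝ (quaternionBasis b.succ)
      (quaternionBasis c.succ * fibreParam m t n x) = ∑ d : Fin 3,
        (t⁻¹ * structConst c d b) * x ((coordEquiv m).symm (.inr (n, d))) := by
    simp only [fibreParam_apply, Finset.mul_sum, inner_sum, mul_smul_comm, real_inner_smul_right]
    exact Finset.sum_congr rfl fun d _ => by rw [structConst]; ring
  have him (q : ℍ[ℝ]) :
      inner ℝ (quaternionBasis b.succ) q.im = inner ℝ (quaternionBasis b.succ) q := by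
    rw [← Quaternion.sub_re_self, inner_sub_right, inner_quaternionBasis_succ_coe, sub_zero]
  simp only [coframe, localForm, maurerCartan, baseParam_single_inr, sectionForm_zero_right,
    zero_add, fibreParam_single_inr, if_true, real_inner_smul_right, inner_sub_right, him,
    smul_mul_assoc, hstruct, quaternionBasis.inner_eq_ite, Fin.succ_inj]
  field_simp
  ring

lemma hasJet_coframe_inr (ht : t ≠ 0) (f : Fin 4 → Fin 4 → Fin m × Fin 3 → ℝ)
    (s : Fin 4 → Fin 4 → Fin 4 → Fin m × Fin 3 → ℝ) (c a : Fin m × Fin 3) :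
    HasJet (coordEquiv m) (coframe t p (.inr c) a) (coframeVal (.inr c) a)
      (coframeD t f (.inr c) a) (coframeH t s (.inr c) a) := by
  rcases a with ⟨n, b⟩
  rcases c with ⟨n', c⟩
  rcases ne_or_eq n n' with hn | rfl
  · refine ((HasJet.const 0).congr (.of_forall fun x => coframe_inr_of_ne hn x)).cast ?_ ?_ ?_
    · simp [coframeVal, hn]
    · rintro (_ | d) <;> simp [coframeD, hn]
    · rintro (_ | d) (_ | d') <;> simp [coframeH, hn]
  · refine (((hasJet_projScale_sq_fibreParam n).mul
      ((HasJet.const (if b = c then (1 : ℝ) else 0)).add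
        ((HasJet.sum (s := Finset.univ) fun d _ => (HasJet.coord (Sum.inr (n, d))).const_mul
          (t⁻¹ * structConst c d b)).const_mul (-1)))).congr
      (.of_forall fun x => coframe_inr_of_eq ht n b c x)).cast ?_ ?_ ?_
    · simp [coframeVal]
    · rintro (k | ⟨n', d⟩)
      · simp [coframeD]
      · by_cases hn : n' = n <;> simp [coframeD, hn]
    · rintro (k | d) (l | d')
      iterate 3 simp [coframeH]
      by_cases hb : b = c <;> simp [coframeH, hb]

lemma hasJet_coframe (hm : 1 < m) (ht : t ≠ 0) (hp : IsAdmissible m (zeroExtend p))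
    (i : Fin 4 ⊕ (Fin m × Fin 3)) (a : Fin m × Fin 3) :
    HasJet (coordEquiv m) (coframe t p i a) (coframeVal i a)
      (coframeD t (sectionCoeffD m p) i a) (coframeH t (sectionCoeffDD m p) i a) := by
  rcases i with i | c
  · exact hasJet_coframe_inl hm hp i a
  · exact hasJet_coframe_inr ht _ _ c a

/-- The second derivatives of the connection metric in one base and one fibre direction, as they
enter `blockH`. -/
def mixedH (t : ℝ) (f : Fin 4 → Fin 4 → Fin m × Fin 3 → ℝ) (k i : Fin 4)
    (d a : Fin m × Fin 3) : ℝ :=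
  ∑ b, t * f k i b * coframeD t f (.inr a) b (.inr d)

/-- The second derivatives of the metric of the fibre `(S³)^m`, rescaled by `t ^ 2`, as they enter
`blockH`. -/
def fibreH (t : ℝ) (d d' a b : Fin m × Fin 3) : ℝ :=
  if d.1 = a.1 ∧ d'.1 = a.1 ∧ b.1 = a.1 then -(t⁻¹) ^ 2 *
    ((if d.2 = d'.2 ∧ a.2 = b.2 then 2 else 0) + (if a.2 = d'.2 ∧ b.2 = d.2 then 1 else 0) +
      (if a.2 = d.2 ∧ b.2 = d'.2 then 1 else 0)) else 0

lemma mixedH_antisymm {f : Fin 4 → Fin 4 → Fin m × Fin 3 → ℝ} (hf : ∀ k i a, f k i a = -f i k a)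
    (k i : Fin 4) (d a : Fin m × Fin 3) : mixedH t f k i d a = -mixedH t f i k d a := by
  rw [mixedH, mixedH, ← Finset.sum_neg_distrib]
  exact Finset.sum_congr rfl fun b _ => by rw [hf k i b]; ring

/- The left-hand side is the Ricci curvature of the fibre, a product of round spheres of radius
`t`. -/
lemma half_sum_fibreH (a b : Fin m × Fin 3) :
    (1 / 2) * ∑ d, (fibreH t d a b d + fibreH t d b a d - fibreH t d d a b - fibreH t b a d d) =
      if a = b then 2 / t ^ 2 else 0 := by
  have hterm (d : Fin m × Fin 3) :
      fibreH t d a b d + fibreH t d b a d - fibreH t d d a b - fibreH t b a d d =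
        if d.1 = a.1 then if a = b then t⁻¹ ^ 2 * (2 - if d.2 = a.2 then 2 else 0) else 0
          else 0 := by
    simp only [fibreH, Prod.ext_iff]
    grind
  simp only [hterm, Fintype.sum_prod_type, Finset.sum_ite_irrel, Finset.sum_const_zero,
    Finset.sum_ite_eq', Finset.mem_univ, if_true, ← Finset.mul_sum, Finset.sum_sub_distrib,
    Finset.sum_const, Finset.card_univ, Fintype.card_fin]
  split_ifs
  · rw [div_eq_mul_inv, inv_pow]
    ring
  · rw [mul_zero]

lemma sum_coframeVal_inr_mul (a : Fin m × Fin 3) (g : Fin m × Fin 3 → ℝ) :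
    ∑ x, coframeVal (.inr a) x * g x = g a := by
  simp [coframeVal]

lemma coframeD_inr_antisymm (f : Fin 4 → Fin 4 → Fin m × Fin 3 → ℝ) (a b d : Fin m × Fin 3) :
    coframeD t f (.inr b) a (.inr d) = -coframeD t f (.inr a) b (.inr d) := by
  simp only [coframeD]
  rcases ne_or_eq a.1 b.1 with h | h
  · simp [h, h.symm]
  · rw [structConst_antisymm, h]
    split_ifs <;> simp

lemma sum_coframeD_inr_mul_coframeD_inr (f : Fin 4 → Fin 4 → Fin m × Fin 3 → ℝ)
    (a b d d' : Fin m × Fin 3) :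
    ∑ x, coframeD t f (.inr a) x (.inr d) * coframeD t f (.inr b) x (.inr d') =
      if d.1 = a.1 ∧ d'.1 = a.1 ∧ b.1 = a.1 then t⁻¹ ^ 2 *
        ((if d.2 = d'.2 ∧ a.2 = b.2 then 1 else 0) - (if a.2 = d'.2 ∧ b.2 = d.2 then 1 else 0))
      else 0 := by
  have hterm (x : Fin m × Fin 3) :
      coframeD t f (.inr a) x (.inr d) * coframeD t f (.inr b) x (.inr d') =
        if x.1 = a.1 then if d.1 = a.1 ∧ d'.1 = a.1 ∧ b.1 = a.1 then t⁻¹ ^ 2 *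
          (structConst a.2 d.2 x.2 * structConst b.2 d'.2 x.2) else 0 else 0 := by
    simp only [coframeD]
    grind
  simp only [hterm, ← sum_structConst_mul_structConst, Fintype.sum_prod_type,
    Finset.sum_ite_irrel, Finset.sum_const_zero, Finset.sum_ite_eq', Finset.mem_univ, if_true,
    Finset.mul_sum]

lemma sum_coframe_inr_eq_fibreH (f : Fin 4 → Fin 4 → Fin m × Fin 3 → ℝ)
    (s : Fin 4 → Fin 4 → Fin 4 → Fin m × Fin 3 → ℝ) (a b d d' : Fin m × Fin 3) :
    ∑ x, (coframeVal (.inr a) x * coframeH t s (.inr b) x (.inr d) (.inr d') +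
        coframeD t f (.inr a) x (.inr d) * coframeD t f (.inr b) x (.inr d') +
        coframeD t f (.inr a) x (.inr d') * coframeD t f (.inr b) x (.inr d) +
        coframeH t s (.inr a) x (.inr d) (.inr d') * coframeVal (.inr b) x) =
      fibreH t d d' a b := by
  simp only [Finset.sum_add_distrib, sum_coframeVal_inr_mul, sum_coframeD_inr_mul_coframeD_inr,
    mul_comm _ (coframeVal _ _), coframeH, fibreH, Prod.ext_iff]
  grind

lemma inner_baseParam_single (i j : Fin 4 ⊕ (Fin m × Fin 3)) :
    inner ℝ (baseParam m (Pi.single ((coordEquiv m).symm i) 1))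
        (baseParam m (Pi.single ((coordEquiv m).symm j) 1)) =
      match i, j with
      | .inl i, .inl j => if i = j then 1 else 0
      | _, _ => 0 := by
  rcases i with i | a <;> rcases j with j | b <;>
    simp [baseParam_single_inl, baseParam_single_inr, quaternionBasis.inner_eq_ite]

lemma metricCoeff_connMetric_eventuallyEq (hm : 1 < m) (hp : IsAdmissible m (zeroExtend p))
    (i j : Fin 4 ⊕ (Fin m × Fin 3)) :
    (fun x => metricCoeff (connMetric m t) (localParam m t p) x
        ((coordEquiv m).symm i) ((coordEquiv m).symm j)) =ᶠ[𝓝 0]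
      fun x => (projScale (baseParam m x) ^ 2) * (projScale (baseParam m x) ^ 2) *
        inner ℝ (baseParam m (Pi.single ((coordEquiv m).symm i) 1))
          (baseParam m (Pi.single ((coordEquiv m).symm j) 1)) +
        ∑ a, coframe t p i a x * coframe t p j a x := by
  have hdom : ∀ᶠ x in 𝓝 0, InSectionDomain m (zeroExtend p) (baseParam m x) :=
    eventually_inSectionDomain (k := 0) (f := fun _ => zeroExtend p) (fun _ => contDiffAt_const)
      (baseParam m).contDiff.contDiffAt
      (by rw [map_zero]; exact inSectionDomain_zero hp)
  filter_upwards [hdom] with x hx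
  refine (connMetricFun_localParam hm hp hx _ _).trans ?_
  rw [Finset.mul_sum, sq (projScale _ ^ 2)]
  congr 1
  exact Finset.sum_congr rfl fun a _ => by rw [coframe, coframe]; ring

lemma sum_coframe_eq_blockD (f : Fin 4 → Fin 4 → Fin m × Fin 3 → ℝ)
    (k i j : Fin 4 ⊕ (Fin m × Fin 3)) :
    ∑ a, (coframeVal i a * coframeD t f j a k + coframeD t f i a k * coframeVal j a) =
      blockD t f k i j := by
  simp only [Finset.sum_add_distrib, mul_comm _ (coframeVal _ _)]
  rcases i with i | a <;> rcases j with j | b <;> rcases k with k | d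
  case inr.inr.inr =>
    rw [sum_coframeVal_inr_mul, sum_coframeVal_inr_mul, coframeD_inr_antisymm]
    simp [blockD]
  all_goals simp [coframeVal, coframeD, blockD]

lemma sum_coframe_eq_blockH (f : Fin 4 → Fin 4 → Fin m × Fin 3 → ℝ)
    (s : Fin 4 → Fin 4 → Fin 4 → Fin m × Fin 3 → ℝ) (k l i j : Fin 4 ⊕ (Fin m × Fin 3)) :
    (match k, l, i, j with
      | .inl k, .inl l, .inl i, .inl j => -4 * ((if k = l then 1 else 0) * (if i = j then 1 else 0))
      | _, _, _, _ => 0) +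
      ∑ a, (coframeVal i a * coframeH t s j a k l + coframeD t f i a k * coframeD t f j a l +
        coframeD t f i a l * coframeD t f j a k + coframeH t s i a k l * coframeVal j a) =
      blockH t f s (mixedH t f) (fibreH t) k l i j := by
  rcases i with i | a <;> rcases j with j | b <;> rcases k with k | d <;> rcases l with l | d'
  case inr.inr.inr.inr => rw [zero_add, sum_coframe_inr_eq_fibreH, blockH]
  case inl.inl.inl.inl =>
    simp only [coframeVal, coframeD, blockH, zero_mul, mul_zero, zero_add, add_zero,
      Finset.mul_sum]
    congr 1
    exact Finset.sum_congr rfl fun a _ => by ring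
  all_goals simp [coframeVal, coframeD, coframeH, blockH, mixedH, mul_comm]

lemma hasJet_metricCoeff (hm : 1 < m) (ht : t ≠ 0) (hp : IsAdmissible m (zeroExtend p))
    (i j : Fin 4 ⊕ (Fin m × Fin 3)) :
    HasJet (coordEquiv m) (fun x => metricCoeff (connMetric m t) (localParam m t p) x
        ((coordEquiv m).symm i) ((coordEquiv m).symm j))
      (if i = j then 1 else 0) (fun k => blockD t (sectionCoeffD m p) k i j)
      (fun k l => blockH t (sectionCoeffD m p) (sectionCoeffDD m p)
        (mixedH t (sectionCoeffD m p)) (fibreH t) k l i j) := by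
  have hscale := (hasJet_projScale_sq_baseParam (m := m)).mul hasJet_projScale_sq_baseParam
  have hvert := HasJet.sum (s := Finset.univ) fun a _ =>
    (hasJet_coframe hm ht hp i a).mul (hasJet_coframe hm ht hp j a)
  refine (((hscale.mul (HasJet.const _)).add hvert).congr
    (metricCoeff_connMetric_eventuallyEq hm hp i j)).cast ?_ (fun k => ?_) fun k l => ?_
  · rcases i with i | a <;> rcases j with j | b <;>
      simp [coframeVal, inner_baseParam_single, eq_comm]
  · rw [← sum_coframe_eq_blockD]
    simp
  · rw [← sum_coframe_eq_blockH, inner_baseParam_single]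
    congr 1
    rcases i with i | a <;> rcases j with j | b <;> rcases k with k | d <;> rcases l with l | d' <;>
      simp
    split_ifs <;> norm_num

end Coframe

/-! ### Positivity of the Ricci curvature -/

section Positivity

variable {m : ℕ} {t : ℝ} {p : Fin m → ℍ[ℝ] × ℍ[ℝ]}

lemma isClosed_Sp2m (m : ℕ) : IsClosed (Sp2m m) := by
  simp only [Sp2m, S7, Set.ofPred_and, Set.ofPred_forall]
  refine (isClosed_iInter fun i => isClosed_eq (by fun_prop) (by fun_prop)).inter
    (isClosed_iInter fun i => isClosed_iInter fun j => isClosed_iInter fun _ => ?_)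
  refine isClosed_eq ?_ (by unfold hopf; fun_prop)
  split_ifs
  · unfold hopf; fun_prop
  · unfold hopfTilde; fun_prop

lemma isCompact_Sp2m (m : ℕ) : IsCompact (Sp2m m) := by
  refine Metric.isCompact_of_isClosed_isBounded (isClosed_Sp2m m) ?_
  refine Metric.isBounded_closedBall (x := 0) (r := 1) |>.subset fun u hu => ?_
  rw [mem_closedBall_zero_iff, pi_norm_le_iff_of_nonneg zero_le_one]
  intro i
  have hi : ‖(u i).1‖ ^ 2 + ‖(u i).2‖ ^ 2 = 1 := hu.1 i
  rw [Prod.norm_def, sup_le_iff]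
  constructor <;> nlinarith [norm_nonneg (u i).1, norm_nonneg (u i).2]

lemma continuousOn_sectionCoeffD (k i : Fin 4) (a : Fin m × Fin 3) :
    ContinuousOn (fun p => sectionCoeffD m p k i a) (Sp2m m) := fun p hp => by
  have hcoeff := contDiffAt_sectionCoeff (mem_Sp2m_iff_isAdmissible.1 hp) i a
  exact ((contDiffAt_sndDeriv hcoeff (m := ω) le_rfl _).continuousAt.comp
    (f := fun p => (p, (0 : ℍ[ℝ]))) (by fun_prop)).continuousWithinAt

lemma continuousOn_sectionCoeffDD (k l i : Fin 4) (a : Fin m × Fin 3) :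
    ContinuousOn (fun p => sectionCoeffDD m p k l i a) (Sp2m m) := fun p hp => by
  have hcoeff := contDiffAt_sectionCoeff (mem_Sp2m_iff_isAdmissible.1 hp) i a
  have hderiv := contDiffAt_sndDeriv hcoeff (m := ω) le_rfl (quaternionBasis l)
  exact ((contDiffAt_sndDeriv hderiv (m := ω) le_rfl _).continuousAt.comp
    (f := fun p => (p, (0 : ℍ[ℝ]))) (by fun_prop)).continuousWithinAt

lemma exists_forall_abs_le_of_continuousOn {X ι : Type*} [TopologicalSpace X] [Finite ι]
    {s : Set X} (hs : IsCompact s) {F : ι → X → ℝ} (hF : ∀ i, ContinuousOn (F i) s) :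
    ∃ K, ∀ x ∈ s, ∀ i, |F i x| ≤ K := by
  cases nonempty_fintype ι
  obtain ⟨K, hK⟩ := hs.exists_bound_of_continuousOn (continuousOn_pi.2 hF)
  exact ⟨K, fun x hx i => (norm_le_pi_norm _ i).trans (hK x hx)⟩

lemma exists_forall_abs_sectionCoeff_le (m : ℕ) : ∃ K : ℝ, 0 ≤ K ∧ ∀ p ∈ Sp2m m,
    (∀ k i a, |sectionCoeffD m p k i a| ≤ K) ∧
    ∀ i a, |∑ k, (sectionCoeffDD m p k i k a - sectionCoeffDD m p k k i a)| ≤ K := by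
  obtain ⟨K₁, hK₁⟩ := exists_forall_abs_le_of_continuousOn (isCompact_Sp2m m)
    (F := fun (b : Fin 4 × Fin 4 × Fin m × Fin 3) p => sectionCoeffD m p b.1 b.2.1 b.2.2)
    fun b => continuousOn_sectionCoeffD b.1 b.2.1 b.2.2
  obtain ⟨K₂, hK₂⟩ := exists_forall_abs_le_of_continuousOn (isCompact_Sp2m m)
    (F := fun (b : Fin 4 × Fin m × Fin 3) p =>
      ∑ k, (sectionCoeffDD m p k b.1 k b.2 - sectionCoeffDD m p k k b.1 b.2))
    fun b => continuousOn_finsetSum _ fun k _ =>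
      (continuousOn_sectionCoeffDD k b.1 k b.2).sub (continuousOn_sectionCoeffDD k k b.1 b.2)
  refine ⟨max 0 (max K₁ K₂), le_max_left _ _, fun p hp => ⟨fun k i a => ?_, fun i a => ?_⟩⟩
  · exact (hK₁ p hp (k, i, a)).trans (le_max_of_le_right (le_max_left _ _))
  · exact (hK₂ p hp (i, a)).trans (le_max_of_le_right (le_max_right _ _))

lemma localForm_zero (hm : 1 < m) (hp : IsAdmissible m (zeroExtend p)) (v : Fin (3 * m + 4) → ℝ)
    (n : Fin m) : localForm m t p 0 v n = fibreParam m t n v := by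
  rw [localForm, map_zero, map_zero, (hasDerivAt_sectionForm_radial hm hp _ n.isLt).1, zero_add,
    maurerCartan, projScale_zero, mul_zero, Quaternion.im_zero, sub_zero, one_pow, one_smul]

lemma connMetric_fderiv_localParam_zero_self (hm : 1 < m) (ht : t ≠ 0)
    (hp : IsAdmissible m (zeroExtend p)) (v : Fin (3 * m + 4) → ℝ) :
    connMetric m t p (fderiv ℝ (localParam m t p) 0 v) (fderiv ℝ (localParam m t p) 0 v) =
      ∑ i, v i ^ 2 := by
  have hdom : InSectionDomain m (zeroExtend p) (baseParam m 0) := by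
    rw [map_zero]
    exact inSectionDomain_zero hp
  have h := connMetricFun_localParam (t := t) hm hp hdom v v
  rw [localParam_zero hp, map_zero, projScale_zero, one_pow, one_pow, one_mul,
    real_inner_self_eq_norm_sq, norm_sq_baseParam] at h
  simp only [localForm_zero hm hp, inner_fibreParam, Finset.mul_sum] at h
  rw [connMetric_apply, h, ← (coordEquiv m).symm.sum_comp, Fintype.sum_sum_type]
  congr 1
  exact Finset.sum_congr rfl fun a _ => by field_simp

lemma connMetric_pos (hm : 1 < m) (ht : t ≠ 0) (hp : p ∈ Sp2m m) {v : Fin m → ℍ[ℝ] × ℍ[ℝ]}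
    (hv : v ∈ tangentVectors (Sp2m m) p) (hv₀ : v ≠ 0) : 0 < connMetric m t p v v := by
  obtain ⟨ξ, rfl⟩ := exists_fderiv_localParam_eq hm ht hp hv
  obtain ⟨i, hi⟩ : ∃ i, ξ i ≠ 0 := Function.ne_iff.1 fun hξ => hv₀ (hξ ▸ map_zero _)
  rw [connMetric_fderiv_localParam_zero_self hm ht (mem_Sp2m_iff_isAdmissible.1 hp)]
  exact Finset.sum_pos' (fun _ _ => sq_nonneg _) ⟨i, Finset.mem_univ i, by positivity⟩

lemma isRiemannianMetric_connMetric (hm : 1 < m) (ht : t ≠ 0) :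
    IsRiemannianMetric (Sp2m m) (connMetric m t) :=
  isRiemannianMetric_of_apply contDiff_connMetric_apply (fun _ _ _ => connMetricFun_comm)
    fun _ hp _ hv hv₀ => connMetric_pos hm ht hp hv hv₀

lemma ricci_metricCoeff (hm : 1 < m) (ht : t ≠ 0) (hp : IsAdmissible m (zeroExtend p))
    (i j : Fin (3 * m + 4)) :
    ricci (metricCoeff (connMetric m t) (localParam m t p)) i j 0 =
      jetRicci (blockD t (sectionCoeffD m p)) (blockH t (sectionCoeffD m p) (sectionCoeffDD m p)
        (mixedH t (sectionCoeffD m p)) (fibreH t)) (coordEquiv m i) (coordEquiv m j) := by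
  have hjet : ∀ i j, HasJet (coordEquiv m)
      (fun x => metricCoeff (connMetric m t) (localParam m t p) x i j) _ _ _ := fun i j => by
    simpa using hasJet_metricCoeff hm ht hp (coordEquiv m i) (coordEquiv m j)
  rw [ricci_eq_jetRicci (fun i j => (hjet i j).contDiffAt), ← jetRicci_reindex (coordEquiv m)]
  · congr 1
    · funext k i j
      simpa using (hjet i j).pderiv_zero (coordEquiv m k)
    · funext k l i j
      simpa using (hjet i j).pderiv_pderiv_zero (coordEquiv m k) (coordEquiv m l)
  · ext i j
    rw [(hjet i j).apply_zero, Matrix.one_apply]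

theorem exists_hasPosRicci (hm : 1 < m) :
    ∃ t : ℝ, t ≠ 0 ∧ HasPosRicci (3 * m + 4) (Sp2m m) (connMetric m t) := by
  obtain ⟨K, hK, hbound⟩ := exists_forall_abs_sectionCoeff_le m
  set C : ℝ := 2 * Fintype.card (Fin 4) ^ 2 * Fintype.card (Fin m × Fin 3) * K ^ 2 +
    Fintype.card (Fin m × Fin 3) * K + Fintype.card (Fin 4) * K
  have hC₀ : 0 ≤ C := by positivity
  set t := (1 + C)⁻¹
  have ht : 0 < t := by positivity
  have ht_one : t ≤ 1 := inv_le_one_of_one_le₀ (by linarith)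
  have htC : t * C ≤ 1 := (inv_mul_le_one₀ (by positivity)).2 (by linarith)
  refine ⟨t, ht.ne', fun p hp => ?_⟩
  have hadm := mem_Sp2m_iff_isAdmissible.1 hp
  have hantisymm := sectionCoeffD_antisymm hm hadm
  obtain ⟨U, hU, hU₀⟩ := exists_isLocalParam hm ht.ne' hp
  refine ⟨U, localParam m t p, 0, hU, hU₀, localParam_zero hadm, fun v hv => ?_⟩
  have hv' : v ∘ (coordEquiv m).symm ≠ 0 := fun h => hv (funext fun i => by
    simpa using congrFun h (coordEquiv m i))
  have hpos := jetRicci_pos (s := sectionCoeffDD m p) (by simp) hantisymm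
    (mixedH_antisymm (t := t) hantisymm) half_sum_fibreH hK ht ht_one htC (hbound p hp).1
    (hbound p hp).2 hv'
  simp only [ricci_metricCoeff hm ht.ne' hadm]
  simpa [← (coordEquiv m).sum_comp] using hpos

lemma isSubmanifold_Sp2m (hm : 1 < m) : IsSubmanifold (3 * m + 4) (Sp2m m) := fun p hp => by
  obtain ⟨U, hU, hU₀⟩ := exists_isLocalParam hm one_ne_zero hp
  exact ⟨U, _, hU, 0, hU₀, localParam_zero (mem_Sp2m_iff_isAdmissible.1 hp)⟩

end Positivity

end Wilhelm

end

theorem mainTheorem10 (m : ℕ) (hm : 2 < m) :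
    Wilhelm.IsSubmanifold (3 * m + 4) (Wilhelm.Sp2m m) ∧
    Wilhelm.IsTrivialPrincipalS3Bundle (Wilhelm.Sp2m m) (Wilhelm.Sp2m (m - 1))
      (Wilhelm.forgetLast m) (Wilhelm.lastAction m) ∧
    Wilhelm.AreDiffeomorphic (Wilhelm.Sp2m m) (Wilhelm.S3pow (m - 2) ×ˢ Wilhelm.Sp2) ∧
    ∃ g : (Fin m → ℍ[ℝ] × ℍ[ℝ]) →
        (Fin m → ℍ[ℝ] × ℍ[ℝ]) →L[ℝ] (Fin m → ℍ[ℝ] × ℍ[ℝ]) →L[ℝ] ℝ,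
      Wilhelm.IsRiemannianMetric (Wilhelm.Sp2m m) g ∧
      Wilhelm.HasPosRicci (3 * m + 4) (Wilhelm.Sp2m m) g ∧
      ∀ p ∈ Wilhelm.S3, ∀ q ∈ Wilhelm.S3pow m,
        Wilhelm.PreservesMetric (Wilhelm.Sp2m m) g (Wilhelm.wilhelmAction m p q) := by
  obtain ⟨k, rfl⟩ : ∃ k, m = k + 3 := ⟨m - 3, by omega⟩
  obtain ⟨t, ht, hpos⟩ := Wilhelm.exists_hasPosRicci (m := k + 3) (by omega)
  exact ⟨Wilhelm.isSubmanifold_Sp2m (by omega), Wilhelm.isTrivialPrincipalS3Bundle_Sp2m k,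
    Wilhelm.areDiffeomorphic_Sp2m (k + 1), Wilhelm.connMetric (k + 3) t,
    Wilhelm.isRiemannianMetric_connMetric (by omega) ht, hpos,
    fun p hp q hq => Wilhelm.preservesMetric_wilhelmAction (by omega) t hp hq⟩
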